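/- Let $M$ be a real-analytic $n$-manifold with tangent bundle $\pi:TM\to M$ and induced coordinates $(x^i,y^i)$ on $TM$, let $J=dx^i\otimes\frac{\partial}{\partial y^i}$ be the canonical vertical endomorphism and $C=y^i\frac{\partial}{\partial y^i}$ the canonical vertical vector field. Let $S$ be an analytic spray on the slit tangent space $\mathcal TM=TM\setminus 0$, i.e. a vector field, analytic on $\mathcal TM$, with $JS=C$ and $[C,S]=S$. Put $\Gamma=[J,S]$ and let $h=\frac12(I+\Gamma)$, $v=I-h$ be its horizontal and vertical projectors. Let $\nabla$ be the Berwald connection of $S$ (so that $\nabla_{hX}JY=[h,JY]X$, $\nabla_{JX}JY=[J,JY]X$), and let $$\mathcal R(X,Y,Z)=\nabla_{hX}\nabla_{JY}JZ-\nabla_{JY}\nabla_{hX}JZ-\nabla_{[hX,JY]}JZ$$ be the Berwald curvature. Let $\mathfrak L\subset T(\mathcal TM)$ be the distribution generated by the horizontal vector fields, the image of $\mathcal R$, and their successive Lie brackets. For a function $E$ put $(g_E)_{ij}=\frac{\partial^2E}{\partial y^i\partial y^j}$ and $\Omega_E=dd_JE$. A Finsler metric of Landsberg type in a neighbourhood of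 $v\in\mathcal TM$ whose geodesics are given by $S$ is a smooth positive function $F$ on an open neighbourhood $U\subset\mathcal TM$ of $v$, positively homogeneous of degree $1$ along the fibres, such that, with $E=\frac12F^2$, on $U$ the form $g_E$ is positive definite, the Euler–Lagrange equation $i_S\Omega_E+d\mathcal L_CE-dE=0$ holds, and $(\nabla_{hX}g_E)(JY,JZ)=0$ for all $X,Y,Z$. **Theorem.** Let $v\in\mathcal TM$ and suppose that $\mathfrak L$ has constant rank in a neighbourhood of $v$. Then there exists a Finsler metric of Landsberg type in a neighbourhood of $v$ whose geodesics are given by $S$ if and only if both of the following hold: 1. $C_v\notin\mathfrak L_v$; 2. the kernel at $v$ of the first prolongation of the first-order system $$\mathcal L_CE-2E=0,\qquad X(E)=0\ \text{ for all sections } X \text{ of } \mathfrak L,$$ contains a positive definite initial condition. That is, there is a $2$-jet $j_{2,v}(\varphi)$ of a real function $\varphi$ on $TM$ at $v$ such that the $1$-jets at $v$ of $\mathcal L_C\varphi-2\varphi$ and of $X(\varphi)$, for every smooth local section $X$ of $\mathfrak L$ near $v$, all vanish, and such that the matrix $\bigl(\frac{\partial^2\varphi}{\partial y^i\partial y^j}(v)\bigr)$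 is positive definite. -/

import Mathlib

open Set Filter Topology
open scoped Manifold ContDiff

noncomputable section

namespace SprayGeometry

/-- The tangent bundle `TM` of an `n`-dimensional manifold `M`. -/
abbrev TM (n : ℕ) (M : Type*) [TopologicalSpace M] [ChartedSpace (EuclideanSpace ℝ (Fin n)) M] :=
  TangentBundle (𝓡 n) M

/-- A (not necessarily smooth) vector field on the total space `TM`. Fields are total functions;
only their values on the open set under consideration matter. -/
abbrev VF (n : ℕ) (M : Type*) [TopologicalSpace M] [ChartedSpace (EuclideanSpace ℝ (Fin n)) M]
    [IsManifold (𝓡 n) ω M] :=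
  (w : TM n M) → TangentSpace (𝓡 n).tangent w

section

variable {n : ℕ} {M : Type*} [TopologicalSpace M] [ChartedSpace (EuclideanSpace ℝ (Fin n)) M]
  [IsManifold (𝓡 n) ω M]

/-- The slit tangent space: the nonzero tangent vectors. -/
def slit (n : ℕ) (M : Type*) [TopologicalSpace M] [ChartedSpace (EuclideanSpace ℝ (Fin n)) M] :
    Set (TM n M) :=
  {w | w.2 ≠ 0}

/-- The vector field `X` on `TM` is of class `C^k` on `U` (`k = ∞`: smooth, `k = ω`: analytic). -/
def RegularOn (k : ℕ∞ω) (X : VF n M) (U : Set (TM n M)) : Prop :=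
  ContMDiffOn (𝓡 n).tangent (𝓡 n).tangent.tangent k
    (fun w => (⟨w, X w⟩ : TangentBundle (𝓡 n).tangent (TM n M))) U

/-- `φ : TM → ℝ` is smooth on `U`. -/
def SmoothFunOn (φ : TM n M → ℝ) (U : Set (TM n M)) : Prop :=
  ContMDiffOn (𝓡 n).tangent 𝓘(ℝ, ℝ) ∞ φ U

/-- The Lie derivative `X(φ) = 𝓛_X φ` of a function along a vector field. -/
def lieD (X : VF n M) (φ : TM n M → ℝ) : TM n M → ℝ :=
  fun w => (mfderiv (𝓡 n).tangent 𝓘(ℝ, ℝ) φ w (X w) : ℝ)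

/-- The Lie bracket `[X, Y]` of vector fields on `TM`. -/
def bracket (X Y : VF n M) : VF n M :=
  VectorField.mlieBracket (𝓡 n).tangent X Y

/-- The differential `π_* : T_w TM → T_{π(w)} M` of the projection `π : TM → M`. -/
def dproj (w : TM n M) (ξ : TangentSpace (𝓡 n).tangent w) : TangentSpace (𝓡 n) w.1 :=
  mfderiv (𝓡 n).tangent (𝓡 n) (fun u : TM n M => u.1) w ξ

/-- The vertical lift `T_{π(w)} M → T_w TM`: the velocity at `t = 0` of `t ↦ w + t a`. -/
def vlift (w : TM n M) (a : TangentSpace (𝓡 n) w.1) : TangentSpace (𝓡 n).tangent w :=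
  mfderiv 𝓘(ℝ, ℝ) (𝓡 n).tangent (fun t : ℝ => (⟨w.1, w.2 + t • a⟩ : TM n M)) 0 (1 : ℝ)

/-- The canonical vertical endomorphism `J`; in coordinates `J = dxⁱ ⊗ ∂/∂yⁱ`. -/
def J (X : VF n M) : VF n M := fun w => vlift w (dproj w (X w))

/-- The canonical vertical vector field `C`; in coordinates `C = yⁱ ∂/∂yⁱ`. -/
def C : VF n M := fun w => vlift w w.2

/-- `S` is an analytic spray: an analytic vector field on the slit tangent space with
`JS = C` and `[C, S] = S`. -/
structure IsAnalyticSpray (S : VF n M) : Prop where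
  analytic : RegularOn ω S (slit n M)
  J_eq : ∀ w ∈ slit n M, J S w = C w
  homogeneous : ∀ w ∈ slit n M, bracket C S w = S w

/-- The connection `Γ = [J, S]` (Frölicher–Nijenhuis bracket): `Γ X = [JX, S] - J[X, S]`. -/
def Gam (S X : VF n M) : VF n M := bracket (J X) S - J (bracket X S)

/-- The horizontal projector `h = (I + Γ) / 2`. -/
def hor (S X : VF n M) : VF n M := (1 / 2 : ℝ) • (X + Gam S X)

/-- The vertical projector `v = I - h`. -/
def ver (S X : VF n M) : VF n M := X - hor S X

/-- The almost complex structure `F = h[S, h] - J`, that is `F X = - h[S, vX] - JX`. It is the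
tensor characterized by `FJ = h` and `Fh = -J`. -/
def acs (S X : VF n M) : VF n M := -hor S (bracket S (ver S X)) - J X

/-- The Berwald connection `∇_W V` on vertical fields `V`, extended from
`∇_{hX} V = [h, V](hX) = v[hX, V]` and `∇_{JX} V = [J, V](X) = [JX, V] - J[X, V]` by additivity to
`W = hW + vW`, where `vW = JX` for `X = FW`. -/
def nabla (S W V : VF n M) : VF n M :=
  ver S (bracket (hor S W) V) + (bracket (ver S W) V - J (bracket (acs S W) V))

/-- The Berwald curvature
`ℛ(X, Y, Z) = ∇_{hX} ∇_{JY} JZ - ∇_{JY} ∇_{hX} JZ - ∇_{[hX, JY]} JZ`. -/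
def berwald (S X Y Z : VF n M) : VF n M :=
  nabla S (hor S X) (nabla S (J Y) (J Z)) - nabla S (J Y) (nabla S (hor S X) (J Z))
    - nabla S (bracket (hor S X) (J Y)) (J Z)

/-- The vector fields on the open set `U` obtained from the horizontal vector fields and the fields
in the image of the Berwald curvature by taking successive Lie brackets. -/
inductive Generated (S : VF n M) (U : Set (TM n M)) : VF n M → Prop
  | horizontal (X : VF n M) : RegularOn ∞ X U → Generated S U (hor S X)
  | curvature (X Y Z : VF n M) : RegularOn ∞ X U → RegularOn ∞ Y U → RegularOn ∞ Z U →
      Generated S U (berwald S X Y Z)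
  | lie (X Y : VF n M) : Generated S U X → Generated S U Y → Generated S U (bracket X Y)

/-- The distribution `𝔏` on the slit tangent space generated by the horizontal vector fields, the
image of the Berwald curvature and their successive Lie brackets. -/
def distL (S : VF n M) (w : TM n M) : Submodule ℝ (TangentSpace (𝓡 n).tangent w) :=
  Submodule.span ℝ {ξ | ∃ (U : Set (TM n M)) (X : VF n M), IsOpen U ∧ w ∈ U ∧ U ⊆ slit n M ∧
    Generated S U X ∧ X w = ξ}

/-- `X` is a smooth section of the distribution `𝔏` over `U`. -/
def IsSectionL (S X : VF n M) (U : Set (TM n M)) : Prop :=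
  RegularOn ∞ X U ∧ ∀ w ∈ U, X w ∈ distL S w

/-- The fundamental tensor `g_E` at `w`, as the second derivative of `E` along the fibre:
`g_E(a, b) = aⁱ bʲ ∂²E / ∂yⁱ∂yʲ` for `a, b ∈ T_{π(w)} M`. -/
def fund (E : TM n M → ℝ) (w : TM n M) (a b : TangentSpace (𝓡 n) w.1) : ℝ :=
  deriv (fun s : ℝ => deriv (fun t : ℝ => E ⟨w.1, w.2 + s • a + t • b⟩) 0) 0

/-- `g_E` is positive definite at `w`. -/
def FundPosDef (E : TM n M → ℝ) (w : TM n M) : Prop :=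
  ∀ a : TangentSpace (𝓡 n) w.1, a ≠ 0 → 0 < fund E w a a

/-- The function `g_E(JY, JZ)` on `TM`. -/
def gJ (E : TM n M → ℝ) (Y Z : VF n M) : TM n M → ℝ :=
  fun w => fund E w (dproj w (Y w)) (dproj w (Z w))

/-- The operator `P_c E = 𝓛_C E - 2E`. -/
def Pc (E : TM n M → ℝ) : TM n M → ℝ := fun w => lieD C E w - 2 * E w

/-- The 1-form `d_J E`, evaluated on a field: `d_J E (X) = (JX)(E)`. -/
def dJ (E : TM n M → ℝ) (X : VF n M) : TM n M → ℝ := lieD (J X) E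

/-- The 2-form `Ω_E = d d_J E`, evaluated on two fields. -/
def Omega (E : TM n M → ℝ) (X Y : VF n M) : TM n M → ℝ :=
  fun w => lieD X (dJ E Y) w - lieD Y (dJ E X) w - dJ E (bracket X Y) w

/-- The Euler–Lagrange form `P_e E = i_S Ω_E + d 𝓛_C E - dE`, evaluated on a field. -/
def Pe (S : VF n M) (E : TM n M → ℝ) (X : VF n M) : TM n M → ℝ :=
  fun w => Omega E S X w + lieD X (lieD C E) w - lieD X E w

/-- `P_g E (X, Y, Z) = (∇_{hX} g_E)(JY, JZ)`. Since `JF = v`, a vertical field `V` is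
`J(FV)`, so that `g_E(V, JZ) = g_E(J(FV), JZ)`. -/
def Pg (S : VF n M) (E : TM n M → ℝ) (X Y Z : VF n M) : TM n M → ℝ :=
  fun w => lieD (hor S X) (gJ E Y Z) w
    - gJ E (acs S (nabla S (hor S X) (J Y))) Z w
    - gJ E Y (acs S (nabla S (hor S X) (J Z))) w

/-- The energy function `E = F² / 2`. -/
def energy (F : TM n M → ℝ) : TM n M → ℝ := fun w => 1 / 2 * F w ^ 2

/-- `F` is a Finsler metric on the open set `U` of nonzero tangent vectors: smooth, positive,
positively homogeneous of degree one, with positive definite fundamental tensor. -/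
structure IsFinslerOn (F : TM n M → ℝ) (U : Set (TM n M)) : Prop where
  smooth : SmoothFunOn F U
  pos : ∀ w ∈ U, 0 < F w
  homogeneous : ∀ w ∈ U, ∀ c : ℝ, 0 < c → (⟨w.1, c • w.2⟩ : TM n M) ∈ U →
    F ⟨w.1, c • w.2⟩ = c * F w
  convex : ∀ w ∈ U, FundPosDef (energy F) w

/-- The geodesics of the Lagrangian `E` on `U` are given by `S`: the Euler–Lagrange equation
`P_e E = 0` holds on `U`. -/
def GeodesicsOn (S : VF n M) (E : TM n M → ℝ) (U : Set (TM n M)) : Prop :=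
  ∀ V ⊆ U, IsOpen V → ∀ X : VF n M, RegularOn ∞ X V → ∀ w ∈ V, Pe S E X w = 0

/-- The Landsberg condition `P_g E = 0` on `U`: the connection of `S` is metric for `g_E`. -/
def LandsbergOn (S : VF n M) (E : TM n M → ℝ) (U : Set (TM n M)) : Prop :=
  ∀ V ⊆ U, IsOpen V → ∀ X Y Z : VF n M, RegularOn ∞ X V → RegularOn ∞ Y V → RegularOn ∞ Z V →
    ∀ w ∈ V, Pg S E X Y Z w = 0

/-- There is a Finsler metric of Landsberg type, defined on a neighbourhood of `v` in the slit
tangent space, whose geodesics are given by `S`. -/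
def LandsbergMetrizableNear (S : VF n M) (v : TM n M) : Prop :=
  ∃ U : Set (TM n M), IsOpen U ∧ v ∈ U ∧ U ⊆ slit n M ∧ ∃ F : TM n M → ℝ,
    IsFinslerOn F U ∧ GeodesicsOn S (energy F) U ∧ LandsbergOn S (energy F) U

/-- `φ` and `ψ` have the same partial derivatives of all orders `≤ k` at `v`, in a chart. -/
def SameJet (k : ℕ) (v : TM n M) (φ ψ : TM n M → ℝ) : Prop :=
  ∀ i ≤ k, iteratedFDeriv ℝ i (φ ∘ (extChartAt (𝓡 n).tangent v).symm)
      (extChartAt (𝓡 n).tangent v v) =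
    iteratedFDeriv ℝ i (ψ ∘ (extChartAt (𝓡 n).tangent v).symm) (extChartAt (𝓡 n).tangent v v)

/-- The functions on `TM` that are smooth in a neighbourhood of `v`. -/
def LocalFun (v : TM n M) : Type _ :=
  {φ : TM n M → ℝ // ∃ U : Set (TM n M), IsOpen U ∧ v ∈ U ∧ SmoothFunOn φ U}

/-- Equality of `k`-jets at `v`, as an equivalence relation. -/
def jetSetoid (k : ℕ) (v : TM n M) : Setoid (LocalFun v) where
  r φ ψ := SameJet k v φ.1 ψ.1
  iseqv := ⟨fun _ _ _ => rfl, fun h i hi => (h i hi).symm,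
    fun h h' i hi => (h i hi).trans (h' i hi)⟩

/-- The space `J_{k,v}(ℝ_{TM})` of `k`-jets at `v` of real functions on `TM`. -/
def JetSpace (k : ℕ) (v : TM n M) : Type _ := Quotient (jetSetoid k v)

/-- The jet `j_{k,v}(φ)`. -/
def jet (k : ℕ) (v : TM n M) (φ : LocalFun v) : JetSpace k v := Quotient.mk (jetSetoid k v) φ

/-- The kernel at `v` of the first prolongation of the reduced system
`𝓛_C E - 2E = 0`, `d_ℓ E = 0` (that is, `X(E) = 0` for the sections `X` of `𝔏`): the 2-jets
`j_{2,v}(φ)` such that the 1-jets at `v` of `𝓛_C φ - 2φ` and of every `X(φ)` vanish. -/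
def prolongedKernel (S : VF n M) (v : TM n M) : Set (JetSpace 2 v) :=
  {p | ∃ φ : LocalFun v, jet 2 v φ = p ∧ SameJet 1 v (Pc φ.1) 0 ∧
    ∀ (U : Set (TM n M)) (X : VF n M), IsOpen U → v ∈ U → U ⊆ slit n M → IsSectionL S X U →
      SameJet 1 v (lieD X φ.1) 0}

/-- A 2-jet `p` at `v` is a positive definite initial condition when its components
`∂²/∂yⁱ∂yʲ` form a positive definite quadratic form. -/
def PosDefJet (v : TM n M) (p : JetSpace 2 v) : Prop :=
  ∃ φ : LocalFun v, jet 2 v φ = p ∧ FundPosDef φ.1 v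

end

end SprayGeometry

end

/-!
The equivalence is proved in the smooth category; analyticity of the spray enters only through the
smoothness it implies.

In the coordinates `(x, y)` of `TM` the spray is `(y, σ)`, the connection coefficients are
`N = -½ ∂σ/∂y`, and the Berwald connection and curvature are `B = ∂N/∂y` and `-R`, `R = ∂B/∂y`
(`flatHor_eq`, `flatNabla_eq`, `flatBerwald_eq`). For a function `E` with fibre derivative `η`:

* if `E` is two-homogeneous, the Euler–Lagrange equation holds if and only if `E` is constant along
  the horizontal distribution (`horConst_of_eulerLagrange`, `eulerLagrange_of_horConst`);
* if `E` is constant along the horizontal distribution, the covariant derivative of its fundamental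
  tensor is `η ∘ R` (`landsberg_eq_of_horConst`).

So the energy of a metric of the required type is exactly a positive definite solution of the
reduced system `C(E) = 2E`, `X(E) = 0` for `X` in `𝔏`, and `C ∉ 𝔏` follows from `C(E) = 2E ≠ 0`.

Conversely, bracketing with `C` preserves the combinations of generated fields
(`Generated.exists_bracket_C`): `C` commutes with the horizontal projector by homogeneity of `N`,
the curvature is homogeneous of degree `-1`, and the Jacobi identity takes care of iterated
brackets. Where `𝔏` has constant rank, `C` together with a frame of generated fields of `𝔏` is
therefore an involutive frame, with all brackets in `𝔏`. Frobenius' theorem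
(`exists_solution_of_compatible`, `exists_graph_of_involutive`) makes the linear system
`Z(E) = ℓ(Z) E` solvable with arbitrary data on a transverse slice, and choosing the `2`-jet of the
data as prescribed gives a solution with that `2`-jet (`exists_solution_of_jet`). Positivity of
`E = ½ g(y, y)` and of `g` persists near `v`, and `√(2E)` is the metric.

Frobenius' theorem with smooth dependence on parameters is obtained by solving along rays: the
integral equation on a space of continuous maps on `[0, 1]` is solved by the implicit function
theorem (`exists_radial_solution`).
-/

noncomputable section

universe u

/-! ### Composition operators on spaces of continuous maps -/

section Nemytskii

variable {K : Type*} [TopologicalSpace K] [CompactSpace K]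

/-- Pointwise application of a continuous family of operators to a continuous map. -/
def ContinuousMap.applyCLM (K : Type*) [TopologicalSpace K] [CompactSpace K] (X Y : Type*)
    [NormedAddCommGroup X] [NormedSpace ℝ X] [NormedAddCommGroup Y] [NormedSpace ℝ Y] :
    C(K, X →L[ℝ] Y) →L[ℝ] C(K, X) →L[ℝ] C(K, Y) :=
  LinearMap.mkContinuous₂
    (LinearMap.mk₂ ℝ (fun (a : C(K, X →L[ℝ] Y)) (x : C(K, X)) =>
      (⟨fun k => a k (x k), by fun_prop⟩ : C(K, Y)))
      (fun a a' x => by ext k; simp) (fun c a x => by ext k; simp)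
      (fun a x x' => by ext k; simp) (fun c a x => by ext k; simp)) 1
    (fun a x => by
      rw [one_mul, ContinuousMap.norm_le _ (by positivity)]
      exact fun k => ((a k).le_opNorm _).trans (mul_le_mul (a.norm_coe_le_norm k)
        (x.norm_coe_le_norm k) (norm_nonneg _) (norm_nonneg a)))

/-- The derivative of `γ ↦ g ∘ γ` is the pointwise multiplication by `g' ∘ γ`. -/
theorem ContinuousMap.hasFDerivAt_comp {X Y : Type*}
    [NormedAddCommGroup X] [NormedSpace ℝ X] [NormedAddCommGroup Y] [NormedSpace ℝ Y]
    {g : C(X, Y)} {g' : C(X, X →L[ℝ] Y)} (hg : ∀ x, HasFDerivAt g (g' x) x) (γ : C(K, X)) :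
    HasFDerivAt (fun γ : C(K, X) => g.comp γ)
      (ContinuousMap.applyCLM K X Y (g'.comp γ)) γ := by
  rw [hasFDerivAt_iff_isLittleO_nhds_zero, Asymptotics.isLittleO_iff]
  intro c hc
  have hcont : Continuous fun γ : C(K, X) => g'.comp γ := g'.continuous_postcomp
  obtain ⟨δ, hδ, H⟩ := (Metric.continuous_iff (f := fun γ : C(K, X) => g'.comp γ)).1 hcont γ c hc
  filter_upwards [Metric.ball_mem_nhds (0 : C(K, X)) hδ] with η hη
  rw [mem_ball_zero_iff] at hη
  rw [ContinuousMap.norm_le _ (by positivity)]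
  intro k
  have key := Convex.norm_image_sub_le_of_norm_hasFDerivWithin_le'
    (s := segment ℝ (γ k) (γ k + η k)) (f := g) (f' := fun x => g' x) (φ := g' (γ k)) (C := c)
    (fun x _ => (hg x).hasFDerivWithinAt) ?_ (convex_segment _ _) (left_mem_segment ℝ _ _)
    (right_mem_segment ℝ _ _)
  · have h2 : c * ‖η k‖ ≤ c * ‖η‖ := by gcongr; exact η.norm_coe_le_norm k
    simp only [add_sub_cancel_left] at key
    exact key.trans h2
  · intro x hx
    rw [segment_eq_image'] at hx
    obtain ⟨s, ⟨hs0, hs1⟩, rfl⟩ := hx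
    have hd : dist (γ + s • η) γ < δ := by
      rw [dist_eq_norm, add_sub_cancel_left, norm_smul, Real.norm_of_nonneg hs0]
      exact lt_of_le_of_lt (mul_le_of_le_one_left (norm_nonneg _) hs1) hη
    have h3 := (ContinuousMap.dist_apply_le_dist k).trans (H _ hd).le
    simpa [dist_eq_norm] using h3

/-- Composition with a smooth map is a smooth operator on continuous maps: its derivative is
multiplication by the derivative of the map, which is a composition operator again. -/
theorem ContinuousMap.contDiff_comp {X Y : Type u} [NormedAddCommGroup X] [NormedSpace ℝ X]
    [NormedAddCommGroup Y] [NormedSpace ℝ Y] (g : C(X, Y)) (hg : ContDiff ℝ ∞ g) :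
    ContDiff ℝ ∞ fun γ : C(K, X) => g.comp γ := by
  rw [contDiff_infty]
  intro n
  induction n generalizing Y with
  | zero => exact contDiff_zero.2 g.continuous_postcomp
  | succ n ih =>
    have hg1 : ContDiff ℝ ∞ (fderiv ℝ g) := hg.fderiv_right (by simp)
    let g' : C(X, X →L[ℝ] Y) := ⟨fderiv ℝ g, hg1.continuous⟩
    have := contDiff_succ_iff_hasFDerivAt (n := n) (𝕜 := ℝ) (f := fun γ : C(K, X) => g.comp γ)
    rw [Nat.cast_succ]
    have h1 : ContDiff ℝ n fun γ : C(K, X) => g'.comp γ := ih g' hg1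
    have h2 : ContDiff ℝ n fun a : C(K, X →L[ℝ] Y) => ContinuousMap.applyCLM K X Y a :=
      ContinuousLinearMap.contDiff (𝕜 := ℝ) (E := C(K, X →L[ℝ] Y))
        (F := C(K, X) →L[ℝ] C(K, Y)) (ContinuousMap.applyCLM K X Y)
    exact this.2 ⟨fun γ => ContinuousMap.applyCLM K X Y (g'.comp γ), h2.comp h1, fun γ =>
        ContinuousMap.hasFDerivAt_comp (g' := g')
          (fun x => (hg.differentiable (by simp) x).hasFDerivAt) γ⟩

end Nemytskii

/-! ### Smoothness of implicit functions near the base point -/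

section Implicit

variable {E₁ E₂ F : Type*} [NormedAddCommGroup E₁] [NormedSpace ℝ E₁] [CompleteSpace E₁]
  [NormedAddCommGroup E₂] [NormedSpace ℝ E₂] [CompleteSpace E₂]
  [NormedAddCommGroup F] [NormedSpace ℝ F] [CompleteSpace F]

/-- The implicit function of a smooth map is smooth on a whole neighbourhood of the base point:
near the base point it coincides with the implicit functions at the points of its graph. -/
theorem ContDiff.eventually_contDiffAt_implicitFunction {f : E₁ × E₂ → F} (hf : ContDiff ℝ ∞ f)
    (u : E₁ × E₂) (h : (fderiv ℝ f u ∘L .inr ℝ E₁ E₂).IsInvertible) :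
    ∀ᶠ x in 𝓝 u.1, ContDiffAt ℝ ∞ (hf.contDiffAt.implicitFunction (by simp) h) x := by
  set ψ := hf.contDiffAt.implicitFunction (u := u) (by simp) h with hψ
  have hψu : ψ u.1 = u.2 := hf.contDiffAt.implicitFunction_apply_self _ h
  have hψc : ∀ᶠ x in 𝓝 u.1, ContinuousAt ψ x := by
    have h1 : ContDiffAt ℝ 1 ψ u.1 :=
      (hf.contDiffAt.contDiffAt_implicitFunction (by simp) h).of_le (by simp)
    exact (h1.eventually (by simp)).mono fun x hx => hx.continuousAt
  have hgr : Tendsto (fun x => (x, ψ x)) (𝓝 u.1) (𝓝 u) := by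
    have := continuousAt_id.prodMk hψc.self_of_nhds
    simpa [ContinuousAt, hψu] using this
  have hinv : ∀ᶠ v in 𝓝 u, (fderiv ℝ f v ∘L .inr ℝ E₁ E₂).IsInvertible := by
    have hc : Continuous fun v => fderiv ℝ f v ∘L .inr ℝ E₁ E₂ :=
      (hf.continuous_fderiv (by simp)).clm_comp continuous_const
    obtain ⟨e, he⟩ := h
    have := (ContinuousLinearEquiv.nhds e)
    rw [he] at this
    exact hc.continuousAt.eventually this
  have hiff := hf.contDiffAt.eventually_apply_eq_iff_implicitFunction (u := u) (by simp) h
  filter_upwards [hgr.eventually hinv, hgr.eventually hiff.eventually_nhds, hψc,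
    hf.contDiffAt.eventually_apply_implicitFunction (u := u) (by simp) h] with x h1 h2 h3 h4
  set u' : E₁ × E₂ := (x, ψ x)
  set ψ' := hf.contDiffAt.implicitFunction (u := u') (by simp) h1
  have hs : ContDiffAt ℝ ∞ ψ' u'.1 := hf.contDiffAt.contDiffAt_implicitFunction (by simp) h1
  have hself : ψ' u'.1 = u'.2 := hf.contDiffAt.implicitFunction_apply_self _ h1
  have hgr' : Tendsto (fun z => (z, ψ' z)) (𝓝 x) (𝓝 u') := by
    have := continuousAt_id.prodMk hs.continuousAt
    rw [ContinuousAt, hself] at this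
    exact this
  refine hs.congr_of_eventuallyEq ?_
  filter_upwards [hgr'.eventually h2,
    hf.contDiffAt.eventually_apply_implicitFunction (u := u') (by simp) h1] with z hz hz'
  exact hz.1 (hz'.trans h4)

end Implicit

/-! ### The radial equation -/

section Radial

local notation "𝕀" => Icc (0 : ℝ) 1

/-- The primitive vanishing at `0`, as an operator on `C([0, 1], F)`. -/
def primitiveCLM (F : Type*) [NormedAddCommGroup F] [NormedSpace ℝ F] :
    C(𝕀, F) →L[ℝ] C(𝕀, F) :=
  LinearMap.mkContinuous
    { toFun := fun η => ⟨fun t => ∫ s in (0 : ℝ)..t, η (projIcc 0 1 zero_le_one s), by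
        have h : Continuous fun s : ℝ => η (projIcc 0 1 zero_le_one s) := by fun_prop
        exact (intervalIntegral.continuous_primitive
          (fun a b => h.intervalIntegrable a b) 0).comp continuous_subtype_val⟩
      map_add' := fun η η' => by
        have h : ∀ η : C(𝕀, F), Continuous fun s : ℝ => η (projIcc 0 1 zero_le_one s) := by
          intro η; fun_prop
        ext t
        exact intervalIntegral.integral_add ((h η).intervalIntegrable _ _)
          ((h η').intervalIntegrable _ _)
      map_smul' := fun c η => by
        ext t
        exact intervalIntegral.integral_smul _ _ } 1
    (fun η => by
      rw [one_mul, ContinuousMap.norm_le _ (norm_nonneg _)]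
      rintro ⟨t, ht0, ht1⟩
      have := intervalIntegral.norm_integral_le_of_norm_le_const (a := 0) (b := t) (C := ‖η‖)
        (f := fun s => η (projIcc 0 1 zero_le_one s)) fun s _ => η.norm_coe_le_norm _
      refine this.trans (mul_le_of_le_one_right (norm_nonneg _) ?_)
      rwa [sub_zero, abs_of_nonneg ht0])

theorem primitiveCLM_apply {F : Type*} [NormedAddCommGroup F] [NormedSpace ℝ F]
    (η : C(𝕀, F)) (t : 𝕀) :
    primitiveCLM F η t = ∫ s in (0 : ℝ)..t, η (projIcc 0 1 zero_le_one s) := rfl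

/-- The ray `s ↦ s • ξ` as a continuous map on `[0, 1]`. -/
def rayCLM (E : Type*) [NormedAddCommGroup E] [NormedSpace ℝ E] : E →L[ℝ] C(𝕀, E) :=
  LinearMap.mkContinuous
    { toFun := fun ξ => ⟨fun s => (s : ℝ) • ξ, by fun_prop⟩
      map_add' := fun ξ ξ' => by ext s; simp
      map_smul' := fun c ξ => by ext s; exact smul_comm _ _ _ } 1
    (fun ξ => by
      rw [one_mul, ContinuousMap.norm_le _ (norm_nonneg _)]
      rintro ⟨t, ht0, ht1⟩
      simpa [norm_smul, abs_of_nonneg ht0] using mul_le_of_le_one_left (norm_nonneg ξ) ht1)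

/-- The constant maps. -/
def constCLM (F : Type*) [NormedAddCommGroup F] [NormedSpace ℝ F] : F →L[ℝ] C(𝕀, F) :=
  LinearMap.mkContinuous
    { toFun := fun y => ContinuousMap.const _ y
      map_add' := fun ξ ξ' => by ext s; simp
      map_smul' := fun c ξ => by ext s; simp } 1
    (fun ξ => by
      rw [one_mul, ContinuousMap.norm_le _ (norm_nonneg _)]
      intro t; simp)

/-- The pairing of two continuous maps. -/
def pairCLM (E F : Type*) [NormedAddCommGroup E] [NormedSpace ℝ E] [NormedAddCommGroup F]
    [NormedSpace ℝ F] : C(𝕀, E) × C(𝕀, F) →L[ℝ] C(𝕀, E × F) :=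
  LinearMap.mkContinuous
    { toFun := fun p => p.1.prodMk p.2
      map_add' := fun ξ ξ' => by ext s <;> simp
      map_smul' := fun c ξ => by ext s <;> simp } 1
    (fun p => by
      rw [one_mul, ContinuousMap.norm_le _ (norm_nonneg _)]
      intro t
      exact max_le_max (p.1.norm_coe_le_norm t) (p.2.norm_coe_le_norm t))

variable {E F : Type u} [NormedAddCommGroup E] [NormedSpace ℝ E]
  [NormedAddCommGroup F] [NormedSpace ℝ F]

/-- The defect of a curve `γ` as a solution of the radial equation
`γ(t) = y + ∫₀ᵗ A(sξ, γ(s)) ξ ds`. -/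
def radialDefect (A : C(E × F, E →L[ℝ] F)) (p : (E × F) × C(𝕀, F)) : C(𝕀, F) :=
  p.2 - constCLM F p.1.2 - primitiveCLM F
    (ContinuousMap.applyCLM 𝕀 E F (A.comp (pairCLM E F (rayCLM E p.1.1, p.2)))
      (constCLM E p.1.1))

theorem radialDefect_eq_zero_iff (A : C(E × F, E →L[ℝ] F)) (p : (E × F) × C(𝕀, F)) :
    radialDefect A p = 0 ↔ ∀ t : 𝕀, p.2 t = p.1.2 +
      ∫ s in (0 : ℝ)..t, A (s • p.1.1, p.2 (projIcc 0 1 zero_le_one s)) p.1.1 := by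
  have key : ∀ t : 𝕀, radialDefect A p t = p.2 t - p.1.2 -
      ∫ s in (0 : ℝ)..t, A (s • p.1.1, p.2 (projIcc 0 1 zero_le_one s)) p.1.1 := by
    intro t
    have : primitiveCLM F (ContinuousMap.applyCLM 𝕀 E F
        (A.comp (pairCLM E F (rayCLM E p.1.1, p.2))) (constCLM E p.1.1)) t =
        ∫ s in (0 : ℝ)..t, A (s • p.1.1, p.2 (projIcc 0 1 zero_le_one s)) p.1.1 := by
      rw [primitiveCLM_apply]
      refine intervalIntegral.integral_congr fun s hs => ?_
      rw [uIcc_of_le t.2.1] at hs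
      have : s = (projIcc 0 1 zero_le_one s : 𝕀) := by
        rw [projIcc_of_mem zero_le_one ⟨hs.1, hs.2.trans t.2.2⟩]
      change A ((projIcc 0 1 zero_le_one s : 𝕀).1 • p.1.1, p.2 (projIcc 0 1 zero_le_one s)) p.1.1
        = _
      rw [← this]
    rw [← this]; rfl
  constructor
  · intro h t
    have := key t
    rw [h] at this
    simp only [ContinuousMap.coe_zero, Pi.zero_apply] at this
    rw [← sub_eq_zero, ← sub_sub]; exact this.symm
  · intro h
    ext t
    rw [key, h t]; simp

theorem contDiff_radialDefect (A : C(E × F, E →L[ℝ] F)) (hA : ContDiff ℝ ∞ A) :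
    ContDiff ℝ ∞ (radialDefect A) := by
  have hp : ∀ {X Y : Type u} [NormedAddCommGroup X] [NormedSpace ℝ X] [NormedAddCommGroup Y]
    [NormedSpace ℝ Y], ContDiff ℝ ∞ (ContinuousMap.applyCLM 𝕀 X Y) := fun {X Y} _ _ _ _ =>
      ContinuousLinearMap.contDiff (𝕜 := ℝ) (E := C(𝕀, X →L[ℝ] Y)) (F := C(𝕀, X) →L[ℝ] C(𝕀, Y)) _
  have hprim : ContDiff ℝ ∞ (primitiveCLM F) :=
    ContinuousLinearMap.contDiff (𝕜 := ℝ) (E := C(𝕀, F)) (F := C(𝕀, F)) _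
  have hray : ContDiff ℝ ∞ (rayCLM E) :=
    ContinuousLinearMap.contDiff (𝕜 := ℝ) (E := E) (F := C(𝕀, E)) _
  have hconst : ∀ {X : Type u} [NormedAddCommGroup X] [NormedSpace ℝ X],
      ContDiff ℝ ∞ (constCLM X) := fun {X} _ _ =>
    ContinuousLinearMap.contDiff (𝕜 := ℝ) (E := X) (F := C(𝕀, X)) _
  have hpair : ContDiff ℝ ∞ (pairCLM E F) :=
    ContinuousLinearMap.contDiff (𝕜 := ℝ) (E := C(𝕀, E) × C(𝕀, F)) (F := C(𝕀, E × F)) _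
  have h1 : ContDiff ℝ ∞ fun p : (E × F) × C(𝕀, F) => p.1.1 := contDiff_fst.fst
  have h2 : ContDiff ℝ ∞ fun p : (E × F) × C(𝕀, F) => p.1.2 := contDiff_fst.snd
  have h3 : ContDiff ℝ ∞ fun p : (E × F) × C(𝕀, F) => pairCLM E F (rayCLM E p.1.1, p.2) :=
    hpair.comp ((hray.comp h1).prodMk contDiff_snd)
  have h4 := hp.comp ((ContinuousMap.contDiff_comp (K := 𝕀) A hA).comp h3)
  exact (contDiff_snd.sub (hconst.comp h2)).sub (hprim.comp (h4.clm_apply (hconst.comp h1)))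

/-- The solutions of the radial equations `d/ds Φ(sξ, y) = A(sξ, Φ(sξ, y)) ξ`, `Φ(0, y) = y`, depend
smoothly on `(ξ, y)`. This is the implicit function theorem for the defect, whose derivative in the
curve is the identity where `ξ = 0`; the uniqueness part identifies the solution for `sξ` with a
reparametrization of the solution for `ξ`. -/
theorem exists_radial_solution [CompleteSpace E] [CompleteSpace F] (A : E × F → E →L[ℝ] F)
    (hA : ContDiff ℝ ∞ A) (y₀ : F) :
    ∃ Φ : E × F → F, (∀ᶠ p in 𝓝 ((0 : E), y₀), ContDiffAt ℝ ∞ Φ p) ∧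
      (∀ᶠ y in 𝓝 y₀, Φ (0, y) = y) ∧
      ∀ᶠ p in 𝓝 ((0 : E), y₀), fderiv ℝ Φ p (p.1, 0) = A (p.1, Φ p) p.1 := by
  let A' : C(E × F, E →L[ℝ] F) := ⟨A, hA.continuous⟩
  have hH := contDiff_radialDefect A' hA
  set u : (E × F) × C(𝕀, F) := ((0, y₀), ContinuousMap.const _ y₀) with hu
  have hconst : ∀ y : F, radialDefect A' ((0, y), ContinuousMap.const _ y) = 0 := by
    intro y
    rw [radialDefect_eq_zero_iff]
    intro t
    simp
  have hu0 : radialDefect A' u = 0 := hconst y₀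
  have hinv : (fderiv ℝ (radialDefect A') u ∘L .inr ℝ (E × F) C(𝕀, F)).IsInvertible := by
    have h1 : HasFDerivAt (fun γ => radialDefect A' ((0, y₀), γ))
        (fderiv ℝ (radialDefect A') u ∘L .inr ℝ (E × F) C(𝕀, F)) u.2 :=
      HasFDerivAt.comp (g := radialDefect A') u.2
        (hH.differentiable (by simp) u).hasFDerivAt (hasFDerivAt_prodMk_right _ _)
    have h2 : HasFDerivAt (fun γ => radialDefect A' ((0, y₀), γ))
        (ContinuousLinearMap.id ℝ C(𝕀, F)) u.2 := by
      have : (fun γ => radialDefect A' ((0, y₀), γ)) = fun γ => γ - constCLM F y₀ := by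
        funext γ
        simp [radialDefect]
      rw [this]
      exact (hasFDerivAt_id _).sub_const _
    rw [h1.unique h2]
    exact ⟨ContinuousLinearEquiv.refl ℝ _, rfl⟩
  set ψ := hH.contDiffAt.implicitFunction (u := u) (by simp) hinv
  have hψu : ψ u.1 = u.2 := hH.contDiffAt.implicitFunction_apply_self _ hinv
  have hψs : ∀ᶠ x in 𝓝 u.1, ContDiffAt ℝ ∞ ψ x :=
    hH.eventually_contDiffAt_implicitFunction u hinv
  have hiff := hH.contDiffAt.eventually_apply_eq_iff_implicitFunction (u := u) (by simp) hinv
  have hsol := hH.contDiffAt.eventually_apply_implicitFunction (u := u) (by simp) hinv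
  rw [hu0] at hiff hsol
  have hone : (1 : ℝ) ∈ 𝕀 := ⟨zero_le_one, le_rfl⟩
  have hΦs : ∀ᶠ p in 𝓝 ((0 : E), y₀), ContDiffAt ℝ ∞ (fun p => ψ p ⟨1, hone⟩) p := by
    filter_upwards [hψs] with p hp
    have := ContinuousLinearMap.contDiff (𝕜 := ℝ) (E := C(𝕀, F)) (F := F) (n := ∞)
      (ContinuousMap.evalCLM ℝ (⟨1, hone⟩ : 𝕀))
    exact this.contDiffAt.comp p hp
  refine ⟨fun p => ψ p ⟨1, hone⟩, hΦs, ?_, ?_⟩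
  · have ht : Tendsto (fun y : F => (((0 : E), y), constCLM F y)) (𝓝 y₀) (𝓝 u) := by
      have : Continuous fun y : F => (((0 : E), y), constCLM F y) := by fun_prop
      exact this.continuousAt
    filter_upwards [ht.eventually hiff] with y hy
    have : ψ (0, y) = constCLM F y := hy.1 (hconst y)
    rw [this]; rfl
  · obtain ⟨ε, hε, hball⟩ := Metric.eventually_nhds_iff_ball.1 hiff
    have hclose : ∀ᶠ p in 𝓝 u.1, dist (ψ p) u.2 < ε := by
      have : Tendsto ψ (𝓝 u.1) (𝓝 u.2) := by
        have := hψs.self_of_nhds.continuousAt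
        rwa [ContinuousAt, hψu] at this
      exact this.eventually (Metric.ball_mem_nhds _ hε)
    filter_upwards [hΦs, hsol, hclose, Metric.ball_mem_nhds u.1 hε] with p hps hp0 hpc hpb
    rw [radialDefect_eq_zero_iff] at hp0
    dsimp only at hp0
    set γ := ψ p with hγ
    -- The solution for the shortened ray is the reparametrized solution.
    have hscale : ∀ s : 𝕀, ψ ((s : ℝ) • p.1, p.2) ⟨1, hone⟩ = γ s := by
      intro s
      have hmem : ∀ t : 𝕀, (s : ℝ) * t ∈ 𝕀 := fun t =>
        ⟨mul_nonneg s.2.1 t.2.1, mul_le_one₀ s.2.2 t.2.1 t.2.2⟩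
      let γs : C(𝕀, F) := ⟨fun t => γ ⟨s * t, hmem t⟩, by fun_prop⟩
      have h1 : radialDefect A' (((s : ℝ) • p.1, p.2), γs) = 0 := by
        rw [radialDefect_eq_zero_iff]
        intro t
        change γ ⟨s * t, hmem t⟩ = _
        rw [hp0]
        dsimp only
        congr 1
        have h2 := intervalIntegral.smul_integral_comp_mul_left (a := 0) (b := (t : ℝ))
          (fun r => A' (r • p.1, γ (projIcc 0 1 zero_le_one r)) p.1) (s : ℝ)
        rw [mul_zero] at h2
        rw [← h2, ← intervalIntegral.integral_smul]
        refine intervalIntegral.integral_congr fun r hr => ?_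
        rw [uIcc_of_le t.2.1] at hr
        have hr' : r ∈ 𝕀 := ⟨hr.1, hr.2.trans t.2.2⟩
        have e1 : γs (projIcc 0 1 zero_le_one r) = γ (projIcc 0 1 zero_le_one (s * r)) := by
          change γ ⟨s * (projIcc 0 1 zero_le_one r : 𝕀), _⟩ = _
          congr 1
          rw [projIcc_of_mem zero_le_one hr', projIcc_of_mem zero_le_one (hmem ⟨r, hr'⟩)]
        simp only [e1, map_smul, smul_smul, mul_comm]
      have h2 : (((s : ℝ) • p.1, p.2), γs) ∈ Metric.ball u ε := by
        rw [Metric.mem_ball, Prod.dist_eq, Prod.dist_eq] at *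
        simp only [max_lt_iff] at hpb ⊢
        refine ⟨⟨?_, hpb.2⟩, ?_⟩
        · refine lt_of_le_of_lt ?_ hpb.1
          simp only [hu, dist_zero_right, norm_smul, Real.norm_of_nonneg s.2.1]
          exact mul_le_of_le_one_left (norm_nonneg _) s.2.2
        · rw [ContinuousMap.dist_lt_iff hε]
          intro t
          exact (ContinuousMap.dist_apply_le_dist (f := γ) (g := u.2) ⟨s * t, hmem t⟩).trans_lt hpc
      have h3 : ψ ((s : ℝ) • p.1, p.2) = γs := (hball _ h2).1 h1
      rw [h3]
      change γ ⟨s * 1, _⟩ = _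
      congr 1
      exact Subtype.ext (mul_one _)
    have hd1 : HasDerivAt (fun t : ℝ => ψ (t • p.1, p.2) ⟨1, hone⟩)
        (fderiv ℝ (fun p => ψ p ⟨1, hone⟩) p (p.1, 0)) 1 := by
      have hf : HasFDerivAt (fun p => ψ p ⟨1, hone⟩) (fderiv ℝ (fun p => ψ p ⟨1, hone⟩) p)
          ((1 : ℝ) • p.1, p.2) := by
        rw [one_smul]
        exact (hps.differentiableAt (by simp)).hasFDerivAt
      have hc : HasDerivAt (fun t : ℝ => (t • p.1, p.2)) (p.1, 0) 1 := by
        have := ((hasDerivAt_id (1 : ℝ)).smul_const p.1).prodMk (hasDerivAt_const (1 : ℝ) p.2)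
        simpa using this
      exact hf.comp_hasDerivAt (1 : ℝ) hc
    have hd2 : HasDerivAt (fun t : ℝ => p.2 +
        ∫ s in (0 : ℝ)..t, A' (s • p.1, γ (projIcc 0 1 zero_le_one s)) p.1)
        (A' ((1 : ℝ) • p.1, γ (projIcc 0 1 zero_le_one (1 : ℝ))) p.1) 1 := by
      have hk : Continuous fun s : ℝ => A' (s • p.1, γ (projIcc 0 1 zero_le_one s)) p.1 := by
        fun_prop
      exact (intervalIntegral.integral_hasDerivAt_right (hk.intervalIntegrable _ _)
        hk.stronglyMeasurable.stronglyMeasurableAtFilter hk.continuousAt).const_add _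
    have heq : EqOn (fun t : ℝ => ψ (t • p.1, p.2) ⟨1, hone⟩) (fun t : ℝ => p.2 +
        ∫ s in (0 : ℝ)..t, A' (s • p.1, γ (projIcc 0 1 zero_le_one s)) p.1) 𝕀 := by
      intro t ht
      exact (hscale ⟨t, ht⟩).trans (hp0 ⟨t, ht⟩)
    have hd3 := (hd2.hasDerivWithinAt (s := 𝕀)).congr_of_mem heq hone
    have := (uniqueDiffOn_Icc zero_lt_one 1 hone).eq_deriv _ hd1.hasDerivWithinAt hd3
    rw [this, one_smul, projIcc_of_mem zero_le_one hone]
    rfl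

end Radial

/-! ### Overdetermined systems -/

section Frobenius

theorem two_le_infty : (2 : ℕ∞ω) ≤ ∞ :=
  WithTop.coe_le_coe.2 (le_top : (2 : ℕ∞) ≤ ⊤)

/-- A map smooth near `p` has the germ of a globally smooth map. -/
theorem exists_contDiff_eventuallyEq {V W : Type*} [NormedAddCommGroup V] [NormedSpace ℝ V]
    [FiniteDimensional ℝ V] [NormedAddCommGroup W] [NormedSpace ℝ W] {f : V → W} {p : V}
    (hf : ∀ᶠ q in 𝓝 p, ContDiffAt ℝ ∞ f q) : ∃ g : V → W, ContDiff ℝ ∞ g ∧ g =ᶠ[𝓝 p] f := by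
  obtain ⟨r, hr, hball⟩ := Metric.eventually_nhds_iff_ball.1 hf
  let χ : ContDiffBump p := ⟨r / 4, r / 2, by positivity, by linarith⟩
  refine ⟨fun q => χ q • f q, ?_, ?_⟩
  · rw [contDiff_iff_contDiffAt]
    intro q
    by_cases hq : q ∈ Metric.ball p r
    · exact χ.contDiff.contDiffAt.smul (hball q hq)
    · have hq' : q ∈ (Metric.closedBall p (r / 2))ᶜ := by
        simp only [Metric.mem_ball, not_lt, mem_compl_iff, Metric.mem_closedBall, not_le] at *
        linarith
      refine contDiffAt_const (c := (0 : W)) |>.congr_of_eventuallyEq ?_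
      filter_upwards [Metric.isClosed_closedBall.isOpen_compl.mem_nhds hq'] with z hz
      have : χ z = 0 := χ.zero_of_le_dist (by
        simp only [mem_compl_iff, Metric.mem_closedBall, not_le] at hz
        exact hz.le)
      rw [this, zero_smul]
  · filter_upwards [χ.eventuallyEq_one] with q hq
    rw [hq, Pi.one_apply, one_smul]

variable {E F : Type u} [NormedAddCommGroup E] [NormedSpace ℝ E] [FiniteDimensional ℝ E]
  [NormedAddCommGroup F] [NormedSpace ℝ F] [FiniteDimensional ℝ F]

/-- **Frobenius' theorem** for the system `∂Φ/∂x = A(x, Φ)`: if `A` satisfies the compatibility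
condition, then the system has solutions with arbitrary initial value `Φ(0, y) = y`, depending
smoothly on `y`. The solution `Φ` of the radial equations has the right derivative along rays; the
defect `B = ∂Φ/∂x - A(x, Φ)` then satisfies a linear differential equation along rays. -/
theorem exists_solution_of_compatible (A : E × F → E →L[ℝ] F) (y₀ : F)
    (hA : ∀ᶠ u in 𝓝 ((0 : E), y₀), ContDiffAt ℝ ∞ A u)
    (hcomp : ∀ᶠ u in 𝓝 ((0 : E), y₀), ∀ e e' : E,
      fderiv ℝ A u (e, A u e) e' = fderiv ℝ A u (e', A u e') e) :
    ∃ Φ : E × F → F, (∀ᶠ p in 𝓝 ((0 : E), y₀), ContDiffAt ℝ ∞ Φ p) ∧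
      (∀ᶠ y in 𝓝 y₀, Φ (0, y) = y) ∧
      ∀ᶠ p in 𝓝 ((0 : E), y₀), ∀ e : E, fderiv ℝ Φ p (e, 0) = A (p.1, Φ p) e := by
  have := FiniteDimensional.complete ℝ E
  have := FiniteDimensional.complete ℝ F
  obtain ⟨A', hA's, hA'⟩ := exists_contDiff_eventuallyEq hA
  obtain ⟨Φ, hΦs, hΦ0, hΦr⟩ := exists_radial_solution A' hA's y₀
  refine ⟨Φ, hΦs, hΦ0, ?_⟩
  have hG : Tendsto (fun p : E × F => (p.1, Φ p)) (𝓝 (0, y₀)) (𝓝 (0, y₀)) := by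
    have := continuousAt_fst.prodMk hΦs.self_of_nhds.continuousAt
    rwa [ContinuousAt, hΦ0.self_of_nhds] at this
  have hbd : ∀ᶠ u in 𝓝 ((0 : E), y₀), ‖fderiv ℝ A u‖ < ‖fderiv ℝ A (0, y₀)‖ + 1 := by
    have h2 := (hA.self_of_nhds.fderiv_right (m := 0) (by simp)).continuousAt.norm
    exact h2.eventually (gt_mem_nhds (lt_add_one _))
  set M := ‖fderiv ℝ A (0, y₀)‖ + 1
  obtain ⟨ε, hε, hball⟩ := Metric.eventually_nhds_iff_ball.1
    (hΦs.and (hΦr.and (hG.eventually (hA.and (hcomp.and (hA'.and hbd))))))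
  set B : E × F → E →L[ℝ] F := fun q => fderiv ℝ Φ q ∘L .inl ℝ E F - A (q.1, Φ q) with hB
  -- The derivative of the defect.
  have hBd : ∀ q ∈ Metric.ball ((0 : E), y₀) ε, ∀ h : E × F, ∀ e : E,
      HasFDerivAt B (fderiv ℝ B q) q ∧ fderiv ℝ B q h e =
        fderiv ℝ (fderiv ℝ Φ) q h (e, 0) - fderiv ℝ A (q.1, Φ q) (h.1, fderiv ℝ Φ q h) e := by
    intro q hq h e
    obtain ⟨h1, -, h3, -⟩ := hball q hq
    have hΦ' : HasFDerivAt (fderiv ℝ Φ) (fderiv ℝ (fderiv ℝ Φ) q) q :=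
      ((h1.fderiv_right (m := 1) (by norm_cast)).differentiableAt (by simp)).hasFDerivAt
    have hΦ1 : HasFDerivAt Φ (fderiv ℝ Φ q) q := (h1.differentiableAt (by simp)).hasFDerivAt
    have hA1 : HasFDerivAt A (fderiv ℝ A (q.1, Φ q)) (q.1, Φ q) :=
      (h3.differentiableAt (by simp)).hasFDerivAt
    have hAG := hA1.comp q ((hasFDerivAt_fst (𝕜 := ℝ) (E := E) (F := F)).prodMk hΦ1)
    have hL := (((ContinuousLinearMap.compL ℝ E (E × F) F).flip
      (.inl ℝ E F)).hasFDerivAt.comp q hΦ').sub hAG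
    have hL' : HasFDerivAt B _ q := hL
    refine ⟨hL'.differentiableAt.hasFDerivAt, ?_⟩
    rw [hL'.fderiv]
    simp
  have hB0 : ∀ q ∈ Metric.ball ((0 : E), y₀) ε, B q q.1 = 0 := by
    intro q hq
    obtain ⟨-, h2, -, -, h5, -⟩ := hball q hq
    simp [hB, h2, h5]
  -- The linear differential equation for the defect.
  have hBr : ∀ q ∈ Metric.ball ((0 : E), y₀) ε, ∀ η : E, fderiv ℝ B q (q.1, 0) η =
      - B q η + fderiv ℝ A (q.1, Φ q) (0, B q η) q.1 := by
    intro q hq η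
    obtain ⟨h1, h2, -, h4, h5, -⟩ := hball q hq
    have e1 : fderiv ℝ B q (η, 0) q.1 + B q η = 0 := by
      have hd : HasFDerivAt (fun q => B q q.1) _ q :=
        (hBd q hq 0 0).1.clm_apply (hasFDerivAt_fst (𝕜 := ℝ) (E := E) (F := F))
      have hz : HasFDerivAt (fun q => B q q.1) (0 : E × F →L[ℝ] F) q := by
        refine (hasFDerivAt_const (0 : F) q).congr_of_eventuallyEq ?_
        filter_upwards [Metric.isOpen_ball.mem_nhds hq] with z hz using hB0 z hz
      have := congrArg (fun L => L (η, 0)) (hd.unique hz)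
      simpa [add_comm] using this
    have hsymm : fderiv ℝ (fderiv ℝ Φ) q (q.1, 0) (η, 0) =
        fderiv ℝ (fderiv ℝ Φ) q (η, 0) (q.1, 0) :=
      (h1.isSymmSndFDerivAt (by simpa using two_le_infty)) _ _
    have e2 := (hBd q hq (q.1, 0) η).2
    have e3 := (hBd q hq (η, 0) q.1).2
    have e4 : fderiv ℝ Φ q (η, 0) = A (q.1, Φ q) η + B q η := by simp [hB]
    have e5 : fderiv ℝ Φ q (q.1, 0) = A (q.1, Φ q) q.1 := by rw [h2, h5]
    have e6 : ((η, A (q.1, Φ q) η + B q η) : E × F) = (η, A (q.1, Φ q) η) + (0, B q η) := by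
      simp
    rw [e5, hsymm] at e2
    rw [e4, e6, map_add, add_apply, h4 η q.1] at e3
    rw [e2, ← eq_neg_of_add_eq_zero_left e1, e3]
    simp only
    abel
  rw [Metric.eventually_nhds_iff_ball]
  refine ⟨ε, hε, fun p hp η => ?_⟩
  have hray : ∀ s ∈ Icc (0 : ℝ) 1, ((s • p.1, p.2) : E × F) ∈ Metric.ball ((0 : E), y₀) ε := by
    intro s hs
    rw [Metric.mem_ball, Prod.dist_eq, max_lt_iff] at hp ⊢
    refine ⟨lt_of_le_of_lt ?_ hp.1, hp.2⟩
    simp only [dist_zero_right, norm_smul, Real.norm_of_nonneg hs.1]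
    exact mul_le_of_le_one_left (norm_nonneg _) hs.2
  have hw : ∀ s ∈ Icc (0 : ℝ) 1, HasDerivAt (fun s : ℝ => s • B (s • p.1, p.2) η)
      (fderiv ℝ A (s • p.1, Φ (s • p.1, p.2)) (0, s • B (s • p.1, p.2) η) p.1) s := by
    intro s hs
    have hc : HasDerivAt (fun t : ℝ => (t • p.1, p.2)) (p.1, 0) s := by
      have := ((hasDerivAt_id s).smul_const p.1).prodMk (hasDerivAt_const s p.2)
      simpa using this
    have h0 : HasDerivAt (fun s : ℝ => B (s • p.1, p.2))
        (fderiv ℝ B (s • p.1, p.2) (p.1, 0)) s :=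
      HasFDerivAt.comp_hasDerivAt s (hBd _ (hray s hs) 0 0).1 hc
    have h1 : HasDerivAt (fun s : ℝ => B (s • p.1, p.2) η)
        (fderiv ℝ B (s • p.1, p.2) (p.1, 0) η) s := by
      simpa using h0.clm_apply (hasDerivAt_const s η)
    have h2 := (hasDerivAt_id s).smul h1
    refine h2.congr_deriv ?_
    have h3 := hBr _ (hray s hs) η
    have h4 : ((s • p.1, 0) : E × F) = s • (p.1, 0) := by simp
    have h5 : ((0, s • B (s • p.1, p.2) η) : E × F) = s • (0, B (s • p.1, p.2) η) := by simp
    simp only [h4, map_smul, smul_apply] at h3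
    rw [h5, map_smul, smul_apply]
    simp only [id, one_smul]
    rw [h3]
    abel
  have hzero := eq_zero_of_abs_deriv_le_mul_abs_self_of_eq_zero_right (a := 0) (b := 1)
    (K := M * ‖p.1‖) (fun s hs => (hw s hs).continuousAt.continuousWithinAt)
    (fun s hs => (hw s ⟨hs.1, hs.2.le⟩).hasDerivWithinAt) (by simp) ?_ 1 ⟨zero_le_one, le_rfl⟩
  · simp only [one_smul, hB] at hzero
    simpa [sub_eq_zero] using hzero
  · intro s hs
    obtain ⟨-, -, -, -, -, h6⟩ := hball _ (hray s ⟨hs.1, hs.2.le⟩)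
    refine (ContinuousLinearMap.le_opNorm₂ _ _ _).trans ?_
    have : ‖((0, s • B (s • p.1, p.2) η) : E × F)‖ = ‖s • B (s • p.1, p.2) η‖ := by
      simp [Prod.norm_def]
    rw [this, mul_right_comm]
    gcongr

end Frobenius

/-! ### Involutive frames -/

section Involutive

open VectorField

variable {E F : Type u} [NormedAddCommGroup E] [NormedSpace ℝ E] [FiniteDimensional ℝ E]
  [NormedAddCommGroup F] [NormedSpace ℝ F] [FiniteDimensional ℝ F]

/-- **Frobenius' theorem** for an involutive frame `Z` on `E × F`, transverse to `F` at the base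
point: the integral manifolds are the graphs of the maps `x ↦ Φ(x, y)`. -/
theorem exists_graph_of_involutive (Z : E × F → E →L[ℝ] E × F) (y₀ : F)
    (hZ : ∀ᶠ u in 𝓝 ((0 : E), y₀), ContDiffAt ℝ ∞ Z u)
    (hZ0 : .fst ℝ E F ∘L Z (0, y₀) = .id ℝ E)
    (hinv : ∀ᶠ u in 𝓝 ((0 : E), y₀), ∀ e e' : E, ∃ c : E,
      lieBracket ℝ (fun u => Z u e) (fun u => Z u e') u = Z u c) :
    ∃ Φ : E × F → F, (∀ᶠ p in 𝓝 ((0 : E), y₀), ContDiffAt ℝ ∞ Φ p) ∧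
      (∀ᶠ y in 𝓝 y₀, Φ (0, y) = y) ∧
      ∀ᶠ p in 𝓝 ((0 : E), y₀), ∀ c : E,
        fderiv ℝ Φ p ((Z (p.1, Φ p) c).1, 0) = (Z (p.1, Φ p) c).2 := by
  have := FiniteDimensional.complete ℝ E
  set P : E × F → E →L[ℝ] E := fun u => .fst ℝ E F ∘L Z u with hP
  set Q : E × F → E →L[ℝ] E := fun u => (P u).inverse with hQ
  have hPs : ∀ᶠ u in 𝓝 ((0 : E), y₀), ContDiffAt ℝ ∞ P u := by
    filter_upwards [hZ] with u hu using contDiffAt_const.clm_comp hu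
  have hPinv : ∀ᶠ u in 𝓝 ((0 : E), y₀), (P u).IsInvertible := by
    have h1 := ContinuousLinearEquiv.nhds (ContinuousLinearEquiv.refl ℝ E)
    have h2 : ((ContinuousLinearEquiv.refl ℝ E : E ≃L[ℝ] E) : E →L[ℝ] E) = P (0, y₀) := hZ0.symm
    rw [h2] at h1
    exact hPs.self_of_nhds.continuousAt.eventually h1
  have hQs : ∀ᶠ u in 𝓝 ((0 : E), y₀), ContDiffAt ℝ ∞ Q u := by
    filter_upwards [hPs, hPinv] with u hu ⟨e, he⟩
    have := contDiffAt_map_inverse (𝕜 := ℝ) (n := ∞) e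
    rw [he] at this
    exact this.comp u hu
  set A : E × F → E →L[ℝ] F := fun u => (.snd ℝ E F ∘L Z u) ∘L Q u with hA
  have hAs : ∀ᶠ u in 𝓝 ((0 : E), y₀), ContDiffAt ℝ ∞ A u := by
    filter_upwards [hZ, hQs] with u hu hu' using
      (contDiffAt_const.clm_comp hu).clm_comp hu'
  have hPQ : ∀ u, (P u).IsInvertible → ∀ e, (Z u (Q u e)).1 = e := by
    intro u hu e
    have : (P u ∘L Q u) e = e := by rw [hQ]; simp [hu.self_comp_inverse]
    exact this
  have hAZ : ∀ u, (P u).IsInvertible → ∀ c, A u (Z u c).1 = (Z u c).2 := by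
    intro u hu c
    have h1 : (Q u ∘L P u) c = c := by rw [hQ]; simp [hu.inverse_comp_self]
    change (Z u ((Q u ∘L P u) c)).2 = _
    rw [h1]
  have hcomp : ∀ᶠ u in 𝓝 ((0 : E), y₀), ∀ e e' : E,
      fderiv ℝ A u (e, A u e) e' = fderiv ℝ A u (e', A u e') e := by
    filter_upwards [hZ, hQs, hAs, hPinv.eventually_nhds, hinv] with u h1 h2 h3 h4 h5 e e'
    have hW : ∀ e : E, fderiv ℝ (fun u => Z u (Q u e)) u =
        (fderiv ℝ (fun u => (e, A u e)) u) := by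
      intro e
      refine Filter.EventuallyEq.fderiv_eq ?_
      filter_upwards [h4] with w hw
      exact Prod.ext (hPQ w hw e) rfl
    have hd : ∀ e h, fderiv ℝ (fun u => (e, A u e)) u h = (0, fderiv ℝ A u h e) := by
      intro e h
      have hA' := ((h3.differentiableAt (by simp)).hasFDerivAt.clm_apply
        (hasFDerivAt_const e u))
      have := ((hasFDerivAt_const e u).prodMk hA').fderiv
      rw [this]; simp
    have hZd : ∀ c h, fderiv ℝ (fun u => Z u c) u h = fderiv ℝ Z u h c := by
      intro c h
      rw [((h1.differentiableAt (by simp)).hasFDerivAt.clm_apply (hasFDerivAt_const c u)).fderiv]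
      simp
    have hWd : ∀ e h, fderiv ℝ (fun u => Z u (Q u e)) u h =
        fderiv ℝ Z u h (Q u e) + Z u (fderiv ℝ Q u h e) := by
      intro e h
      rw [((h1.differentiableAt (by simp)).hasFDerivAt.clm_apply
        ((h2.differentiableAt (by simp)).hasFDerivAt.clm_apply (hasFDerivAt_const e u))).fderiv]
      simp [add_comm]
    have hval : ∀ e, (e, A u e) = Z u (Q u e) := fun e =>
      Prod.ext (hPQ u h4.self_of_nhds e).symm rfl
    obtain ⟨c, hc⟩ := h5 (Q u e) (Q u e')
    rw [lieBracket, hZd, hZd] at hc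
    -- The bracket of the fields `(e, A e)`, `(e', A e')` is tangent to the frame and vertical.
    have key : ((0, fderiv ℝ A u (e, A u e) e' - fderiv ℝ A u (e', A u e') e) : E × F) =
        Z u (c + fderiv ℝ Q u (e, A u e) e' - fderiv ℝ Q u (e', A u e') e) := by
      have h6 : ((0, fderiv ℝ A u (e, A u e) e' - fderiv ℝ A u (e', A u e') e) : E × F) =
        (0, fderiv ℝ A u (e, A u e) e') - (0, fderiv ℝ A u (e', A u e') e) := by simp
      rw [h6, ← hd, ← hd, ← hW, ← hW, hWd, hWd, map_sub, map_add, ← hc, hval, hval]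
      abel
    have h7 := hAZ u h4.self_of_nhds (c + fderiv ℝ Q u (e, A u e) e' - fderiv ℝ Q u (e', A u e') e)
    rw [← key] at h7
    simp only [map_zero] at h7
    exact (sub_eq_zero.1 h7.symm)
  obtain ⟨Φ, hΦs, hΦ0, hΦ⟩ := exists_solution_of_compatible A y₀ hAs hcomp
  refine ⟨Φ, hΦs, hΦ0, ?_⟩
  have hG : Tendsto (fun p : E × F => (p.1, Φ p)) (𝓝 (0, y₀)) (𝓝 (0, y₀)) := by
    have := continuousAt_fst.prodMk hΦs.self_of_nhds.continuousAt
    rwa [ContinuousAt, hΦ0.self_of_nhds] at this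
  filter_upwards [hΦ, hG.eventually hPinv] with p hp hp' c
  rw [hp, hAZ _ hp']

/-- The overdetermined system `du(Z c) = ℓ(c) u` has a solution with arbitrary values on the slice
`{0} × F`, if the brackets of the frame are combinations of the frame with coefficients in the
kernel of `ℓ`. The solution is `exp Λ` times the value on the slice, where `Λ` is the last
component of the integral manifolds of the frame `(Z, ℓ)` on `E × F × ℝ`. -/
theorem exists_solution_eq_on_slice (Z : E × F → E →L[ℝ] E × F) (ℓ : E →L[ℝ] ℝ) (y₀ : F)
    (hZ : ∀ᶠ u in 𝓝 ((0 : E), y₀), ContDiffAt ℝ ∞ Z u)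
    (hZ0 : Z (0, y₀) = .inl ℝ E F)
    (hinv : ∀ᶠ u in 𝓝 ((0 : E), y₀), ∀ e e' : E, ∃ c : E, ℓ c = 0 ∧
      lieBracket ℝ (fun u => Z u e) (fun u => Z u e') u = Z u c)
    (φ : E × F → ℝ) (hφ : ∀ᶠ u in 𝓝 ((0 : E), y₀), ContDiffAt ℝ ∞ φ u) :
    ∃ f : E × F → ℝ, (∀ᶠ u in 𝓝 ((0 : E), y₀), ContDiffAt ℝ ∞ f u) ∧
      (∀ᶠ u in 𝓝 ((0 : E), y₀), ∀ c : E, fderiv ℝ f u (Z u c) = ℓ c * f u) ∧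
      ∀ᶠ y in 𝓝 y₀, f (0, y) = φ (0, y) := by
  have := FiniteDimensional.complete ℝ E
  have := FiniteDimensional.complete ℝ F
  let π : E × (F × ℝ) →L[ℝ] E × F := (ContinuousLinearMap.id ℝ E).prodMap (.fst ℝ F ℝ)
  let j : E × F →L[ℝ] E × (F × ℝ) := (ContinuousLinearMap.id ℝ E).prodMap (.inl ℝ F ℝ)
  let k : E →L[ℝ] E × (F × ℝ) := .inr ℝ E (F × ℝ) ∘L .inr ℝ F ℝ ∘L ℓ
  let Z' : E × (F × ℝ) → E →L[ℝ] E × (F × ℝ) := fun w => j ∘L Z (π w) + k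
  have hπ : Tendsto π (𝓝 ((0 : E), (y₀, (0 : ℝ)))) (𝓝 ((0 : E), y₀)) := by
    have := π.continuous.tendsto ((0 : E), (y₀, (0 : ℝ)))
    exact this
  have hZ's : ∀ᶠ w in 𝓝 ((0 : E), (y₀, (0 : ℝ))), ContDiffAt ℝ ∞ Z' w := by
    filter_upwards [hπ.eventually hZ] with w hw
    exact (contDiffAt_const.clm_comp (hw.comp w π.contDiff.contDiffAt)).add contDiffAt_const
  have hinv' : ∀ᶠ w in 𝓝 ((0 : E), (y₀, (0 : ℝ))), ∀ e e' : E, ∃ c : E,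
      lieBracket ℝ (fun w => Z' w e) (fun w => Z' w e') w = Z' w c := by
    filter_upwards [hπ.eventually hZ, hπ.eventually hinv] with w h1 h2 e e'
    obtain ⟨c, hc0, hc⟩ := h2 e e'
    refine ⟨c, ?_⟩
    have hd : ∀ e h, fderiv ℝ (fun w => Z' w e) w h =
        j (fderiv ℝ (fun u => Z u e) (π w) (π h)) := by
      intro e h
      have h3 : HasFDerivAt (fun u => Z u e) _ (π w) :=
        (h1.clm_apply contDiffAt_const).differentiableAt (by simp) |>.hasFDerivAt
      have h4 : HasFDerivAt (fun w => j (Z (π w) e) + k e) _ w :=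
        (j.hasFDerivAt.comp w (h3.comp w π.hasFDerivAt)).add_const (k e)
      change fderiv ℝ (fun w => j (Z (π w) e) + k e) w h = _
      rw [h4.fderiv]; rfl
    have hπZ : ∀ e, π (Z' w e) = Z (π w) e := by
      intro e; ext <;> simp [π, Z', j, k]
    rw [lieBracket, hd, hd, hπZ, hπZ, ← map_sub]
    rw [lieBracket] at hc
    rw [hc]
    have : k c = 0 := by simp [k, hc0]
    simp [Z', this]
  obtain ⟨Φ, hΦs, hΦ0, hΦ⟩ := exists_graph_of_involutive Z' (y₀, (0 : ℝ)) hZ's (by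
    ext e
    have : Z (π ((0 : E), (y₀, (0 : ℝ)))) = Z (0, y₀) := rfl
    simp [Z', this, hZ0, j, k]) hinv'
  let i : E × F →L[ℝ] E × (F × ℝ) := j
  have hi : Tendsto i (𝓝 ((0 : E), y₀)) (𝓝 ((0 : E), (y₀, (0 : ℝ)))) :=
    i.continuous.tendsto ((0 : E), y₀)
  let Ψ : E × F → E × F := fun p => (p.1, (Φ (i p)).1)
  let Λ : E × F → ℝ := fun p => (Φ (i p)).2
  have hΦi : ∀ᶠ p in 𝓝 ((0 : E), y₀), ContDiffAt ℝ ∞ (fun p => Φ (i p)) p := by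
    filter_upwards [hi.eventually hΦs] with p hp using hp.comp p i.contDiff.contDiffAt
  have hΨs : ∀ᶠ p in 𝓝 ((0 : E), y₀), ContDiffAt ℝ ∞ Ψ p := by
    filter_upwards [hΦi] with p hp using contDiffAt_fst.prodMk hp.fst
  have hΛs : ∀ᶠ p in 𝓝 ((0 : E), y₀), ContDiffAt ℝ ∞ Λ p := by
    filter_upwards [hΦi] with p hp using hp.snd
  have hΦ0' : ∀ᶠ y in 𝓝 y₀, Φ (0, (y, 0)) = (y, 0) := by
    have : Tendsto (fun y : F => (y, (0 : ℝ))) (𝓝 y₀) (𝓝 (y₀, 0)) :=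
      (Continuous.prodMk continuous_id continuous_const).tendsto y₀
    exact this.eventually hΦ0
  have hΨ0 : ∀ᶠ y in 𝓝 y₀, Ψ (0, y) = (0, y) := by
    filter_upwards [hΦ0'] with y hy
    simp [Ψ, i, j, hy]
  -- `Ψ` straightens the frame, and `Λ` grows along it at the rate `ℓ`.
  have hdir : ∀ᶠ p in 𝓝 ((0 : E), y₀), ∀ c : E,
      fderiv ℝ Ψ p ((Z (Ψ p) c).1, 0) = Z (Ψ p) c ∧
      fderiv ℝ Λ p ((Z (Ψ p) c).1, 0) = ℓ c := by
    filter_upwards [hi.eventually hΦ, hi.eventually hΦs] with p h1 h2 c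
    have h3 := h1 c
    have e1 : π ((i p).1, Φ (i p)) = Ψ p := rfl
    have e2 : Z' ((i p).1, Φ (i p)) c = j (Z (Ψ p) c) + k c := by
      simp [Z', e1]
    rw [e2] at h3
    have h4 : HasFDerivAt (fun p => Φ (i p)) (fderiv ℝ Φ (i p) ∘L i) p :=
      (h2.differentiableAt (by simp)).hasFDerivAt.comp p i.hasFDerivAt
    have h5 : HasFDerivAt Ψ _ p := (hasFDerivAt_fst (𝕜 := ℝ) (E := E) (F := F)).prodMk h4.fst
    have h6 : HasFDerivAt Λ _ p := h4.snd
    have e3 : i ((Z (Ψ p) c).1, 0) = ((j (Z (Ψ p) c) + k c).1, 0) := by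
      simp [i, j, k]
    rw [h5.fderiv, h6.fderiv]
    refine ⟨Prod.ext rfl ?_, ?_⟩
    · change (fderiv ℝ Φ (i p) (i ((Z (Ψ p) c).1, 0))).1 = _
      rw [e3, h3]; simp [j, k]
    · change (fderiv ℝ Φ (i p) (i ((Z (Ψ p) c).1, 0))).2 = _
      rw [e3, h3]; simp [j, k]
  have hΨd : HasFDerivAt Ψ ((ContinuousLinearEquiv.refl ℝ (E × F) : (E × F) ≃L[ℝ] (E × F)) :
      E × F →L[ℝ] E × F) (0, y₀) := by
    have h1 : HasFDerivAt Ψ (fderiv ℝ Ψ (0, y₀)) (0, y₀) :=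
      (hΨs.self_of_nhds.differentiableAt (by simp)).hasFDerivAt
    have h2 : HasFDerivAt (fun y => Ψ (0, y)) (fderiv ℝ Ψ (0, y₀) ∘L .inr ℝ E F) y₀ :=
      HasFDerivAt.comp y₀ h1 (hasFDerivAt_prodMk_right _ _)
    have h3 : HasFDerivAt (fun y => Ψ (0, y)) (.inr ℝ E F) y₀ :=
      (hasFDerivAt_prodMk_right (0 : E) y₀).congr_of_eventuallyEq hΨ0
    have h4 : fderiv ℝ Ψ (0, y₀) = ContinuousLinearMap.id ℝ (E × F) := by
      ext1
      · ext1 e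
        have h5 := (hdir.self_of_nhds e).1
        rw [hΨ0.self_of_nhds, hZ0] at h5
        exact h5
      · rw [h2.unique h3]; rfl
    rw [h4] at h1
    exact h1
  have hcd : ContDiffAt ℝ ∞ Ψ (0, y₀) := hΨs.self_of_nhds
  set H := hcd.toOpenPartialHomeomorph Ψ hΨd (by simp) with hH
  have hHc : (H : E × F → E × F) = Ψ := rfl
  have hmem : ((0 : E), y₀) ∈ H.source := hcd.mem_toOpenPartialHomeomorph_source hΨd (by simp)
  have hΨb : Ψ (0, y₀) = (0, y₀) := hΨ0.self_of_nhds
  have hsymm0 : H.symm (0, y₀) = (0, y₀) := by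
    have := H.left_inv hmem
    rwa [hHc, hΨb] at this
  have htgt : ((0 : E), y₀) ∈ H.target := by
    have := H.map_source hmem
    rwa [hHc, hΨb] at this
  have hsymmt : Tendsto H.symm (𝓝 (0, y₀)) (𝓝 (0, y₀)) := by
    have := H.continuousAt_symm htgt
    rwa [ContinuousAt, hsymm0] at this
  have hdinv : ∀ᶠ p in 𝓝 ((0 : E), y₀), (fderiv ℝ Ψ p).IsInvertible := by
    have h1 := ContinuousLinearEquiv.nhds (ContinuousLinearEquiv.refl ℝ (E × F))
    rw [← hΨd.fderiv] at h1
    exact (hcd.fderiv_right (m := 0) (by simp)).continuousAt.eventually h1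
  have hsymms : ∀ᶠ u in 𝓝 ((0 : E), y₀), ContDiffAt ℝ ∞ H.symm u := by
    filter_upwards [H.open_target.mem_nhds htgt, hsymmt.eventually hdinv,
      hsymmt.eventually hΨs] with u h1 ⟨e, he⟩ h3
    refine H.contDiffAt_symm (f₀' := e) h1 ?_ h3
    rw [he]
    exact (h3.differentiableAt (by simp)).hasFDerivAt
  let g : E × F → ℝ := fun p => Real.exp (Λ p) * φ (0, p.2)
  have hsl : Tendsto (fun p : E × F => ((0 : E), p.2)) (𝓝 (0, y₀)) (𝓝 (0, y₀)) :=
    (Continuous.prodMk continuous_const continuous_snd).tendsto ((0 : E), y₀)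
  have hgs : ∀ᶠ p in 𝓝 ((0 : E), y₀), ContDiffAt ℝ ∞ g p := by
    filter_upwards [hΛs, hsl.eventually hφ] with p h1 h2
    exact h1.exp.mul (ContDiffAt.comp p h2 (contDiffAt_const.prodMk contDiffAt_snd))
  have hfs : ∀ᶠ u in 𝓝 ((0 : E), y₀), ContDiffAt ℝ ∞ (fun u => g (H.symm u)) u := by
    filter_upwards [hsymms, hsymmt.eventually hgs] with u h1 h2 using h2.comp u h1
  have hfg : ∀ p ∈ H.source, g (H.symm (Ψ p)) = g p := fun p hp => by
    rw [← hHc, H.left_inv hp]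
  have hΨt : Tendsto Ψ (𝓝 (0, y₀)) (𝓝 (0, y₀)) := by
    have := hcd.continuousAt
    rwa [ContinuousAt, hΨb] at this
  refine ⟨fun u => g (H.symm u), hfs, ?_, ?_⟩
  · have hp : ∀ᶠ p in 𝓝 ((0 : E), y₀), ∀ c : E,
        fderiv ℝ (fun u => g (H.symm u)) (Ψ p) (Z (Ψ p) c) = ℓ c * g p := by
      filter_upwards [hΨs, hΛs, hsl.eventually hφ, hdir, H.open_source.mem_nhds hmem,
        hΨt.eventually hfs] with p h1 h2 h3 h4 h5 h6 c
      have h7 : HasFDerivAt (fun p => g (H.symm (Ψ p)))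
          (fderiv ℝ (fun u => g (H.symm u)) (Ψ p) ∘L fderiv ℝ Ψ p) p :=
        HasFDerivAt.comp (g := fun u => g (H.symm u)) p
          (h6.differentiableAt (by simp)).hasFDerivAt (h1.differentiableAt (by simp)).hasFDerivAt
      have h8 : HasFDerivAt (fun p : E × F => φ (0, p.2))
          (fderiv ℝ φ (0, p.2) ∘L (0 : E × F →L[ℝ] E).prod (.snd ℝ E F)) p :=
        HasFDerivAt.comp (g := φ) p (h3.differentiableAt (by simp)).hasFDerivAt
          ((hasFDerivAt_const (0 : E) p).prodMk hasFDerivAt_snd)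
      have h9 := ((h2.differentiableAt (by simp)).hasFDerivAt.exp).mul h8
      have h10 : (fun p => g (H.symm (Ψ p))) =ᶠ[𝓝 p] g := by
        filter_upwards [H.open_source.mem_nhds h5] with q hq using hfg q hq
      have h11 := (h7.congr_of_eventuallyEq h10.symm).unique h9
      have h12 := congrArg (fun L => L ((Z (Ψ p) c).1, 0)) h11
      simp only [ContinuousLinearMap.comp_apply, (h4 c).1] at h12
      rw [h12]
      have h13 : ((0 : E × F →L[ℝ] E).prod (.snd ℝ E F)) ((Z (Ψ p) c).1, 0) = 0 := by
        simp
      simp only [add_apply, smul_apply, ContinuousLinearMap.comp_apply, h13, map_zero,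
        (h4 c).2, smul_eq_mul, g]
      ring
    filter_upwards [hsymmt.eventually hp, H.open_target.mem_nhds htgt] with u h1 h2 c
    have := h1 c
    rwa [← hHc, H.right_inv h2] at this
  · have hy : Tendsto (fun y : F => ((0 : E), y)) (𝓝 y₀) (𝓝 (0, y₀)) :=
      (Continuous.prodMk continuous_const continuous_id).tendsto y₀
    filter_upwards [hΨ0, hΦ0', hy.eventually (H.open_source.mem_nhds hmem)] with y h1 h2 h3
    have h4 := hfg _ h3
    rw [h1] at h4
    rw [h4]
    simp [g, Λ, i, j, h2]

/-- A `2`-jet satisfying the first prolongation of the system `du(Z c) = ℓ(c) u` at `p` extends to a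
solution near `p`. The solution taking the values of `φ` on a slice transverse to the frame has the
`2`-jet of `φ`: the equations at `p` and their first derivatives determine all second derivatives
but those along the slice. -/
theorem exists_solution_of_jet {V : Type u} [NormedAddCommGroup V] [NormedSpace ℝ V]
    [FiniteDimensional ℝ V] (Z : V → E →L[ℝ] V) (ℓ : E →L[ℝ] ℝ) (p : V)
    (hZ : ∀ᶠ q in 𝓝 p, ContDiffAt ℝ ∞ Z q) (hZp : Function.Injective (Z p))
    (hinv : ∀ᶠ q in 𝓝 p, ∀ e e' : E, ∃ c : E, ℓ c = 0 ∧
      lieBracket ℝ (fun q => Z q e) (fun q => Z q e') q = Z q c)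
    (φ : V → ℝ) (hφ : ∀ᶠ q in 𝓝 p, ContDiffAt ℝ ∞ φ q)
    (h0 : ∀ c, fderiv ℝ φ p (Z p c) = ℓ c * φ p)
    (h1 : ∀ c, fderiv ℝ (fun q => fderiv ℝ φ q (Z q c) - ℓ c * φ q) p = 0) :
    ∃ f : V → ℝ, (∀ᶠ q in 𝓝 p, ContDiffAt ℝ ∞ f q) ∧
      (∀ᶠ q in 𝓝 p, ∀ c : E, fderiv ℝ f q (Z q c) = ℓ c * f q) ∧
      f p = φ p ∧ fderiv ℝ f p = fderiv ℝ φ p ∧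
      fderiv ℝ (fderiv ℝ f) p = fderiv ℝ (fderiv ℝ φ) p := by
  obtain ⟨F, hF⟩ := Submodule.exists_isCompl (LinearMap.range (Z p : E →ₗ[ℝ] V))
  let L₁ : (E × F) ≃ₗ[ℝ] V := ((LinearEquiv.ofInjective (Z p : E →ₗ[ℝ] V) hZp).prodCongr
    (LinearEquiv.refl ℝ F)).trans (Submodule.prodEquivOfIsCompl _ _ hF)
  let L : (E × F) ≃L[ℝ] V := L₁.toContinuousLinearEquiv
  have hL : ∀ e y, L (e, y) = Z p e + y := fun e y => rfl
  let T : E × F → V := fun w => p + L w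
  have hTd : ∀ w, HasFDerivAt T (L : E × F →L[ℝ] V) w := fun w => L.hasFDerivAt.const_add p
  have hTs : ContDiff ℝ ∞ T := contDiff_const.add L.contDiff
  let R : V → E × F := fun q => L.symm (q - p)
  have hTR : ∀ q, T (R q) = q := fun q => by simp [T, R]
  have hRd : ∀ q, HasFDerivAt R (L.symm : V →L[ℝ] E × F) q := fun q =>
    HasFDerivAt.comp (g := L.symm) q L.symm.hasFDerivAt ((hasFDerivAt_id q).sub_const p)
  have hRs : ContDiff ℝ ∞ R := L.symm.contDiff.comp (contDiff_id.sub contDiff_const)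
  have hT0 : T ((0 : E), (0 : F)) = p := by simp [T, hL]
  have hTt : Tendsto T (𝓝 ((0 : E), (0 : F))) (𝓝 p) := by
    have := hTs.continuous.tendsto ((0 : E), (0 : F))
    rwa [hT0] at this
  have hRt : Tendsto R (𝓝 p) (𝓝 ((0 : E), (0 : F))) := by
    have := hRs.continuous.tendsto p
    have h : R p = ((0 : E), (0 : F)) := by simp [R, Prod.zero_eq_mk]
    rwa [h] at this
  let Z' : E × F → E →L[ℝ] E × F := fun w => (L.symm : V →L[ℝ] E × F) ∘L Z (T w)
  have hZ's : ∀ᶠ w in 𝓝 ((0 : E), (0 : F)), ContDiffAt ℝ ∞ Z' w := by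
    filter_upwards [hTt.eventually hZ] with w hw
    exact contDiffAt_const.clm_comp (hw.comp w hTs.contDiffAt)
  have hZ'0 : Z' (0, 0) = .inl ℝ E F := by
    ext1 e
    change L.symm (Z (T (0, 0)) e) = (e, 0)
    rw [hT0, ContinuousLinearEquiv.symm_apply_eq, hL]
    simp
  have hinv' : ∀ᶠ w in 𝓝 ((0 : E), (0 : F)), ∀ e e' : E, ∃ c : E, ℓ c = 0 ∧
      lieBracket ℝ (fun w => Z' w e) (fun w => Z' w e') w = Z' w c := by
    filter_upwards [hTt.eventually hinv, hTt.eventually hZ] with w h2 h3 e e'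
    obtain ⟨c, hc, hc'⟩ := h2 e e'
    refine ⟨c, hc, ?_⟩
    have hd : ∀ e h, fderiv ℝ (fun w => Z' w e) w h =
        L.symm (fderiv ℝ (fun q => Z q e) (T w) (L h)) := by
      intro e h
      have h4 : HasFDerivAt (fun q => Z q e) (fderiv ℝ (fun q => Z q e) (T w)) (T w) :=
        (h3.clm_apply contDiffAt_const).differentiableAt (by simp) |>.hasFDerivAt
      have h5 : HasFDerivAt (fun w => L.symm (Z (T w) e)) _ w :=
        HasFDerivAt.comp (g := L.symm) w L.symm.hasFDerivAt (h4.comp w (hTd w))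
      change fderiv ℝ (fun w => L.symm (Z (T w) e)) w h = _
      rw [h5.fderiv]; rfl
    rw [lieBracket] at hc' ⊢
    rw [hd, hd, ← map_sub]
    change L.symm (fderiv ℝ (fun q => Z q e') (T w) (L (L.symm (Z (T w) e))) -
      fderiv ℝ (fun q => Z q e) (T w) (L (L.symm (Z (T w) e')))) = L.symm (Z (T w) c)
    rw [L.apply_symm_apply, L.apply_symm_apply, hc']
  obtain ⟨g, hgs, hgZ, hgφ⟩ := exists_solution_eq_on_slice Z' ℓ (0 : F) hZ's hZ'0 hinv'
    (fun w => φ (T w)) (by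
      filter_upwards [hTt.eventually hφ] with w hw using hw.comp w hTs.contDiffAt)
  have hfs : ∀ᶠ q in 𝓝 p, ContDiffAt ℝ ∞ (fun q => g (R q)) q := by
    filter_upwards [hRt.eventually hgs] with q hq using hq.comp q hRs.contDiffAt
  have hfZ : ∀ᶠ q in 𝓝 p, ∀ c : E, fderiv ℝ (fun q => g (R q)) q (Z q c) = ℓ c * g (R q) := by
    filter_upwards [hRt.eventually hgs, hRt.eventually hgZ] with q h2 h3 c
    have h4 : HasFDerivAt (fun q => g (R q)) _ q :=
      HasFDerivAt.comp (g := g) q (h2.differentiableAt (by simp)).hasFDerivAt (hRd q)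
    rw [h4.fderiv, ← h3 c]
    simp only [Z', hTR]; rfl
  -- The difference vanishes to second order.
  set f : V → ℝ := fun q => g (R q)
  set δ : V → ℝ := fun q => f q - φ q with hδ
  have hδs : ContDiffAt ℝ ∞ δ p := hfs.self_of_nhds.sub hφ.self_of_nhds
  have hδd : ∀ᶠ q in 𝓝 p, DifferentiableAt ℝ δ q := by
    filter_upwards [hfs, hφ] with q h2 h3 using (h2.sub h3).differentiableAt (by simp)
  have hδd' : HasFDerivAt (fderiv ℝ δ) (fderiv ℝ (fderiv ℝ δ) p) p :=
    ((hδs.fderiv_right (m := 1) (by norm_cast)).differentiableAt (by simp)).hasFDerivAt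
  have hslt : Tendsto (fun y : F => p + (y : V)) (𝓝 0) (𝓝 p) := by
    have : Continuous fun y : F => p + (y : V) := by fun_prop
    simpa using this.tendsto 0
  have hsld : ∀ y : F, HasFDerivAt (fun y : F => p + (y : V)) F.subtypeL y := fun y =>
    F.subtypeL.hasFDerivAt.const_add p
  have hδ0 : ∀ᶠ y : F in 𝓝 (0 : F), δ (p + (y : V)) = 0 := by
    filter_upwards [hgφ] with y hy
    have h2 : R (p + y) = (0, y) := by
      simp only [R]
      rw [ContinuousLinearEquiv.symm_apply_eq, hL]; simp
    have h3 : T (0, y) = p + y := by simp [T, hL]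
    simp only [hδ, f, h2, hy, h3, sub_self]
  have hδp : δ p = 0 := by simpa using hδ0.self_of_nhds
  have hδF : ∀ᶠ y : F in 𝓝 (0 : F), ∀ y' : F, fderiv ℝ δ (p + (y : V)) (y' : V) = 0 := by
    filter_upwards [hδ0.eventually_nhds, hslt.eventually hδd] with y h2 h3 y'
    have h4 : HasFDerivAt (fun y : F => δ (p + y)) _ y :=
      HasFDerivAt.comp (g := δ) (f := fun y : F => p + (y : V)) y h3.hasFDerivAt (hsld y)
    have h5 : HasFDerivAt (fun y : F => δ (p + y)) (0 : F →L[ℝ] ℝ) y :=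
      (hasFDerivAt_const (0 : ℝ) y).congr_of_eventuallyEq h2
    exact congrArg (fun A => A y') (h4.unique h5)
  have hδFF : ∀ y y' : F, fderiv ℝ (fderiv ℝ δ) p y y' = 0 := by
    intro y y'
    have h4 : HasFDerivAt (fun y : F => fderiv ℝ δ (p + y) y')
        (((ContinuousLinearMap.apply ℝ ℝ (y' : V)) ∘L fderiv ℝ (fderiv ℝ δ) p) ∘L F.subtypeL)
        0 := by
      refine HasFDerivAt.comp (g := fun q => fderiv ℝ δ q y') (0 : F) ?_ (hsld 0)
      have : p + ((0 : F) : V) = p := by simp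
      rw [this]
      exact (ContinuousLinearMap.apply ℝ ℝ (y' : V)).hasFDerivAt.comp p hδd'
    have h5 : HasFDerivAt (fun y : F => fderiv ℝ δ (p + y) y') (0 : F →L[ℝ] ℝ) 0 := by
      refine (hasFDerivAt_const (0 : ℝ) (0 : F)).congr_of_eventuallyEq ?_
      filter_upwards [hδF] with z hz using hz y'
    exact congrArg (fun A => A y) (h4.unique h5)
  have hfd := hfs.self_of_nhds.differentiableAt (by simp)
  have hφd := hφ.self_of_nhds.differentiableAt (by simp)
  have hδfd : fderiv ℝ δ p = fderiv ℝ f p - fderiv ℝ φ p := fderiv_sub hfd hφd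
  have hfp : f p = φ p := sub_eq_zero.1 hδp
  have hδZ : ∀ c, fderiv ℝ δ p (Z p c) = 0 := by
    intro c
    rw [hδfd, sub_apply, show fderiv ℝ f p (Z p c) = ℓ c * f p from hfZ.self_of_nhds c, h0 c,
      hfp, sub_self]
  have hdec : ∀ q : V, ∃ (e : E) (y : F), q = Z p e + y := fun q =>
    ⟨(L.symm q).1, (L.symm q).2, by rw [← hL]; simp⟩
  have hδ1 : fderiv ℝ δ p = 0 := by
    ext q
    obtain ⟨e, y, rfl⟩ := hdec q
    have := hδF.self_of_nhds y
    simp only [ZeroMemClass.coe_zero, add_zero] at this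
    rw [map_add, hδZ, this]; simp
  have hδ2Z : ∀ q c, fderiv ℝ (fderiv ℝ δ) p q (Z p c) = 0 := by
    intro q c
    have hZc : HasFDerivAt (fun q => Z q c) (fderiv ℝ (fun q => Z q c) p) p :=
      (hZ.self_of_nhds.clm_apply contDiffAt_const).differentiableAt (by simp) |>.hasFDerivAt
    have h2 : HasFDerivAt (fun q => fderiv ℝ δ q (Z q c) - ℓ c * δ q) _ p :=
      (hδd'.clm_apply hZc).sub ((hδs.differentiableAt (by simp)).hasFDerivAt.const_mul (ℓ c))
    have h3 : HasFDerivAt (fun q => fderiv ℝ δ q (Z q c) - ℓ c * δ q) (0 : V →L[ℝ] ℝ) p := by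
      have h4 : HasFDerivAt (fun q => -(fderiv ℝ φ q (Z q c) - ℓ c * φ q)) (-0 : V →L[ℝ] ℝ) p := by
        rw [← h1 c]
        refine (DifferentiableAt.hasFDerivAt ?_).neg
        have h5 := (hφ.self_of_nhds.fderiv_right (m := 1) (by norm_cast)).differentiableAt
          (by simp)
        exact (h5.clm_apply hZc.differentiableAt).sub (hφd.const_mul _)
      rw [neg_zero] at h4
      refine h4.congr_of_eventuallyEq ?_
      filter_upwards [hfZ, hfs, hφ] with q h5 h6 h7
      have h8 : fderiv ℝ δ q = fderiv ℝ f q - fderiv ℝ φ q :=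
        fderiv_sub (h6.differentiableAt (by simp)) (h7.differentiableAt (by simp))
      rw [h8, sub_apply, h5 c]
      simp only [hδ]; ring
    have h4 := congrArg (fun A => A q) (h2.unique h3)
    simpa [hδ1] using h4
  have hsymm : IsSymmSndFDerivAt ℝ δ p := hδs.isSymmSndFDerivAt (by simpa using two_le_infty)
  have hδ2 : fderiv ℝ (fderiv ℝ δ) p = 0 := by
    ext q q'
    obtain ⟨e, y, rfl⟩ := hdec q
    obtain ⟨e', y', rfl⟩ := hdec q'
    rw [map_add, hδ2Z, zero_add, hsymm.eq, map_add, hδ2Z, zero_add, hδFF]; simp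
  refine ⟨f, hfs, hfZ, hfp, ?_, ?_⟩
  · rw [← sub_eq_zero, ← hδfd, hδ1]
  · have h2 : fderiv ℝ δ =ᶠ[𝓝 p] fun q => fderiv ℝ f q - fderiv ℝ φ q := by
      filter_upwards [hfs, hφ] with q h6 h7
      exact fderiv_sub (h6.differentiableAt (by simp)) (h7.differentiableAt (by simp))
    have h3 := (hfs.self_of_nhds.fderiv_right (m := 1) (by norm_cast)).differentiableAt (by simp)
    have h4 := (hφ.self_of_nhds.fderiv_right (m := 1) (by norm_cast)).differentiableAt (by simp)
    rw [← sub_eq_zero, ← hδ2, h2.fderiv_eq]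
    exact (fderiv_sub h3 h4).symm

end Involutive

namespace SprayGeometry

variable {n : ℕ} {M : Type*} [TopologicalSpace M] [ChartedSpace (EuclideanSpace ℝ (Fin n)) M]
  [IsManifold (𝓡 n) ω M]

/-! ### Coordinates on the tangent bundle -/

/-- The model space `ℝⁿ × ℝⁿ` of `TM`, with coordinates `(x, y)`. -/
abbrev Model (n : ℕ) := EuclideanSpace ℝ (Fin n) × EuclideanSpace ℝ (Fin n)

/-- The coordinates `(x, y)` on `TM` induced by the chart of `M` at the base point of `v`. -/
def coord (v : TM n M) : TM n M → Model n := extChartAt (𝓡 n).tangent v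

/-- The inverse of `coord v`. -/
def coordSymm (v : TM n M) : Model n → TM n M := (extChartAt (𝓡 n).tangent v).symm

/-- The domain of the coordinates `coord v`. -/
def coordSource (v : TM n M) : Set (TM n M) := (extChartAt (𝓡 n).tangent v).source

/-- The differential of the coordinates `coord v`. -/
def dcoord (v w : TM n M) : TangentSpace (𝓡 n).tangent w →L[ℝ] Model n :=
  mfderiv (𝓡 n).tangent 𝓘(ℝ, Model n) (coord v) w

/-- The differential of the base coordinates. -/
def dbase (v : TM n M) (b : M) : TangentSpace (𝓡 n) b →L[ℝ] EuclideanSpace ℝ (Fin n) :=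
  mfderiv (𝓡 n) 𝓘(ℝ, EuclideanSpace ℝ (Fin n)) (extChartAt (𝓡 n) v.1) b

theorem isOpen_coordSource (v : TM n M) : IsOpen (coordSource v) := isOpen_extChartAt_source v

theorem mem_coordSource (v : TM n M) : v ∈ coordSource v := mem_extChartAt_source v

theorem mem_coordSource_iff {v w : TM n M} :
    w ∈ coordSource v ↔ w.1 ∈ (chartAt (EuclideanSpace ℝ (Fin n)) v.1).source := by
  rw [coordSource, extChartAt_source]
  exact TangentBundle.mem_chart_source_iff w v

theorem coordSymm_coord {v w : TM n M} (hw : w ∈ coordSource v) : coordSymm v (coord v w) = w :=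
  (extChartAt (𝓡 n).tangent v).left_inv hw

theorem isInvertible_dcoord {v w : TM n M} (hw : w ∈ coordSource v) :
    (dcoord v w).IsInvertible := isInvertible_mfderiv_extChartAt hw

theorem isInvertible_dbase {v : TM n M} {b : M}
    (hb : b ∈ (chartAt (EuclideanSpace ℝ (Fin n)) v.1).source) :
    (dbase v b).IsInvertible := isInvertible_mfderiv_extChartAt (by rwa [extChartAt_source])

theorem coord_eq {v w : TM n M} (hw : w ∈ coordSource v) :
    coord v w = (extChartAt (𝓡 n) v.1 w.1, dbase v w.1 w.2) := by
  have hb := mem_coordSource_iff.1 hw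
  have h1 : dbase v w.1 = (trivializationAt (EuclideanSpace ℝ (Fin n)) (TangentSpace (𝓡 n))
      v.1).continuousLinearMapAt ℝ w.1 :=
    (TangentBundle.continuousLinearMapAt_trivializationAt hb).symm
  rw [h1, TangentBundle.continuousLinearMapAt_trivializationAt_eq_core hb]
  rfl

theorem contMDiffAt_coord {v w : TM n M} (hw : w ∈ coordSource v) :
    ContMDiffAt (𝓡 n).tangent 𝓘(ℝ, Model n) ∞ (coord v) w := by
  apply contMDiffAt_extChartAt'
  rwa [coordSource, extChartAt_source] at hw

theorem mdifferentiableAt_coord {v w : TM n M} (hw : w ∈ coordSource v) :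
    MDifferentiableAt (𝓡 n).tangent 𝓘(ℝ, Model n) (coord v) w :=
  (contMDiffAt_coord hw).mdifferentiableAt (by simp)

theorem contMDiffAt_coordSymm {v w : TM n M} (hw : w ∈ coordSource v) :
    ContMDiffAt 𝓘(ℝ, Model n) (𝓡 n).tangent ∞ (coordSymm v) (coord v w) := by
  have h1 := (contMDiffOn_extChartAt_symm (I := (𝓡 n).tangent) (n := ∞) v) (coord v w)
    ((extChartAt _ v).map_source hw)
  exact h1.contMDiffAt (extChartAt_target_mem_nhds' ((extChartAt _ v).map_source hw))

theorem coord_coordSymm {v w : TM n M} (hw : w ∈ coordSource v) :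
    ∀ᶠ u in 𝓝 (coord v w), coord v (coordSymm v u) = u := by
  filter_upwards [extChartAt_target_mem_nhds' (I := (𝓡 n).tangent)
    ((extChartAt (𝓡 n).tangent v).map_source hw)] with u hu
  exact (extChartAt (𝓡 n).tangent v).right_inv hu

theorem tendsto_coordSymm {v w : TM n M} (hw : w ∈ coordSource v) :
    Tendsto (coordSymm v) (𝓝 (coord v w)) (𝓝 w) := by
  have := (contMDiffAt_coordSymm hw).continuousAt
  rwa [ContinuousAt, coordSymm_coord hw] at this

theorem tendsto_coord {v w : TM n M} (hw : w ∈ coordSource v) :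
    Tendsto (coord v) (𝓝 w) (𝓝 (coord v w)) :=
  (contMDiffAt_coord hw).continuousAt

/-- A property of coordinates holds near `coord v w` if its pullback holds near `w`. -/
theorem eventually_coord {v w : TM n M} (hw : w ∈ coordSource v) {P : Model n → Prop}
    (h : ∀ᶠ w' in 𝓝 w, P (coord v w')) : ∀ᶠ u in 𝓝 (coord v w), P u := by
  filter_upwards [(tendsto_coordSymm hw).eventually h, coord_coordSymm hw] with u h1 h2
  rwa [h2] at h1

theorem inverse_mfderiv_coordSymm {v w : TM n M} (hw : w ∈ coordSource v) :
    (mfderiv 𝓘(ℝ, Model n) (𝓡 n).tangent (coordSymm v) (coord v w)).inverse =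
      dcoord v (coordSymm v (coord v w)) := by
  have hu := (extChartAt (𝓡 n).tangent v).map_source hw
  have h1 := mfderivWithin_extChartAt_symm_comp_mfderiv_extChartAt hu
  have h2 := mfderiv_extChartAt_comp_mfderivWithin_extChartAt_symm hu
  rw [ModelWithCorners.range_eq_univ, mfderivWithin_univ] at h1 h2
  exact ContinuousLinearMap.inverse_eq h1 h2

theorem isInvertible_mfderiv_coordSymm {v w : TM n M} (hw : w ∈ coordSource v) :
    (mfderiv 𝓘(ℝ, Model n) (𝓡 n).tangent (coordSymm v) (coord v w)).IsInvertible := by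
  have := isInvertible_mfderivWithin_extChartAt_symm (I := (𝓡 n).tangent)
    ((extChartAt (𝓡 n).tangent v).map_source hw)
  rwa [ModelWithCorners.range_eq_univ, mfderivWithin_univ] at this

theorem mfderiv_eq_comp_dcoord {v w : TM n M} (hw : w ∈ coordSource v) {f : TM n M → ℝ}
    {g : Model n → ℝ} (hfg : ∀ᶠ w' in 𝓝 w, f w' = g (coord v w'))
    (hg : DifferentiableAt ℝ g (coord v w)) (ξ : TangentSpace (𝓡 n).tangent w) :
    mfderiv (𝓡 n).tangent 𝓘(ℝ, ℝ) f w ξ = fderiv ℝ g (coord v w) (dcoord v w ξ) := by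
  have h1 : f =ᶠ[𝓝 w] g ∘ coord v := hfg
  rw [h1.mfderiv_eq, mfderiv_comp (I' := 𝓘(ℝ, Model n)) w hg.mdifferentiableAt
    (mdifferentiableAt_coord hw), mfderiv_eq_fderiv]
  rfl

theorem lieD_eq {v w : TM n M} (hw : w ∈ coordSource v) {f : TM n M → ℝ}
    {g : Model n → ℝ} (hfg : ∀ᶠ w' in 𝓝 w, f w' = g (coord v w'))
    (hg : DifferentiableAt ℝ g (coord v w)) (X : VF n M) :
    lieD X f w = fderiv ℝ g (coord v w) (dcoord v w (X w)) :=
  mfderiv_eq_comp_dcoord hw hfg hg _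

theorem dbase_dproj {v w : TM n M} (hw : w ∈ coordSource v) (ξ : TangentSpace (𝓡 n).tangent w) :
    dbase v w.1 (dproj w ξ) = (dcoord v w ξ).1 := by
  have hb := mem_coordSource_iff.1 hw
  have hπ : MDifferentiableAt (𝓡 n).tangent (𝓡 n) (fun u : TM n M => u.1) w :=
    (Bundle.contMDiff_proj (n := ∞) (IB := 𝓡 n) (TangentSpace (𝓡 n) : M → Type _) w
      ).mdifferentiableAt (by simp)
  have h1 : (fun u : TM n M => extChartAt (𝓡 n) v.1 u.1) =ᶠ[𝓝 w]
      (Prod.fst ∘ coord v) := by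
    filter_upwards [(isOpen_coordSource v).mem_nhds hw] with u hu
    rw [Function.comp_apply, coord_eq hu]
  have h2 : HasMFDerivAt (𝓡 n).tangent 𝓘(ℝ, EuclideanSpace ℝ (Fin n))
      (fun u : TM n M => extChartAt (𝓡 n) v.1 u.1) w _ :=
    HasMFDerivAt.comp (I' := 𝓡 n) w (mdifferentiableAt_extChartAt hb).hasMFDerivAt hπ.hasMFDerivAt
  have h3 : HasMFDerivAt (𝓡 n).tangent 𝓘(ℝ, EuclideanSpace ℝ (Fin n)) (Prod.fst ∘ coord v) w _ :=
    HasMFDerivAt.comp (I' := 𝓘(ℝ, Model n)) w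
      (hasFDerivAt_fst (𝕜 := ℝ) (p := coord v w)).hasMFDerivAt
      (mdifferentiableAt_coord hw).hasMFDerivAt
  exact congrArg (fun L => L ξ) (hasMFDerivAt_unique h2 (h3.congr_of_eventuallyEq h1))

theorem dcoord_vlift {v w : TM n M} (hw : w ∈ coordSource v) (a : TangentSpace (𝓡 n) w.1) :
    dcoord v w (vlift w a) = (0, dbase v w.1 a) := by
  have hb := mem_coordSource_iff.1 hw
  set c : ℝ → TM n M := fun t => ⟨w.1, w.2 + t • a⟩ with hc
  have hmem : ∀ t, c t ∈ coordSource v := fun t => mem_coordSource_iff.2 hb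
  have hcoord : ∀ t, coord v (c t) = coord v w + t • ((0 : EuclideanSpace ℝ (Fin n)),
      dbase v w.1 a) := by
    intro t
    rw [coord_eq (hmem t), coord_eq hw]
    change (_, dbase v w.1 (w.2 + t • a)) = _
    rw [map_add, map_smul, Prod.smul_mk, Prod.mk_add_mk, smul_zero, add_zero]
  have hc0 : c 0 = w := by simp [hc]
  have hcs : c = coordSymm v ∘ fun t : ℝ => coord v w + t • ((0 : EuclideanSpace ℝ (Fin n)),
      dbase v w.1 a) := by
    funext t
    rw [Function.comp_apply, ← hcoord, coordSymm_coord (hmem t)]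
  have hline : HasDerivAt (fun t : ℝ => coord v w + t • ((0 : EuclideanSpace ℝ (Fin n)),
      dbase v w.1 a)) ((0 : EuclideanSpace ℝ (Fin n)), dbase v w.1 a) 0 := by
    simpa using ((hasDerivAt_id (0 : ℝ)).smul_const ((0 : EuclideanSpace ℝ (Fin n)),
      dbase v w.1 a)).const_add (coord v w)
  have hcd : MDifferentiableAt 𝓘(ℝ, ℝ) (𝓡 n).tangent c 0 := by
    rw [hcs]
    refine MDifferentiableAt.comp (I' := 𝓘(ℝ, Model n)) (0 : ℝ) ?_
      hline.differentiableAt.mdifferentiableAt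
    have := (contMDiffAt_coordSymm hw).mdifferentiableAt (by simp)
    simpa using this
  have h1 : HasMFDerivAt 𝓘(ℝ, ℝ) 𝓘(ℝ, Model n) (coord v ∘ c) 0 _ :=
    HasMFDerivAt.comp (I' := (𝓡 n).tangent) (0 : ℝ)
      (mdifferentiableAt_coord (hmem 0)).hasMFDerivAt hcd.hasMFDerivAt
  have h2 : coord v ∘ c = fun t : ℝ => coord v w + t • ((0 : EuclideanSpace ℝ (Fin n)),
      dbase v w.1 a) := funext hcoord
  rw [h2] at h1
  have h3 := congrArg (fun L => L (1 : ℝ)) (hasMFDerivAt_unique h1 hline.hasFDerivAt.hasMFDerivAt)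
  have h4 : ∀ w' : TM n M, w' = w → ∀ ξ : Model n, (dcoord v w' ξ : Model n) = dcoord v w ξ := by
    rintro _ rfl _; rfl
  refine (h4 _ hc0 (vlift w a)).symm.trans (h3.trans ?_)
  exact one_smul ℝ ((0 : EuclideanSpace ℝ (Fin n)), dbase v w.1 a)

/-! ### Coordinate representations of vector fields -/

/-- The vector field `X` is represented on `U` by the smooth map `f` in the coordinates of `v`. -/
def IsRep (v : TM n M) (U : Set (TM n M)) (X : VF n M) (f : Model n → Model n) : Prop :=
  ∀ w ∈ U, dcoord v w (X w) = f (coord v w) ∧ ContDiffAt ℝ ∞ f (coord v w)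

section Rep

variable {v : TM n M} {U : Set (TM n M)} {X Y : VF n M} {f g : Model n → Model n}

theorem IsRep.add (hX : IsRep v U X f) (hY : IsRep v U Y g) :
    IsRep v U (X + Y) (f + g) := fun w hw =>
  ⟨by rw [Pi.add_apply, map_add, (hX w hw).1, (hY w hw).1]; rfl, (hX w hw).2.add (hY w hw).2⟩

theorem IsRep.sub (hX : IsRep v U X f) (hY : IsRep v U Y g) :
    IsRep v U (X - Y) (f - g) := fun w hw =>
  ⟨by rw [Pi.sub_apply, map_sub, (hX w hw).1, (hY w hw).1]; rfl, (hX w hw).2.sub (hY w hw).2⟩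

theorem IsRep.neg (hX : IsRep v U X f) : IsRep v U (-X) (-f) := fun w hw =>
  ⟨by rw [Pi.neg_apply, map_neg, (hX w hw).1]; rfl, (hX w hw).2.neg⟩

theorem IsRep.smul (c : ℝ) (hX : IsRep v U X f) : IsRep v U (c • X) (c • f) := fun w hw =>
  ⟨by rw [Pi.smul_apply, map_smul, (hX w hw).1]; rfl, (hX w hw).2.const_smul c⟩

theorem IsRep.mono {U' : Set (TM n M)} (h : U' ⊆ U) (hX : IsRep v U X f) : IsRep v U' X f :=
  fun w hw => hX w (h hw)

theorem IsRep.congr_left (hX : IsRep v U X f) (h : EqOn X Y U) : IsRep v U Y f := fun w hw => by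
  rw [← h hw]; exact hX w hw

theorem IsRep.congr_right (hU : IsOpen U) (hUs : U ⊆ coordSource v) (hX : IsRep v U X f)
    (h : ∀ w ∈ U, f (coord v w) = g (coord v w)) : IsRep v U X g := fun w hw => by
  refine ⟨by rw [(hX w hw).1, h w hw], (hX w hw).2.congr_of_eventuallyEq ?_⟩
  refine eventually_coord (hUs hw) ?_
  filter_upwards [hU.mem_nhds hw] with w' hw' using (h w' hw').symm

theorem IsRep.eq_mpullback (hUs : U ⊆ coordSource v) (hX : IsRep v U X f) :
    EqOn X (VectorField.mpullback (𝓡 n).tangent 𝓘(ℝ, Model n) (coord v) f) U := by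
  intro w hw
  change X w = (dcoord v w).inverse (f (coord v w))
  rw [← (hX w hw).1]
  obtain ⟨e, he⟩ := isInvertible_dcoord (hUs hw)
  rw [← he, ContinuousLinearMap.inverse_equiv]
  simp

theorem IsRep.regularOn (hU : IsOpen U) (hUs : U ⊆ coordSource v) (hX : IsRep v U X f) :
    RegularOn ∞ X U := by
  intro w hw
  have h1 : ContMDiffAt 𝓘(ℝ, Model n) 𝓘(ℝ, Model n).tangent ∞
      (fun u => (⟨u, f u⟩ : TangentBundle 𝓘(ℝ, Model n) (Model n))) (coord v w) :=
    contMDiffAt_vectorSpace_iff_contDiffAt.2 (hX w hw).2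
  have h2 := ContMDiffAt.mpullback_vectorField_preimage h1 (contMDiffAt_coord (hUs hw))
    (isInvertible_dcoord (hUs hw)) (by simp)
  refine (h2.congr_of_eventuallyEq ?_).contMDiffWithinAt
  filter_upwards [hU.mem_nhds hw] with w' hw'
  rw [hX.eq_mpullback hUs hw']

theorem RegularOn.exists_isRep (hU : IsOpen U) (hUs : U ⊆ coordSource v) (hX : RegularOn ∞ X U) :
    ∃ f, IsRep v U X f := by
  refine ⟨fun u => dcoord v (coordSymm v u) (X (coordSymm v u)), fun w hw => ⟨?_, ?_⟩⟩
  · exact congrArg (fun w' => dcoord v w' (X w')) (coordSymm_coord (hUs hw)).symm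
  · have hws := hUs hw
    have hX' : ContMDiffAt (𝓡 n).tangent (𝓡 n).tangent.tangent ∞
        (fun w => (⟨w, X w⟩ : TangentBundle (𝓡 n).tangent (TM n M)))
        (coordSymm v (coord v w)) := by
      rw [coordSymm_coord hws]
      exact (hX w hw).contMDiffAt (hU.mem_nhds hw)
    have h2 := ContMDiffAt.mpullback_vectorField_preimage hX' (contMDiffAt_coordSymm hws)
      (isInvertible_mfderiv_coordSymm hws) (by simp)
    refine (contMDiffAt_vectorSpace_iff_contDiffAt.1 h2).congr_of_eventuallyEq ?_
    refine eventually_coord hws ?_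
    filter_upwards [(isOpen_coordSource v).mem_nhds hws] with w' hw'
    exact congrArg (fun L => L (X (coordSymm v (coord v w'))))
      (inverse_mfderiv_coordSymm hw').symm

/-- Lie brackets are computed in coordinates. -/
theorem IsRep.bracket (hU : IsOpen U) (hUs : U ⊆ coordSource v) (hX : IsRep v U X f)
    (hY : IsRep v U Y g) : IsRep v U (bracket X Y) (VectorField.lieBracket ℝ f g) := by
  intro w hw
  have hmd : ∀ {f : Model n → Model n}, ContDiffAt ℝ ∞ f (coord v w) →
      MDifferentiableAt 𝓘(ℝ, Model n) 𝓘(ℝ, Model n).tangent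
      (fun u => (⟨u, f u⟩ : TangentBundle 𝓘(ℝ, Model n) (Model n))) (coord v w) := fun h =>
    (contMDiffAt_vectorSpace_iff_contDiffAt.2 h).mdifferentiableAt (by simp)
  refine ⟨?_, (hX w hw).2.lieBracket_vectorField (hY w hw).2 (by simp)⟩
  have h1 : SprayGeometry.bracket X Y w = VectorField.mlieBracket (𝓡 n).tangent
      (VectorField.mpullback (𝓡 n).tangent 𝓘(ℝ, Model n) (coord v) f)
      (VectorField.mpullback (𝓡 n).tangent 𝓘(ℝ, Model n) (coord v) g) w :=
    Filter.EventuallyEq.mlieBracket_vectorField_eq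
      ((hX.eq_mpullback hUs).eventuallyEq_of_mem (hU.mem_nhds hw))
      ((hY.eq_mpullback hUs).eventuallyEq_of_mem (hU.mem_nhds hw))
  rw [h1, ← VectorField.mpullback_mlieBracket (hmd (hX w hw).2) (hmd (hY w hw).2)
    (contMDiffAt_coord (hUs hw)) (by simpa using two_le_infty)]
  obtain ⟨e, he⟩ := isInvertible_dcoord (hUs hw)
  have h2 : VectorField.mlieBracket 𝓘(ℝ, Model n) f g = VectorField.lieBracket ℝ f g :=
    VectorField.mlieBracketWithin_univ.symm.trans
      (VectorField.mlieBracketWithin_eq_lieBracketWithin.trans VectorField.lieBracketWithin_univ)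
  have h3 : ∀ η : Model n, dcoord v w ((dcoord v w).inverse η) = η := by
    intro η
    rw [← he, ContinuousLinearMap.inverse_equiv]
    exact e.apply_symm_apply _
  exact (h3 _).trans (congrFun h2 _)

end Rep

/-! ### Spray geometry in coordinates -/

section Flat

open VectorField

variable {G W : Type*} [NormedAddCommGroup G] [NormedSpace ℝ G]
  [NormedAddCommGroup W] [NormedSpace ℝ W]

/-- The derivative along the fibre variable: `vder f (x, y) b = bⁱ ∂f/∂yⁱ`. -/
def vder (f : G × G → W) (u : G × G) : G →L[ℝ] W := fderiv ℝ f u ∘L .inr ℝ G G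

/-- The connection coefficients `Nⁱⱼ = -½ ∂σⁱ/∂yʲ` of the spray `(y, σ)`. -/
def conn (σ : G × G → G) (u : G × G) : G →L[ℝ] G := (-1 / 2 : ℝ) • vder σ u

theorem vder_apply (f : G × G → W) (u : G × G) (b : G) : vder f u b = fderiv ℝ f u (0, b) := rfl

/-- The horizontal part of a field, in coordinates. -/
def flatHor (σ : G × G → G) (f : G × G → G × G) (u : G × G) : G × G :=
  ((f u).1, -conn σ u (f u).1)

/-- The vertical part of a field, in coordinates, as a field on the fibres. -/
def flatVer (σ : G × G → G) (f : G × G → G × G) (u : G × G) : G :=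
  (f u).2 + conn σ u (f u).1

/-- The vertical field with components `k`. -/
def vert (k : G × G → G) (u : G × G) : G × G := (0, k u)

/-- The components of the Berwald derivative of the vertical field `k` along `f`. -/
def flatNabla (σ : G × G → G) (f : G × G → G × G) (k : G × G → G) (u : G × G) : G :=
  fderiv ℝ k u (f u) + vder (conn σ) u (k u) (f u).1

/-- The almost complex structure, in coordinates. -/
def flatAcs (σ : G × G → G) (f : G × G → G × G) (u : G × G) : G × G :=
  (flatVer σ f u, -conn σ u (flatVer σ f u) - (f u).1)

/-- The spray with fibre components `σ`. -/
def flatSpray (σ : G × G → G) (u : G × G) : G × G := (u.2, σ u)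

section smooth

variable {σ : G × G → G} {f g : G × G → G × G} {k : G × G → G} {F : G × G → W} {u : G × G}

theorem contDiffAt_vder (h : ContDiffAt ℝ ∞ F u) : ContDiffAt ℝ ∞ (vder F) u :=
  (h.fderiv_right (m := ∞) (by simp)).clm_comp contDiffAt_const

theorem contDiffAt_conn (h : ContDiffAt ℝ ∞ σ u) : ContDiffAt ℝ ∞ (conn σ) u :=
  (contDiffAt_vder h).const_smul _

theorem contDiffAt_flatVer (hσ : ContDiffAt ℝ ∞ σ u) (hf : ContDiffAt ℝ ∞ f u) :
    ContDiffAt ℝ ∞ (flatVer σ f) u :=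
  hf.snd.add ((contDiffAt_conn hσ).clm_apply hf.fst)

theorem contDiffAt_flatHor (hσ : ContDiffAt ℝ ∞ σ u) (hf : ContDiffAt ℝ ∞ f u) :
    ContDiffAt ℝ ∞ (flatHor σ f) u :=
  hf.fst.prodMk ((contDiffAt_conn hσ).clm_apply hf.fst).neg

theorem contDiffAt_vert (hk : ContDiffAt ℝ ∞ k u) : ContDiffAt ℝ ∞ (vert k) u :=
  contDiffAt_const.prodMk hk

theorem contDiffAt_flatSpray (hσ : ContDiffAt ℝ ∞ σ u) : ContDiffAt ℝ ∞ (flatSpray σ) u :=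
  contDiffAt_snd.prodMk hσ

theorem contDiffAt_flatAcs (hσ : ContDiffAt ℝ ∞ σ u) (hf : ContDiffAt ℝ ∞ f u) :
    ContDiffAt ℝ ∞ (flatAcs σ f) u :=
  (contDiffAt_flatVer hσ hf).prodMk
    (((contDiffAt_conn hσ).clm_apply (contDiffAt_flatVer hσ hf)).neg.sub hf.fst)

end smooth

theorem hasFDerivAt_of_contDiffAt {V : Type*} [NormedAddCommGroup V] [NormedSpace ℝ V] {f : V → W}
    {u : V} (h : ContDiffAt ℝ ∞ f u) : HasFDerivAt f (fderiv ℝ f u) u :=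
  (h.differentiableAt (by simp)).hasFDerivAt

theorem fderiv_pair {a b : G × G → G} {u : G × G} (ha : ContDiffAt ℝ ∞ a u)
    (hb : ContDiffAt ℝ ∞ b u) (h : G × G) :
    fderiv ℝ (fun u => (a u, b u)) u h = (fderiv ℝ a u h, fderiv ℝ b u h) := by
  rw [((hasFDerivAt_of_contDiffAt ha).prodMk (hasFDerivAt_of_contDiffAt hb)).fderiv]; rfl

theorem fderiv_clm_apply_apply {V : Type*} [NormedAddCommGroup V] [NormedSpace ℝ V]
    {A : V → G →L[ℝ] W} {a : V → G} {u : V} (hA : ContDiffAt ℝ ∞ A u)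
    (ha : ContDiffAt ℝ ∞ a u) (h : V) :
    fderiv ℝ (fun u => A u (a u)) u h = fderiv ℝ A u h (a u) + A u (fderiv ℝ a u h) := by
  rw [((hasFDerivAt_of_contDiffAt hA).clm_apply (hasFDerivAt_of_contDiffAt ha)).fderiv]
  simp [add_comm]

theorem fderiv_comp_fst {f : G × G → G × G} {u : G × G} (hf : ContDiffAt ℝ ∞ f u) (h : G × G) :
    fderiv ℝ (fun u => (f u).1) u h = (fderiv ℝ f u h).1 := by
  rw [(hasFDerivAt_of_contDiffAt hf).fst.fderiv]; rfl

variable {σ : G × G → G} {f g : G × G → G × G} {k : G × G → G} {u : G × G}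

theorem fderiv_flatSpray (hσ : ContDiffAt ℝ ∞ σ u) (h : G × G) :
    fderiv ℝ (flatSpray σ) u h = (h.2, fderiv ℝ σ u h) := by
  change fderiv ℝ (fun u => (u.2, σ u)) u h = _
  rw [fderiv_pair contDiffAt_snd hσ, fderiv_snd]; rfl

theorem fderiv_vert (hk : ContDiffAt ℝ ∞ k u) (h : G × G) :
    fderiv ℝ (vert k) u h = (0, fderiv ℝ k u h) := by
  change fderiv ℝ (fun u => ((0 : G), k u)) u h = _
  rw [fderiv_pair contDiffAt_const hk, fderiv_fun_const]; rfl

theorem fderiv_flatHor (hσ : ContDiffAt ℝ ∞ σ u) (hf : ContDiffAt ℝ ∞ f u) (h : G × G) :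
    fderiv ℝ (flatHor σ f) u h = ((fderiv ℝ f u h).1,
      -(fderiv ℝ (conn σ) u h (f u).1 + conn σ u (fderiv ℝ f u h).1)) := by
  change fderiv ℝ (fun u => ((f u).1, -conn σ u (f u).1)) u h = _
  rw [fderiv_pair hf.fst ((contDiffAt_conn hσ).clm_apply hf.fst).neg, fderiv_comp_fst hf,
    fderiv_fun_neg, neg_apply, fderiv_clm_apply_apply (contDiffAt_conn hσ) hf.fst,
    fderiv_comp_fst hf]

theorem two_smul_conn (σ : G × G → G) (u : G × G) (a : G) :
    fderiv ℝ σ u (0, a) = -(2 : ℝ) • conn σ u a := by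
  simp only [conn, smul_apply, vder_apply, smul_smul]
  norm_num

/-- The horizontal projector `h = ½(I + [J, S])` in coordinates. -/
theorem flatHor_eq (hσ : ContDiffAt ℝ ∞ σ u) (hf : ContDiffAt ℝ ∞ f u) :
    ((1 / 2 : ℝ) • (f u + (lieBracket ℝ (vert fun u => (f u).1) (flatSpray σ) u -
      vert (fun u => (lieBracket ℝ f (flatSpray σ) u).1) u))) = flatHor σ f u := by
  have h1 := fderiv_vert (k := fun u => (f u).1) hf.fst (flatSpray σ u)
  simp only [lieBracket]
  rw [h1, fderiv_flatSpray hσ, fderiv_comp_fst hf]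
  simp only [vert, flatHor]
  rw [fderiv_flatSpray hσ, two_smul_conn]
  ext
  · simp only [Prod.smul_fst, Prod.fst_add, Prod.fst_sub]
    simp only [sub_zero, smul_add]
    rw [← smul_add, ← two_smul ℝ (f u).1, smul_smul]; norm_num
  · simp only [Prod.smul_snd, Prod.snd_add, Prod.snd_sub, Prod.fst_sub]
    module

theorem flatAcs_eq (hσ : ContDiffAt ℝ ∞ σ u) (hf : ContDiffAt ℝ ∞ f u) :
    -flatHor σ (lieBracket ℝ (flatSpray σ) (vert (flatVer σ f))) u - vert (fun u => (f u).1) u =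
      flatAcs σ f u := by
  have h1 : (lieBracket ℝ (flatSpray σ) (vert (flatVer σ f)) u).1 = -flatVer σ f u := by
    simp only [lieBracket]
    rw [fderiv_flatSpray hσ, fderiv_vert (contDiffAt_flatVer hσ hf)]
    simp [vert]
  simp only [flatHor, h1, vert, flatAcs]
  ext <;> simp

theorem flatNabla_eq (hσ : ContDiffAt ℝ ∞ σ u) (hf : ContDiffAt ℝ ∞ f u)
    (hk : ContDiffAt ℝ ∞ k u) :
    vert (flatVer σ (lieBracket ℝ (flatHor σ f) (vert k))) u +
      (lieBracket ℝ (vert (flatVer σ f)) (vert k) u -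
        vert (fun u => (lieBracket ℝ (flatAcs σ f) (vert k) u).1) u) =
      vert (flatNabla σ f k) u := by
  have hv := contDiffAt_flatVer hσ hf
  have h1 : lieBracket ℝ (vert (flatVer σ f)) (vert k) u =
      (0, fderiv ℝ k u (0, flatVer σ f u) - fderiv ℝ (flatVer σ f) u (0, k u)) := by
    simp only [lieBracket]
    rw [fderiv_vert hv, fderiv_vert hk]
    simp [vert]
  have h2 : (lieBracket ℝ (flatAcs σ f) (vert k) u).1 = -fderiv ℝ (flatVer σ f) u (0, k u) := by
    simp only [lieBracket]
    rw [fderiv_vert hk, Prod.fst_sub, ← fderiv_comp_fst (contDiffAt_flatAcs hσ hf)]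
    simp [vert, flatAcs]
  have h3 : lieBracket ℝ (flatHor σ f) (vert k) u = (-(fderiv ℝ f u (0, k u)).1,
      fderiv ℝ k u (flatHor σ f u) + (fderiv ℝ (conn σ) u (0, k u) (f u).1 +
        conn σ u (fderiv ℝ f u (0, k u)).1)) := by
    simp only [lieBracket]
    rw [fderiv_vert hk, fderiv_flatHor hσ hf]
    simp [vert]
    abel
  have h4 : f u = flatHor σ f u + (0, flatVer σ f u) := by
    simp [flatHor, flatVer]
  have h5 : fderiv ℝ k u (f u) =
      fderiv ℝ k u (flatHor σ f u) + fderiv ℝ k u (0, flatVer σ f u) := by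
    rw [← map_add, ← h4]
  rw [h1]
  simp only [vert, flatNabla, h2]
  rw [h5, vder_apply]
  conv_lhs => enter [1]; simp only [flatVer]
  rw [h3]
  ext
  · simp
  · simp only [Prod.snd_add, Prod.snd_sub, map_neg]
    abel

theorem flatBerwald_eq {k l : G × G → G} (hσ : ContDiffAt ℝ ∞ σ u) (hf : ContDiffAt ℝ ∞ f u)
    (hk : ContDiffAt ℝ ∞ k u) (hl : ContDiffAt ℝ ∞ l u) :
    flatNabla σ (flatHor σ f) (flatNabla σ (vert k) l) u -
      flatNabla σ (vert k) (flatNabla σ (flatHor σ f) l) u -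
      flatNabla σ (lieBracket ℝ (flatHor σ f) (vert k)) l u =
      -vder (vder (conn σ)) u (k u) (l u) (f u).1 := by
  have hN := contDiffAt_conn hσ
  have hB := contDiffAt_vder hN
  have hh := contDiffAt_flatHor hσ hf
  have hv := contDiffAt_vert hk
  have hl' : ContDiffAt ℝ ∞ (fderiv ℝ l) u := hl.fderiv_right (by simp)
  have e1 : flatNabla σ (vert k) l = fun u => fderiv ℝ l u (vert k u) := by
    funext u; simp [flatNabla, vert]
  have e2 : ∀ h, fderiv ℝ (flatNabla σ (vert k) l) u h =
      fderiv ℝ (fderiv ℝ l) u h (vert k u) + fderiv ℝ l u (0, fderiv ℝ k u h) := by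
    intro h
    rw [e1, fderiv_clm_apply_apply hl' hv, fderiv_vert hk]
  have e3 : ∀ h, fderiv ℝ (flatNabla σ (flatHor σ f) l) u h =
      (fderiv ℝ (fderiv ℝ l) u h (flatHor σ f u) + fderiv ℝ l u (fderiv ℝ (flatHor σ f) u h)) +
      ((fderiv ℝ (vder (conn σ)) u h (l u) + vder (conn σ) u (fderiv ℝ l u h)) (f u).1 +
        vder (conn σ) u (l u) (fderiv ℝ f u h).1) := by
    intro h
    have : flatNabla σ (flatHor σ f) l = fun u => fderiv ℝ l u (flatHor σ f u) +
        (vder (conn σ) u (l u)) (f u).1 := rfl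
    have h1 := (hl'.clm_apply hh)
    have h2 := ((hB.clm_apply hl).clm_apply hf.fst)
    rw [this, fderiv_fun_add (h1.differentiableAt (by simp)) (h2.differentiableAt (by simp)),
      add_apply,
      fderiv_clm_apply_apply hl' hh, fderiv_clm_apply_apply (hB.clm_apply hl) hf.fst,
      fderiv_clm_apply_apply hB hl, fderiv_comp_fst hf]
  have hsymm : fderiv ℝ (fderiv ℝ l) u (flatHor σ f u) (vert k u) =
      fderiv ℝ (fderiv ℝ l) u (vert k u) (flatHor σ f u) :=
    (hl.isSymmSndFDerivAt (by simpa using two_le_infty)) _ _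
  have e4 : lieBracket ℝ (flatHor σ f) (vert k) u =
      (0, fderiv ℝ k u (flatHor σ f u)) - fderiv ℝ (flatHor σ f) u (vert k u) := by
    simp only [lieBracket]
    rw [fderiv_vert hk]
  have e5 : (fderiv ℝ (flatHor σ f) u (vert k u)).1 = (fderiv ℝ f u (vert k u)).1 := by
    rw [fderiv_flatHor hσ hf]
  have e6 : flatNabla σ (flatHor σ f) (flatNabla σ (vert k) l) u =
      fderiv ℝ (flatNabla σ (vert k) l) u (flatHor σ f u) +
        vder (conn σ) u (flatNabla σ (vert k) l u) (f u).1 := rfl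
  have e7 : flatNabla σ (vert k) (flatNabla σ (flatHor σ f) l) u =
      fderiv ℝ (flatNabla σ (flatHor σ f) l) u (vert k u) := by
    change fderiv ℝ (flatNabla σ (flatHor σ f) l) u (vert k u) +
      vder (conn σ) u (flatNabla σ (flatHor σ f) l u) (vert k u).1 = _
    simp [vert]
  have e8 : flatNabla σ (lieBracket ℝ (flatHor σ f) (vert k)) l u =
      fderiv ℝ l u ((0, fderiv ℝ k u (flatHor σ f u)) - fderiv ℝ (flatHor σ f) u (vert k u)) +
      vder (conn σ) u (l u) (-(fderiv ℝ f u (vert k u)).1) := by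
    change fderiv ℝ l u (lieBracket ℝ (flatHor σ f) (vert k) u) +
      vder (conn σ) u (l u) (lieBracket ℝ (flatHor σ f) (vert k) u).1 = _
    rw [e4, Prod.fst_sub, e5]; simp
  rw [e6, e7, e8, e2, e3, hsymm, congrFun e1 u]
  simp only [map_sub, map_neg, add_apply]
  rw [vder_apply (vder (conn σ))]
  simp only [vert]
  abel

end Flat

/-! ### Homogeneity and the metric conditions in coordinates -/

section FlatMetric

open VectorField

variable {G W : Type*} [NormedAddCommGroup G] [NormedSpace ℝ G]
  [NormedAddCommGroup W] [NormedSpace ℝ W]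

theorem fderiv_vder_apply {F : G × G → W} {u : G × G} (hF : ContDiffAt ℝ ∞ F u) (h : G × G)
    (b : G) : fderiv ℝ (vder F) u h b = fderiv ℝ (fderiv ℝ F) u h (0, b) := by
  have h1 := (hasFDerivAt_of_contDiffAt (hF.fderiv_right (m := ∞) (by simp))).clm_comp
    (hasFDerivAt_const (ContinuousLinearMap.inr ℝ G G) u)
  change fderiv ℝ (fun u => fderiv ℝ F u ∘L .inr ℝ G G) u h b = _
  rw [h1.fderiv]
  simp

theorem fderiv_fderiv_symm {F : G × G → W} {u : G × G} (hF : ContDiffAt ℝ ∞ F u) (h k : G × G) :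
    fderiv ℝ (fderiv ℝ F) u h k = fderiv ℝ (fderiv ℝ F) u k h :=
  hF.isSymmSndFDerivAt (by simpa using two_le_infty) _ _

theorem vder_vder_symm {F : G × G → W} {u : G × G} (hF : ContDiffAt ℝ ∞ F u) (a b : G) :
    vder (vder F) u a b = vder (vder F) u b a := by
  rw [vder_apply, vder_apply, fderiv_vder_apply hF, fderiv_vder_apply hF, fderiv_fderiv_symm hF]

theorem vder_congr {F F' : G × G → W} {u : G × G} (h : F =ᶠ[𝓝 u] F') : vder F u = vder F' u := by
  simp only [vder, h.fderiv_eq]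

/-- Euler's relation lowers the degree by one under a derivative along the fibre. -/
theorem vder_vder_self {F : G × G → W} {u : G × G} {κ : ℝ} (hF : ContDiffAt ℝ ∞ F u)
    (h : ∀ᶠ w in 𝓝 u, vder F w w.2 = κ • F w) :
    vder (vder F) u u.2 = (κ - 1) • vder F u := by
  ext a
  have h1 : vder (fun w => vder F w w.2) u a = vder (fun w => κ • F w) u a := by
    rw [vder_congr h]
  rw [vder_apply, vder_apply, fderiv_clm_apply_apply (contDiffAt_vder hF) contDiffAt_snd,
    fderiv_snd, fderiv_fun_const_smul (hF.differentiableAt (by simp))] at h1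
  rw [vder_vder_symm hF, vder_apply (vder F), eq_sub_of_add_eq h1]
  simp only [smul_apply, sub_smul, vder_apply, one_smul]
  rfl

variable {σ : G × G → G} {f g h : G × G → G × G} {k : G × G → G} {u : G × G}

/-- The spray coefficients are homogeneous of degree two near `u`. -/
def HomNear (σ : G × G → G) (u : G × G) : Prop :=
  ∀ᶠ w in 𝓝 u, ContDiffAt ℝ ∞ σ w ∧ vder σ w w.2 = (2 : ℝ) • σ w

theorem HomNear.eventually (hσ : HomNear σ u) : ∀ᶠ w in 𝓝 u, HomNear σ w :=
  hσ.eventually_nhds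

theorem HomNear.contDiffAt (hσ : HomNear σ u) : ContDiffAt ℝ ∞ σ u := hσ.self_of_nhds.1

theorem conn_self (hσ : HomNear σ u) : conn σ u u.2 = -σ u := by
  simp only [conn, smul_apply, hσ.self_of_nhds.2, smul_smul]
  norm_num

theorem vder_conn_self (hσ : HomNear σ u) : vder (conn σ) u u.2 = conn σ u := by
  have h1 := vder_vder_self hσ.contDiffAt (hσ.mono fun _ hw => hw.2)
  have h2 : vder (conn σ) u = (-1 / 2 : ℝ) • vder (vder σ) u := by
    ext b
    change fderiv ℝ (fun u => (-1 / 2 : ℝ) • vder σ u) u (0, b) _ = _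
    rw [fderiv_fun_const_smul ((contDiffAt_vder hσ.contDiffAt).differentiableAt (by simp))]
    rfl
  rw [h2, smul_apply, h1, conn]
  norm_num

theorem vder_conn_symm (hσ : ContDiffAt ℝ ∞ σ u) (a b : G) :
    vder (conn σ) u a b = vder (conn σ) u b a := by
  have h2 : vder (conn σ) u = (-1 / 2 : ℝ) • vder (vder σ) u := by
    ext b
    change fderiv ℝ (fun u => (-1 / 2 : ℝ) • vder σ u) u (0, b) _ = _
    rw [fderiv_fun_const_smul ((contDiffAt_vder hσ).differentiableAt (by simp))]
    rfl
  simp only [h2, smul_apply, vder_vder_symm hσ a b]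

theorem vder_curv_self (hσ : HomNear σ u) :
    vder (vder (vder (conn σ))) u u.2 = -vder (vder (conn σ)) u := by
  have hN := contDiffAt_conn hσ.contDiffAt
  have h1 : ∀ᶠ w in 𝓝 u, vder (vder (conn σ)) w w.2 = (0 : ℝ) • vder (conn σ) w := by
    filter_upwards [hσ.eventually.eventually_nhds] with w hw
    have := vder_vder_self (κ := 1) (contDiffAt_conn hw.self_of_nhds.contDiffAt)
      (hw.mono fun q hq => by rw [vder_conn_self hq, one_smul])
    rw [this, sub_self]
  rw [vder_vder_self (contDiffAt_vder hN) h1]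
  norm_num

/-- The canonical vertical field in coordinates. -/
def flatC : G × G → G × G := vert Prod.snd

theorem contDiffAt_flatC : ContDiffAt ℝ ∞ (flatC : G × G → G × G) u :=
  contDiffAt_vert contDiffAt_snd

theorem fderiv_flatC (a : G × G) : fderiv ℝ (flatC : G × G → G × G) u a = (0, a.2) := by
  rw [flatC, fderiv_vert contDiffAt_snd, fderiv_snd]
  rfl

/-- The condition `[C, S] = S` says that the spray coefficients have degree two. -/
theorem vder_eq_of_lieBracket_flatC (hσ : ContDiffAt ℝ ∞ σ u)
    (h : lieBracket ℝ flatC (flatSpray σ) u = flatSpray σ u) : vder σ u u.2 = (2 : ℝ) • σ u := by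
  have h1 := congrArg Prod.snd h
  simp only [lieBracket] at h1
  rw [fderiv_flatSpray hσ, fderiv_flatC, Prod.snd_sub] at h1
  rw [vder_apply, two_smul]
  exact sub_eq_iff_eq_add.1 h1

theorem lieBracket_flatC_fst (f : G × G → G × G) (u : G × G) :
    (lieBracket ℝ flatC f u).1 = (fderiv ℝ f u (0, u.2)).1 := by
  simp only [lieBracket]
  rw [fderiv_flatC, Prod.fst_sub, sub_zero]
  rfl

theorem lieBracket_flatC_flatHor (hσ : HomNear σ u) (hf : ContDiffAt ℝ ∞ f u) :
    lieBracket ℝ flatC (flatHor σ f) u = flatHor σ (lieBracket ℝ flatC f) u := by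
  simp only [flatHor, lieBracket_flatC_fst]
  simp only [lieBracket]
  have h1 := vder_conn_self hσ
  rw [fderiv_flatC]
  change fderiv ℝ (flatHor σ f) u (0, u.2) - _ = _
  rw [fderiv_flatHor hσ.contDiffAt hf, ← vder_apply (conn σ), h1]
  ext <;> simp [flatHor]

/-- The Berwald curvature in coordinates, as a vertical field. -/
def flatBerwald (σ : G × G → G) (f g h : G × G → G × G) (u : G × G) : G × G :=
  vert (fun u => -vder (vder (conn σ)) u (g u).1 (h u).1 (f u).1) u

/-- The Berwald curvature is homogeneous of degree `-1`, so bracketing with `C` acts on it as a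
derivation up to a multiple of the curvature itself. -/
theorem lieBracket_flatC_flatBerwald (hσ : HomNear σ u) (hf : ContDiffAt ℝ ∞ f u)
    (hg : ContDiffAt ℝ ∞ g u) (hh : ContDiffAt ℝ ∞ h u) :
    lieBracket ℝ flatC (flatBerwald σ f g h) u =
      flatBerwald σ (lieBracket ℝ flatC f) g h u + flatBerwald σ f (lieBracket ℝ flatC g) h u +
        flatBerwald σ f g (lieBracket ℝ flatC h) u - (2 : ℝ) • flatBerwald σ f g h u := by
  have hR := contDiffAt_vder (contDiffAt_vder (contDiffAt_conn hσ.contDiffAt))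
  have h1 := vder_curv_self hσ
  have hRg := hR.clm_apply hg.fst
  have hRgh := hRg.clm_apply hh.fst
  have hk := (hRgh.clm_apply hf.fst).neg
  have e1 : fderiv ℝ (flatBerwald σ f g h) u (0, u.2) =
      (0, -(((-vder (vder (conn σ)) u (g u).1 + vder (vder (conn σ)) u
        (fderiv ℝ g u (0, u.2)).1) (h u).1 + vder (vder (conn σ)) u (g u).1
        (fderiv ℝ h u (0, u.2)).1) (f u).1 + vder (vder (conn σ)) u (g u).1 (h u).1
        (fderiv ℝ f u (0, u.2)).1)) := by
    change fderiv ℝ (vert (fun u => -vder (vder (conn σ)) u (g u).1 (h u).1 (f u).1)) u _ = _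
    rw [fderiv_vert hk, fderiv_fun_neg, neg_apply, fderiv_clm_apply_apply hRgh hf.fst,
      fderiv_clm_apply_apply hRg hh.fst, fderiv_clm_apply_apply hR hg.fst, fderiv_comp_fst hf,
      fderiv_comp_fst hg, fderiv_comp_fst hh, ← vder_apply, h1, neg_apply]
  have e2 : lieBracket ℝ flatC (flatBerwald σ f g h) u =
      fderiv ℝ (flatBerwald σ f g h) u (0, u.2) - flatBerwald σ f g h u := by
    simp only [lieBracket]
    rw [fderiv_flatC]
    rfl
  rw [e2, e1]
  simp only [flatBerwald, vert, lieBracket_flatC_fst]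
  ext
  · simp
  · simp only [Prod.snd_add, Prod.snd_sub, Prod.smul_snd, add_apply, neg_apply]
    module

variable {E : G × G → ℝ}

/-- If the horizontal derivative of `ζ` along `a` is `κ`, the horizontal derivative of its fibre
derivative differs from that of `κ` by the Berwald connection term. -/
theorem fderiv_vder_horizontal {ζ κ : G × G → W} (hσ : ContDiffAt ℝ ∞ σ u)
    (hζ : ContDiffAt ℝ ∞ ζ u) (a : G)
    (h : ∀ᶠ w in 𝓝 u, fderiv ℝ ζ w (a, -conn σ w a) = κ w) (c : G) :
    fderiv ℝ (vder ζ) u (a, -conn σ u a) c = vder κ u c + vder ζ u (vder (conn σ) u c a) := by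
  have hN := contDiffAt_conn hσ
  have hNa : ContDiffAt ℝ ∞ (fun w => -conn σ w a) u := (hN.clm_apply contDiffAt_const).neg
  rw [← vder_congr h, vder_apply, fderiv_vder_apply hζ]
  have h2 : ContDiffAt ℝ ∞ (fun w => (a, -conn σ w a)) u := contDiffAt_const.prodMk hNa
  have e1 := (hasFDerivAt_of_contDiffAt (hζ.fderiv_right (m := ∞) (by simp))).clm_apply
    (hasFDerivAt_of_contDiffAt h2)
  rw [e1.fderiv]
  simp only [add_apply, ContinuousLinearMap.comp_apply, ContinuousLinearMap.flip_apply]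
  rw [fderiv_pair contDiffAt_const hNa, fderiv_fun_neg, neg_apply,
    fderiv_clm_apply_apply hN contDiffAt_const, fderiv_fun_const, fderiv_fderiv_symm hζ]
  simp only [Pi.zero_apply, zero_apply, map_zero, add_zero]
  rw [← vder_apply (conn σ)]
  have : ((0 : G), -vder (conn σ) u c a) = -(0, vder (conn σ) u c a) := by simp
  rw [this, map_neg, vder_apply ζ]
  abel

/-- `E` is constant along the horizontal distribution, near `u`. -/
def HorConst (σ : G × G → G) (E : G × G → ℝ) (u : G × G) : Prop :=
  ∀ᶠ w in 𝓝 u, ∀ a, fderiv ℝ E w (a, -conn σ w a) = 0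

theorem fderiv_vder_of_horConst (hσ : ContDiffAt ℝ ∞ σ u) (hE : ContDiffAt ℝ ∞ E u)
    (h : HorConst σ E u) (a c : G) :
    fderiv ℝ (vder E) u (a, -conn σ u a) c = vder E u (vder (conn σ) u c a) := by
  rw [fderiv_vder_horizontal (κ := fun _ => 0) hσ hE a (h.mono fun w hw => hw a), vder_apply]
  simp

/-- For `E` constant along the horizontal distribution, the covariant derivative of the
fundamental tensor is the curvature applied to `E`. -/
theorem landsberg_eq_of_horConst (hσ' : HomNear σ u)
    (hE' : ∀ᶠ w in 𝓝 u, ContDiffAt ℝ ∞ E w) (h : HorConst σ E u) (a b c : G) :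
    fderiv ℝ (vder (vder E)) u (a, -conn σ u a) c b - vder (vder E) u (vder (conn σ) u c a) b -
        vder (vder E) u c (vder (conn σ) u b a) =
      vder E u (vder (vder (conn σ)) u c b a) := by
  have hσ := hσ'.contDiffAt
  have hE := hE'.self_of_nhds
  have hB := contDiffAt_vder (contDiffAt_conn hσ)
  have hη := contDiffAt_vder hE
  set κ : G × G → G →L[ℝ] ℝ := fun w => vder E w ∘L (vder (conn σ) w).flip a with hκ
  have hBa : ContDiffAt ℝ ∞ (fun w => (vder (conn σ) w).flip a) u :=
    (((ContinuousLinearMap.flipₗᵢ ℝ G G G).contDiff.contDiffAt).comp u hB).clm_apply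
      contDiffAt_const
  have h1 : ∀ᶠ w in 𝓝 u, fderiv ℝ (vder E) w (a, -conn σ w a) = κ w := by
    filter_upwards [hσ'.eventually, hE', h.eventually_nhds] with w h1 h2 h3
    ext b
    exact fderiv_vder_of_horConst h1.contDiffAt h2 h3 a b
  have hκd : ContDiffAt ℝ ∞ κ u := hη.clm_comp hBa
  rw [fderiv_vder_horizontal hσ hη a h1]
  have e2 : vder κ u c b = vder (fun w => vder E w (vder (conn σ) w b a)) u c := by
    change fderiv ℝ κ u (0, c) b = fderiv ℝ (fun w => κ w b) u (0, c)
    rw [fderiv_clm_apply_apply hκd contDiffAt_const, fderiv_fun_const]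
    simp
  have e3 : vder (fun w => vder E w (vder (conn σ) w b a)) u c =
      vder (vder E) u c (vder (conn σ) u b a) + vder E u (vder (vder (conn σ)) u c b a) := by
    rw [vder_apply, fderiv_clm_apply_apply hη ((hB.clm_apply contDiffAt_const).clm_apply
      contDiffAt_const), fderiv_clm_apply_apply (hB.clm_apply contDiffAt_const) contDiffAt_const,
      fderiv_clm_apply_apply hB contDiffAt_const, fderiv_fun_const, fderiv_fun_const]
    simp only [Pi.zero_apply, zero_apply, map_zero, add_zero]
    rfl
  rw [add_apply, e2, e3]
  ring

/-- The covariant derivative `(∇_{hX} g)(JY, JZ)` of the fundamental tensor `g` of `E`. -/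
theorem flat_covariant_eq {f₁ f₂ : G × G → G} (hE : ContDiffAt ℝ ∞ E u)
    (h₁ : ContDiffAt ℝ ∞ f₁ u) (h₂ : ContDiffAt ℝ ∞ f₂ u) :
    fderiv ℝ (fun w => vder (vder E) w (f₁ w) (f₂ w)) u (flatHor σ f u) -
      vder (vder E) u (flatNabla σ (flatHor σ f) f₁ u) (f₂ u) -
      vder (vder E) u (f₁ u) (flatNabla σ (flatHor σ f) f₂ u) =
    fderiv ℝ (vder (vder E)) u ((f u).1, -conn σ u (f u).1) (f₁ u) (f₂ u) -
      vder (vder E) u (vder (conn σ) u (f₁ u) (f u).1) (f₂ u) -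
      vder (vder E) u (f₁ u) (vder (conn σ) u (f₂ u) (f u).1) := by
  have hg := contDiffAt_vder (contDiffAt_vder hE)
  rw [fderiv_clm_apply_apply (hg.clm_apply h₁) h₂, fderiv_clm_apply_apply hg h₁]
  simp only [flatNabla, flatHor, map_add, add_apply]
  ring

/-- The Euler–Lagrange form `i_S Ω_E + d 𝓛_C E - dE` in coordinates. -/
theorem flat_eulerLagrange_eq (hE : ContDiffAt ℝ ∞ E u) (hσ : ContDiffAt ℝ ∞ σ u)
    (hf : ContDiffAt ℝ ∞ f u) :
    fderiv ℝ (fun w => vder E w (f w).1) u (flatSpray σ u) -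
        vder E u (lieBracket ℝ (flatSpray σ) f u).1 - fderiv ℝ E u (f u) =
      fderiv ℝ (vder E) u (flatSpray σ u) (f u).1 - fderiv ℝ E u ((f u).1, 0) := by
  have h1 : fderiv ℝ E u (f u) = fderiv ℝ E u ((f u).1, 0) + vder E u (f u).2 := by
    rw [vder_apply, ← map_add]
    simp
  rw [fderiv_clm_apply_apply (contDiffAt_vder hE) hf.fst, fderiv_comp_fst hf, h1]
  simp only [lieBracket]
  rw [fderiv_flatSpray hσ, Prod.fst_sub, map_sub]
  ring

/-- The Euler–Lagrange equation of a function constant along the horizontal distribution. -/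
theorem eulerLagrange_of_horConst (hσ : HomNear σ u) (hE : ContDiffAt ℝ ∞ E u)
    (h : HorConst σ E u) (a : G) :
    fderiv ℝ (vder E) u (flatSpray σ u) a = fderiv ℝ E u (a, 0) := by
  have h1 : flatSpray σ u = (u.2, -conn σ u u.2) := by rw [conn_self hσ, neg_neg]; rfl
  have h2 := h.self_of_nhds a
  have h3 : (a, -conn σ u a) = (a, 0) - (0, conn σ u a) := by simp
  rw [h3, map_sub, sub_eq_zero] at h2
  rw [h1, fderiv_vder_of_horConst hσ.contDiffAt hE h, vder_conn_symm hσ.contDiffAt, vder_conn_self hσ,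
    h2, vder_apply]

/-- A two-homogeneous solution of the Euler–Lagrange equation is constant along the spray, and
therefore along the whole horizontal distribution. -/
theorem horConst_of_eulerLagrange (hσ : HomNear σ u) (hE : ∀ᶠ w in 𝓝 u, ContDiffAt ℝ ∞ E w)
    (hhom : ∀ᶠ w in 𝓝 u, vder E w w.2 = 2 * E w)
    (h : ∀ᶠ w in 𝓝 u, ∀ a, fderiv ℝ (vder E) w (flatSpray σ w) a = fderiv ℝ E w (a, 0)) :
    HorConst σ E u := by
  -- `S(E) = 0`, from the derivative of Euler's relation along `S`
  have h1 : ∀ᶠ w in 𝓝 u, fderiv ℝ E w (flatSpray σ w) = 0 := by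
    filter_upwards [hE, hhom.eventually_nhds, h] with w hE hhom h
    have e1 : fderiv ℝ (fun w => vder E w w.2) w (flatSpray σ w) =
        2 * fderiv ℝ E w (flatSpray σ w) := by
      rw [EventuallyEq.fderiv_eq hhom, fderiv_const_mul (hE.differentiableAt (by simp))]
      rfl
    have e2 : fderiv ℝ E w (flatSpray σ w) = fderiv ℝ E w (w.2, 0) + vder E w (σ w) := by
      rw [vder_apply, ← map_add]
      simp [flatSpray]
    rw [fderiv_clm_apply_apply (contDiffAt_vder hE) contDiffAt_snd, h, fderiv_snd] at e1
    have e3 : fderiv ℝ E w (w.2, 0) + vder E w (σ w) = 2 * fderiv ℝ E w (flatSpray σ w) := e1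
    linarith
  filter_upwards [hE, hσ, h1.eventually_nhds, h] with w hE hσ h1 h a
  replace hσ := hσ.1
  -- the fibre derivative of `S(E) = 0` is twice the horizontal derivative of `E`
  have e1 : vder (fun w => fderiv ℝ E w (flatSpray σ w)) w a = 0 := by
    rw [vder_congr (F' := fun _ => 0) h1, vder_apply]
    simp
  have e2 := (hasFDerivAt_of_contDiffAt (hE.fderiv_right (m := ∞) (by simp))).clm_apply
    (hasFDerivAt_of_contDiffAt (contDiffAt_flatSpray hσ))
  rw [vder_apply, e2.fderiv] at e1
  simp only [add_apply, ContinuousLinearMap.comp_apply, ContinuousLinearMap.flip_apply] at e1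
  rw [fderiv_fderiv_symm hE, ← fderiv_vder_apply hE, h, fderiv_flatSpray hσ, two_smul_conn] at e1
  have e3 : (a, -(2 : ℝ) • conn σ w a) = (2 : ℝ) • (a, -conn σ w a) - (a, 0) := by
    ext
    · simp [two_smul]
    · simp
  change fderiv ℝ E w (a, -(2 : ℝ) • conn σ w a) + _ = 0 at e1
  rw [e3, map_sub, map_smul, smul_eq_mul] at e1
  linarith

/-- A bracket of two fields annihilating a function annihilates it too. -/
theorem fderiv_lieBracket_eq_zero {V : Type*} [NormedAddCommGroup V] [NormedSpace ℝ V]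
    {E : V → ℝ} {f g : V → V} {u : V} (hE : ContDiffAt ℝ ∞ E u) (hf : ContDiffAt ℝ ∞ f u)
    (hg : ContDiffAt ℝ ∞ g u) (h1 : ∀ᶠ w in 𝓝 u, fderiv ℝ E w (f w) = 0)
    (h2 : ∀ᶠ w in 𝓝 u, fderiv ℝ E w (g w) = 0) :
    fderiv ℝ E u (lieBracket ℝ f g u) = 0 := by
  have hE' := hasFDerivAt_of_contDiffAt (hE.fderiv_right (m := ∞) (by simp))
  have e1 := (hE'.clm_apply (hasFDerivAt_of_contDiffAt hf)).fderiv
  have e2 := (hE'.clm_apply (hasFDerivAt_of_contDiffAt hg)).fderiv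
  rw [EventuallyEq.fderiv_eq (f := fun _ => (0 : ℝ)) h1, fderiv_fun_const] at e1
  rw [EventuallyEq.fderiv_eq (f := fun _ => (0 : ℝ)) h2, fderiv_fun_const] at e2
  have e1' := congrArg (fun L => L (g u)) e1
  have e2' := congrArg (fun L => L (f u)) e2
  have hs : fderiv ℝ (fderiv ℝ E) u (f u) (g u) = fderiv ℝ (fderiv ℝ E) u (g u) (f u) :=
    hE.isSymmSndFDerivAt (by simpa using two_le_infty) _ _
  simp only [Pi.zero_apply, zero_apply, add_apply, ContinuousLinearMap.comp_apply,
    ContinuousLinearMap.flip_apply] at e1' e2'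
  simp only [lieBracket, map_sub]
  linarith

end FlatMetric

/-! ### Coordinate expressions of the geometric objects of a spray -/

section

variable {v : TM n M} {U : Set (TM n M)} {X Y Z W V : VF n M} {f g h : Model n → Model n}
  {k : Model n → EuclideanSpace ℝ (Fin n)}

theorem IsRep.J (hUs : U ⊆ coordSource v) (hX : IsRep v U X f) :
    IsRep v U (J X) (vert fun u => (f u).1) := fun w hw => by
  refine ⟨?_, contDiffAt_vert (hX w hw).2.fst⟩
  rw [SprayGeometry.J, dcoord_vlift (hUs hw), dbase_dproj (hUs hw), (hX w hw).1]
  rfl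

theorem isRep_C (hUs : U ⊆ coordSource v) : IsRep v U C flatC := fun w hw => by
  refine ⟨?_, contDiffAt_flatC⟩
  rw [C, dcoord_vlift (hUs hw)]
  change _ = ((0 : EuclideanSpace ℝ (Fin n)), (coord v w).2)
  rw [coord_eq (hUs hw)]

theorem IsRep.eq_of_eq (hX : IsRep v U X f) (hY : IsRep v U Y g) {w : TM n M} (hw : w ∈ U)
    (h : X w = Y w) : f (coord v w) = g (coord v w) := by
  rw [← (hX w hw).1, ← (hY w hw).1, h]

theorem dcoord_injective {w : TM n M} (hw : w ∈ coordSource v) :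
    Function.Injective (dcoord v w) := by
  obtain ⟨e, he⟩ := isInvertible_dcoord hw
  rw [← he]
  exact e.injective

theorem IsRep.eqOn (hUs : U ⊆ coordSource v) (hX : IsRep v U X f) (hY : IsRep v U Y g)
    (h : ∀ w ∈ U, f (coord v w) = g (coord v w)) : EqOn X Y U := fun w hw =>
  dcoord_injective (hUs hw) (by rw [(hX w hw).1, (hY w hw).1, h w hw])

/-- Every smooth map is the coordinate expression of a vector field. -/
theorem exists_isRep (hUs : U ⊆ coordSource v) (hf : ∀ w ∈ U, ContDiffAt ℝ ∞ f (coord v w)) :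
    ∃ X, IsRep v U X f := by
  refine ⟨VectorField.mpullback (𝓡 n).tangent 𝓘(ℝ, Model n) (coord v) f,
    fun w hw => ⟨?_, hf w hw⟩⟩
  obtain ⟨e, he⟩ := isInvertible_dcoord (hUs hw)
  change dcoord v w ((dcoord v w).inverse (f (coord v w))) = _
  rw [← he, ContinuousLinearMap.inverse_equiv]
  exact e.apply_symm_apply _

/-- In the coordinates of `v`, on `U`, the spray `S` is `yⁱ ∂/∂xⁱ + σⁱ ∂/∂yⁱ` with `σ` homogeneous
of degree two. -/
structure IsSprayRep (S : VF n M) (v : TM n M) (U : Set (TM n M))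
    (σ : Model n → EuclideanSpace ℝ (Fin n)) : Prop where
  isOpen : IsOpen U
  subset : U ⊆ coordSource v
  rep : IsRep v U S (flatSpray σ)
  hom : ∀ w ∈ U, HomNear σ (coord v w)

theorem IsAnalyticSpray.exists_isSprayRep {S : VF n M} (hS : IsAnalyticSpray S) (hU : IsOpen U)
    (hUs : U ⊆ coordSource v) (hUslit : U ⊆ slit n M) : ∃ σ, IsSprayRep S v U σ := by
  have hreg : RegularOn ∞ S U := (ContMDiffOn.of_le hS.analytic (by simp)).mono hUslit
  obtain ⟨f, hf⟩ := hreg.exists_isRep hU hUs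
  have h1 : ∀ w ∈ U, (f (coord v w)).1 = (coord v w).2 := fun w hw =>
    congrArg Prod.snd ((hf.J hUs).eq_of_eq (isRep_C hUs) hw (hS.J_eq w (hUslit hw)))
  set σ := fun u => (f u).2 with hσ
  have h2 : IsRep v U S (flatSpray σ) := hf.congr_right hU hUs fun w hw =>
    Prod.ext (h1 w hw) rfl
  have hσ' : ∀ w ∈ U, ContDiffAt ℝ ∞ σ (coord v w) := fun w hw => (hf w hw).2.snd
  refine ⟨σ, hU, hUs, h2, fun w hw => eventually_coord (hUs hw) ?_⟩
  filter_upwards [hU.mem_nhds hw] with w hw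
  refine ⟨hσ' w hw, vder_eq_of_lieBracket_flatC (hσ' w hw) ?_⟩
  exact ((isRep_C hUs).bracket hU hUs h2).eq_of_eq h2 hw (hS.homogeneous w (hUslit hw))

theorem IsRep.vert_contDiffAt (hV : IsRep v U V (vert k)) {w : TM n M} (hw : w ∈ U) :
    ContDiffAt ℝ ∞ k (coord v w) := (hV w hw).2.snd

variable {S : VF n M} {σ : Model n → EuclideanSpace ℝ (Fin n)}

theorem IsSprayRep.smooth (hS : IsSprayRep S v U σ) {w : TM n M} (hw : w ∈ U) :
    ContDiffAt ℝ ∞ σ (coord v w) := (hS.hom w hw).contDiffAt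

theorem IsSprayRep.hor (hS : IsSprayRep S v U σ) (hX : IsRep v U X f) :
    IsRep v U (hor S X) (flatHor σ f) := by
  have h1 := (hX.add (((hX.J hS.subset).bracket hS.isOpen hS.subset hS.rep).sub
    ((hX.bracket hS.isOpen hS.subset hS.rep).J hS.subset))).smul (1 / 2)
  exact h1.congr_right hS.isOpen hS.subset fun w hw => flatHor_eq (hS.smooth hw) (hX w hw).2

theorem IsSprayRep.ver (hS : IsSprayRep S v U σ) (hX : IsRep v U X f) :
    IsRep v U (ver S X) (vert (flatVer σ f)) :=
  (hX.sub (hS.hor hX)).congr_right hS.isOpen hS.subset fun w hw => by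
    simp [vert, flatVer, flatHor, Prod.ext_iff]

theorem IsSprayRep.acs (hS : IsSprayRep S v U σ) (hX : IsRep v U X f) :
    IsRep v U (acs S X) (flatAcs σ f) :=
  ((hS.hor (hS.rep.bracket hS.isOpen hS.subset (hS.ver hX))).neg.sub
    (hX.J hS.subset)).congr_right hS.isOpen hS.subset fun w hw =>
      flatAcs_eq (hS.smooth hw) (hX w hw).2

theorem IsSprayRep.nabla (hS : IsSprayRep S v U σ) (hW : IsRep v U W f)
    (hV : IsRep v U V (vert k)) : IsRep v U (nabla S W V) (vert (flatNabla σ f k)) := by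
  have ho := hS.isOpen
  have hs := hS.subset
  have h1 := (hS.ver ((hS.hor hW).bracket ho hs hV)).add
    (((hS.ver hW).bracket ho hs hV).sub (((hS.acs hW).bracket ho hs hV).J hs))
  exact h1.congr_right ho hs fun w hw =>
    flatNabla_eq (hS.smooth hw) (hW w hw).2 (hV.vert_contDiffAt hw)

theorem IsSprayRep.berwald (hS : IsSprayRep S v U σ) (hX : IsRep v U X f) (hY : IsRep v U Y g)
    (hZ : IsRep v U Z h) : IsRep v U (berwald S X Y Z) (flatBerwald σ f g h) := by
  have ho := hS.isOpen
  have hs := hS.subset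
  have h1 := ((hS.nabla (hS.hor hX) (hS.nabla (hY.J hs) (hZ.J hs))).sub
    (hS.nabla (hY.J hs) (hS.nabla (hS.hor hX) (hZ.J hs)))).sub
      (hS.nabla ((hS.hor hX).bracket ho hs (hY.J hs)) (hZ.J hs))
  refine h1.congr_right ho hs fun w hw => ?_
  have h2 := flatBerwald_eq (hS.smooth hw) (hX w hw).2 (hY w hw).2.fst (hZ w hw).2.fst
  simp only [Pi.sub_apply, flatBerwald, vert, Prod.mk_sub_mk, sub_zero]
  exact congrArg (Prod.mk 0) h2

/-! ### Coordinate expressions of functions -/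

/-- The function `φ` is represented on `U` by the smooth function `F` in the coordinates of `v`. -/
def IsFunRep (v : TM n M) (U : Set (TM n M)) (φ : TM n M → ℝ) (F : Model n → ℝ) : Prop :=
  ∀ w ∈ U, φ w = F (coord v w) ∧ ContDiffAt ℝ ∞ F (coord v w)

variable {φ ψ : TM n M → ℝ} {F F' : Model n → ℝ}

theorem SmoothFunOn.isFunRep (hU : IsOpen U) (hUs : U ⊆ coordSource v) (hφ : SmoothFunOn φ U) :
    IsFunRep v U φ (φ ∘ coordSymm v) := fun w hw => by
  refine ⟨by rw [Function.comp_apply, coordSymm_coord (hUs hw)], ?_⟩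
  have h1 : ContMDiffAt (𝓡 n).tangent 𝓘(ℝ, ℝ) ∞ φ (coordSymm v (coord v w)) := by
    rw [coordSymm_coord (hUs hw)]
    exact (hφ w hw).contMDiffAt (hU.mem_nhds hw)
  exact (h1.comp (coord v w) (contMDiffAt_coordSymm (hUs hw))).contDiffAt

theorem IsFunRep.smoothFunOn (hU : IsOpen U) (hUs : U ⊆ coordSource v) (hφ : IsFunRep v U φ F) :
    SmoothFunOn φ U := fun w hw => by
  have h1 : ContMDiffAt (𝓡 n).tangent 𝓘(ℝ, ℝ) ∞ (F ∘ coord v) w :=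
    (hφ w hw).2.contMDiffAt.comp w (contMDiffAt_coord (hUs hw))
  refine (h1.congr_of_eventuallyEq ?_).contMDiffWithinAt
  filter_upwards [hU.mem_nhds hw] with w' hw' using (hφ w' hw').1

theorem IsFunRep.mono {U' : Set (TM n M)} (h : U' ⊆ U) (hφ : IsFunRep v U φ F) :
    IsFunRep v U' φ F := fun w hw => hφ w (h hw)

theorem IsFunRep.eventually (hU : IsOpen U) (hUs : U ⊆ coordSource v) (hφ : IsFunRep v U φ F)
    {w : TM n M} (hw : w ∈ U) : ∀ᶠ u in 𝓝 (coord v w), ContDiffAt ℝ ∞ F u :=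
  eventually_coord (hUs hw) (by filter_upwards [hU.mem_nhds hw] with w' hw' using (hφ w' hw').2)

theorem IsFunRep.lieD (hU : IsOpen U) (hUs : U ⊆ coordSource v) (hφ : IsFunRep v U φ F)
    (hX : IsRep v U X f) : IsFunRep v U (lieD X φ) (fun u => fderiv ℝ F u (f u)) := fun w hw => by
  refine ⟨?_, ((hφ w hw).2.fderiv_right (m := ∞) (by simp)).clm_apply (hX w hw).2⟩
  rw [lieD_eq (hUs hw) (g := F) ?_ ((hφ w hw).2.differentiableAt (by simp)), (hX w hw).1]
  filter_upwards [hU.mem_nhds hw] with w' hw' using (hφ w' hw').1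

theorem coord_fibre {w : TM n M} (hw : w ∈ coordSource v) (y : TangentSpace (𝓡 n) w.1) :
    coord v ⟨w.1, y⟩ = ((coord v w).1, dbase v w.1 y) := by
  rw [coord_eq (w := ⟨w.1, y⟩) (mem_coordSource_iff.2 (mem_coordSource_iff.1 hw)), coord_eq hw]

theorem coord_snd {w : TM n M} (hw : w ∈ coordSource v) :
    (coord v w).2 = dbase v w.1 w.2 := by rw [coord_eq hw]

/-- The map `y ↦ (x, y)` parametrizing the fibre through `w` is continuous. -/
theorem tendsto_fibre {w : TM n M} (hw : w ∈ coordSource v) {c : ℝ → TangentSpace (𝓡 n) w.1}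
    {t : ℝ} (hc : ContinuousAt (fun t => dbase v w.1 (c t)) t) :
    Tendsto (fun t => (⟨w.1, c t⟩ : TM n M)) (𝓝 t) (𝓝 ⟨w.1, c t⟩) := by
  have hmem : ∀ y : TangentSpace (𝓡 n) w.1, (⟨w.1, y⟩ : TM n M) ∈ coordSource v := fun y =>
    mem_coordSource_iff.2 (mem_coordSource_iff.1 hw)
  have h1 : (fun t => (⟨w.1, c t⟩ : TM n M)) =
      fun t => coordSymm v ((coord v w).1, dbase v w.1 (c t)) := by
    funext t
    rw [← coord_fibre hw, coordSymm_coord (hmem _)]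
  have h2 := tendsto_coordSymm (hmem (c t))
  rw [h1, coord_fibre hw] at *
  exact h2.comp ((continuousAt_const.prodMk hc).tendsto)

/-- The fundamental tensor in coordinates. -/
theorem IsFunRep.fund_eq (hU : IsOpen U) (hUs : U ⊆ coordSource v) (hφ : IsFunRep v U φ F)
    {w : TM n M} (hw : w ∈ U) (a b : TangentSpace (𝓡 n) w.1) :
    fund φ w a b = vder (vder F) (coord v w) (dbase v w.1 a) (dbase v w.1 b) := by
  set x := (coord v w).1
  set y := (coord v w).2
  set a' := dbase v w.1 a
  set b' := dbase v w.1 b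
  have hcoord : ∀ s t : ℝ, coord v ⟨w.1, w.2 + s • a + t • b⟩ = (x, y + s • a' + t • b') := by
    intro s t
    rw [coord_fibre (hUs hw), map_add, map_add, map_smul, map_smul, ← coord_snd (hUs hw)]
  have hev : ∀ᶠ u in 𝓝 (x, y), ∀ w' ∈ coordSource v, coord v w' = u →
      φ w' = F u ∧ ContDiffAt ℝ ∞ F u := by
    refine eventually_coord (hUs hw) ?_
    filter_upwards [hU.mem_nhds hw] with w' hw' w'' hw'' he
    have : w'' = w' := by
      rw [← coordSymm_coord hw'', he, coordSymm_coord (hUs hw')]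
    rw [this]
    exact hφ w' hw'
  have hline : ∀ (p : Model n) (c : EuclideanSpace ℝ (Fin n)),
      HasDerivAt (fun t : ℝ => ((p.1, p.2 + t • c) : Model n)) (0, c) 0 := by
    intro p c
    have := (hasDerivAt_const (0 : ℝ) p.1).prodMk
      (((hasDerivAt_id (0 : ℝ)).smul_const c).const_add p.2)
    simpa using this
  have hz : ∀ (p : Model n) (c : EuclideanSpace ℝ (Fin n)), (p.1, p.2 + (0 : ℝ) • c) = p := by
    intro p c; simp
  have hwc := hUs hw
  have hmem : ∀ z : TangentSpace (𝓡 n) w.1, (⟨w.1, z⟩ : TM n M) ∈ coordSource v := fun z =>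
    mem_coordSource_iff.2 (mem_coordSource_iff.1 hwc)
  have hinner : ∀ᶠ s : ℝ in 𝓝 0, deriv (fun t : ℝ => φ ⟨w.1, w.2 + s • a + t • b⟩) 0 =
      vder F (x, y + s • a') b' := by
    have h1 := (hline (x, y) a').continuousAt.tendsto
    rw [hz] at h1
    filter_upwards [h1.eventually hev.eventually_nhds] with s hs
    have h2 := (hline (x, y + s • a') b').continuousAt.tendsto
    rw [hz] at h2
    have h3 : (fun t : ℝ => φ ⟨w.1, w.2 + s • a + t • b⟩) =ᶠ[𝓝 0]
        fun t => F (x, y + s • a' + t • b') := by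
      filter_upwards [h2.eventually hs] with t ht
      exact (ht _ (hmem _) (hcoord s t)).1
    rw [h3.deriv_eq]
    have h4 : HasFDerivAt F (fderiv ℝ F (x, y + s • a')) (x, y + s • a') :=
      hasFDerivAt_of_contDiffAt (hs.self_of_nhds ⟨w.1, w.2 + s • a + (0 : ℝ) • b⟩ (hmem _)
        (by rw [hcoord, zero_smul, add_zero])).2
    exact (h4.comp_hasDerivAt_of_eq (0 : ℝ) (hline (x, y + s • a') b') (hz _ _).symm).deriv
  rw [fund, EventuallyEq.deriv_eq hinner]
  have h5 := contDiffAt_vder (hφ w hw).2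
  have h6 : HasFDerivAt (fun u => vder F u b') (fderiv ℝ (fun u => vder F u b') (x, y))
      (x, y) := hasFDerivAt_of_contDiffAt (h5.clm_apply contDiffAt_const)
  refine (h6.comp_hasDerivAt_of_eq (0 : ℝ) (hline (x, y) a') (hz _ _).symm).deriv.trans ?_
  rw [fderiv_clm_apply_apply h5 contDiffAt_const, fderiv_fun_const, Pi.zero_apply, zero_apply,
    map_zero, add_zero]
  rfl

end

/-! ### The metrizability operators in coordinates -/

section

variable {v : TM n M} {U : Set (TM n M)} {X Y Z : VF n M} {f g h : Model n → Model n}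
  {S : VF n M} {σ : Model n → EuclideanSpace ℝ (Fin n)} {E : TM n M → ℝ} {F : Model n → ℝ}

theorem Pe_eq (hS : IsSprayRep S v U σ) (hE : IsFunRep v U E F) (hX : IsRep v U X f)
    {w : TM n M} (hw : w ∈ U) :
    Pe S E X w = fderiv ℝ (vder F) (coord v w) (flatSpray σ (coord v w)) (f (coord v w)).1 -
      fderiv ℝ F (coord v w) ((f (coord v w)).1, 0) := by
  have ho := hS.isOpen
  have hs := hS.subset
  rw [← flat_eulerLagrange_eq (hE w hw).2 (hS.smooth hw) (hX w hw).2]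
  have h1 := ((hE.lieD ho hs (hX.J hs)).lieD ho hs hS.rep w hw).1
  have h2 := ((hE.lieD ho hs (hS.rep.J hs)).lieD ho hs hX w hw).1
  have h3 := (hE.lieD ho hs ((hS.rep.bracket ho hs hX).J hs) w hw).1
  have h4 := ((hE.lieD ho hs (isRep_C hs)).lieD ho hs hX w hw).1
  have h5 := (hE.lieD ho hs hX w hw).1
  -- `d_J E (S) = C(E)`, because `J S = C`
  have h6 : lieD X (dJ E S) w = lieD X (lieD C E) w := h2.trans h4.symm
  simp only [Pe, Omega]
  rw [h6, h5]
  have h1' : lieD S (dJ E X) w = _ := h1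
  have h3' : dJ E (bracket S X) w = _ := h3
  rw [h1', h3']
  simp only [vder_apply, vert]
  ring

theorem IsFunRep.gJ (hU : IsOpen U) (hUs : U ⊆ coordSource v) (hE : IsFunRep v U E F)
    (hY : IsRep v U Y g) (hZ : IsRep v U Z h) :
    IsFunRep v U (gJ E Y Z) (fun u => vder (vder F) u (g u).1 (h u).1) := fun w hw => by
  refine ⟨?_, ((contDiffAt_vder (contDiffAt_vder (hE w hw).2)).clm_apply
    (hY w hw).2.fst).clm_apply (hZ w hw).2.fst⟩
  rw [SprayGeometry.gJ, hE.fund_eq hU hUs hw, dbase_dproj (hUs hw), dbase_dproj (hUs hw),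
    (hY w hw).1, (hZ w hw).1]

theorem Pg_eq (hS : IsSprayRep S v U σ) (hE : IsFunRep v U E F) (hX : IsRep v U X f)
    (hY : IsRep v U Y g) (hZ : IsRep v U Z h) {w : TM n M} (hw : w ∈ U)
    (hconst : HorConst σ F (coord v w)) :
    Pg S E X Y Z w = vder F (coord v w) (vder (vder (conn σ)) (coord v w) (g (coord v w)).1
      (h (coord v w)).1 (f (coord v w)).1) := by
  have ho := hS.isOpen
  have hs := hS.subset
  rw [← landsberg_eq_of_horConst (hS.hom w hw) (hE.eventually ho hs hw) hconst,
    ← flat_covariant_eq (hE w hw).2 (hY w hw).2.fst (hZ w hw).2.fst]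
  have hacs : ∀ {V : VF n M} {k : Model n → EuclideanSpace ℝ (Fin n)}, IsRep v U V (vert k) →
      IsRep v U (acs S V) (flatAcs σ (vert k)) ∧ ∀ u, (flatAcs σ (vert k) u).1 = k u :=
    fun hV => ⟨hS.acs hV, fun u => by simp [flatAcs, flatVer, vert]⟩
  obtain ⟨h1, h1'⟩ := hacs (hS.nabla (hS.hor hX) (hY.J hs))
  obtain ⟨h2, h2'⟩ := hacs (hS.nabla (hS.hor hX) (hZ.J hs))
  have e1 := ((hE.gJ ho hs hY hZ).lieD ho hs (hS.hor hX) w hw).1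
  have e2 := (hE.gJ ho hs h1 hZ w hw).1
  have e3 := (hE.gJ ho hs hY h2 w hw).1
  simp only [h1'] at e2
  simp only [h2'] at e3
  rw [Pg, e1, e2, e3]

end

/-! ### The generated fields -/

section

variable {v : TM n M} {U U' : Set (TM n M)} {X Y : VF n M} {f g : Model n → Model n}
  {S : VF n M} {σ : Model n → EuclideanSpace ℝ (Fin n)} {E : TM n M → ℝ} {F : Model n → ℝ}

theorem Generated.mono (h : U' ⊆ U) (hX : Generated S U X) : Generated S U' X := by
  induction hX with
  | horizontal X hX => exact .horizontal X (ContMDiffOn.mono hX h)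
  | curvature X Y Z hX hY hZ =>
    exact .curvature X Y Z (ContMDiffOn.mono hX h) (ContMDiffOn.mono hY h) (ContMDiffOn.mono hZ h)
  | lie X Y _ _ hX hY => exact .lie X Y hX hY

theorem Generated.mem_distL (hU : IsOpen U) (hUslit : U ⊆ slit n M) (hX : Generated S U X)
    {w : TM n M} (hw : w ∈ U) : X w ∈ distL S w :=
  Submodule.subset_span ⟨U, X, hU, hw, hUslit, hX, rfl⟩

theorem Generated.exists_isRep (hS : IsSprayRep S v U σ) (hX : Generated S U X) :
    ∃ f, IsRep v U X f := by
  induction hX with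
  | horizontal X hX =>
    obtain ⟨f, hf⟩ := hX.exists_isRep hS.isOpen hS.subset
    exact ⟨_, hS.hor hf⟩
  | curvature X Y Z hX hY hZ =>
    obtain ⟨f, hf⟩ := hX.exists_isRep hS.isOpen hS.subset
    obtain ⟨g, hg⟩ := hY.exists_isRep hS.isOpen hS.subset
    obtain ⟨h, hh⟩ := hZ.exists_isRep hS.isOpen hS.subset
    exact ⟨_, hS.berwald hf hg hh⟩
  | lie X Y _ _ hX hY =>
    obtain ⟨f, hf⟩ := hX
    obtain ⟨g, hg⟩ := hY
    exact ⟨_, hf.bracket hS.isOpen hS.subset hg⟩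

/-- The constant-coefficient combinations of the generated fields on `U`. -/
def genSpan (S : VF n M) (U : Set (TM n M)) : Submodule ℝ (VF n M) :=
  Submodule.span ℝ {X | Generated S U X}

theorem exists_isRep_of_mem_genSpan (hS : IsSprayRep S v U σ) (hX : X ∈ genSpan S U) :
    ∃ f, IsRep v U X f := by
  induction hX using Submodule.span_induction with
  | mem X hX => exact Generated.exists_isRep hS hX
  | zero => exact ⟨0, fun w _ => ⟨map_zero _, contDiffAt_const⟩⟩
  | add X Y _ _ hX hY =>
    obtain ⟨f, hf⟩ := hX
    obtain ⟨g, hg⟩ := hY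
    exact ⟨_, hf.add hg⟩
  | smul c X _ hX =>
    obtain ⟨f, hf⟩ := hX
    exact ⟨_, hf.smul c⟩

theorem mem_distL_of_mem_genSpan (hU : IsOpen U) (hUslit : U ⊆ slit n M) (hX : X ∈ genSpan S U)
    {w : TM n M} (hw : w ∈ U) : X w ∈ distL S w := by
  induction hX using Submodule.span_induction with
  | mem X hX => exact Generated.mem_distL hU hUslit hX hw
  | zero => exact Submodule.zero_mem _
  | add X Y _ _ hX hY => exact Submodule.add_mem _ hX hY
  | smul c X _ hX => exact Submodule.smul_mem _ c hX

theorem exists_genSpan_bracket (hS : IsSprayRep S v U σ) (hX : X ∈ genSpan S U)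
    (hY : Generated S U Y) : ∃ B ∈ genSpan S U, EqOn (bracket X Y) B U := by
  have ho := hS.isOpen
  have hs := hS.subset
  obtain ⟨g, hg⟩ := hY.exists_isRep hS
  induction hX using Submodule.span_induction with
  | mem X hX => exact ⟨_, Submodule.subset_span (.lie X Y hX hY), fun _ _ => rfl⟩
  | zero =>
    refine ⟨0, Submodule.zero_mem _, fun w _ => ?_⟩
    rw [bracket, VectorField.mlieBracket_zero_left]
  | add X X' hXm hXm' hX hX' =>
    obtain ⟨B, hB, hB'⟩ := hX
    obtain ⟨D, hD, hD'⟩ := hX'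
    obtain ⟨f, hf⟩ := exists_isRep_of_mem_genSpan hS hXm
    obtain ⟨f', hf'⟩ := exists_isRep_of_mem_genSpan hS hXm'
    refine ⟨_, Submodule.add_mem _ hB hD, ?_⟩
    refine ((hf.add hf').bracket ho hs hg).eqOn hs
      (((hf.bracket ho hs hg).congr_left hB').add ((hf'.bracket ho hs hg).congr_left hD')) ?_
    intro w hw
    exact VectorField.lieBracket_add_left ((hf w hw).2.differentiableAt (by simp))
      ((hf' w hw).2.differentiableAt (by simp))
  | smul c X hXm hX =>
    obtain ⟨B, hB, hB'⟩ := hX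
    obtain ⟨f, hf⟩ := exists_isRep_of_mem_genSpan hS hXm
    refine ⟨_, Submodule.smul_mem _ c hB, ?_⟩
    refine ((hf.smul c).bracket ho hs hg).eqOn hs
      (((hf.bracket ho hs hg).congr_left hB').smul c) ?_
    intro w hw
    exact VectorField.lieBracket_const_smul_left ((hf w hw).2.differentiableAt (by simp))

/-- Bracketing with `C` preserves the combinations of generated fields: `C` commutes with the
horizontal projector, the Berwald curvature is homogeneous, and the Jacobi identity propagates
this to iterated brackets. -/
theorem Generated.exists_bracket_C (hS : IsSprayRep S v U σ) (hX : Generated S U X) :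
    ∃ B ∈ genSpan S U, EqOn (bracket C X) B U := by
  have ho := hS.isOpen
  have hs := hS.subset
  have hC : IsRep v U C flatC := isRep_C hs
  induction hX with
  | horizontal X hX =>
    obtain ⟨f, hf⟩ := hX.exists_isRep ho hs
    have h1 := hC.bracket ho hs hf
    exact ⟨_, Submodule.subset_span (.horizontal _ (h1.regularOn ho hs)),
      (hC.bracket ho hs (hS.hor hf)).eqOn hs (hS.hor h1) fun w hw =>
        lieBracket_flatC_flatHor (hS.hom w hw) (hf w hw).2⟩
  | curvature X Y Z hX hY hZ =>
    obtain ⟨f, hf⟩ := hX.exists_isRep ho hs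
    obtain ⟨g, hg⟩ := hY.exists_isRep ho hs
    obtain ⟨h, hh⟩ := hZ.exists_isRep ho hs
    have h1 := hC.bracket ho hs hf
    have h2 := hC.bracket ho hs hg
    have h3 := hC.bracket ho hs hh
    refine ⟨berwald S (bracket C X) Y Z + berwald S X (bracket C Y) Z +
      berwald S X Y (bracket C Z) - (2 : ℝ) • berwald S X Y Z, ?_, ?_⟩
    · exact Submodule.sub_mem _ (Submodule.add_mem _ (Submodule.add_mem _
        (Submodule.subset_span (.curvature _ _ _ (h1.regularOn ho hs) hY hZ))
        (Submodule.subset_span (.curvature _ _ _ hX (h2.regularOn ho hs) hZ)))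
        (Submodule.subset_span (.curvature _ _ _ hX hY (h3.regularOn ho hs))))
        (Submodule.smul_mem _ _ (Submodule.subset_span (.curvature _ _ _ hX hY hZ)))
    · exact (hC.bracket ho hs (hS.berwald hf hg hh)).eqOn hs
        ((((hS.berwald h1 hg hh).add (hS.berwald hf h2 hh)).add (hS.berwald hf hg h3)).sub
          ((hS.berwald hf hg hh).smul 2)) fun w hw =>
        lieBracket_flatC_flatBerwald (hS.hom w hw) (hf w hw).2 (hg w hw).2 (hh w hw).2
  | lie X Y hXg hYg hX hY =>
    obtain ⟨A, hA, hA'⟩ := hX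
    obtain ⟨B, hB, hB'⟩ := hY
    obtain ⟨f, hf⟩ := hXg.exists_isRep hS
    obtain ⟨g, hg⟩ := hYg.exists_isRep hS
    obtain ⟨D, hD, hD'⟩ := exists_genSpan_bracket hS hA hYg
    obtain ⟨D', hDm, hDe⟩ := exists_genSpan_bracket hS hB hXg
    refine ⟨D - D', Submodule.sub_mem _ hD hDm, ?_⟩
    have e1 : IsRep v U D (VectorField.lieBracket ℝ (VectorField.lieBracket ℝ flatC f) g) :=
      (((hC.bracket ho hs hf).congr_left hA').bracket ho hs hg).congr_left hD'
    have e2 : IsRep v U D' (VectorField.lieBracket ℝ (VectorField.lieBracket ℝ flatC g) f) :=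
      (((hC.bracket ho hs hg).congr_left hB').bracket ho hs hf).congr_left hDe
    refine (hC.bracket ho hs (hf.bracket ho hs hg)).eqOn hs (e1.sub e2) fun w hw => ?_
    rw [VectorField.leibniz_identity_lieBracket (n := 2) (by simp)
      (contDiffAt_flatC.of_le two_le_infty) ((hf w hw).2.of_le two_le_infty)
      ((hg w hw).2.of_le two_le_infty), VectorField.lieBracket_swap (V := f)]
    simp [sub_eq_add_neg]

/-- A function constant along the horizontal distribution and annihilated by the image of the
curvature is annihilated by all generated fields. -/
theorem Generated.lieD_eq_zero (hS : IsSprayRep S v U σ) (hE : IsFunRep v U E F)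
    (h1 : ∀ w ∈ U, ∀ a, fderiv ℝ F (coord v w) (a, -conn σ (coord v w) a) = 0)
    (h2 : ∀ w ∈ U, ∀ a b c, vder F (coord v w) (vder (vder (conn σ)) (coord v w) a b c) = 0)
    (hX : Generated S U X) : ∀ w ∈ U, lieD X E w = 0 := by
  have ho := hS.isOpen
  have hs := hS.subset
  induction hX with
  | horizontal X hX =>
    obtain ⟨f, hf⟩ := hX.exists_isRep ho hs
    intro w hw
    rw [(hE.lieD ho hs (hS.hor hf) w hw).1]
    exact h1 w hw _
  | curvature X Y Z hX hY hZ =>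
    obtain ⟨f, hf⟩ := hX.exists_isRep ho hs
    obtain ⟨g, hg⟩ := hY.exists_isRep ho hs
    obtain ⟨h, hh⟩ := hZ.exists_isRep ho hs
    intro w hw
    rw [(hE.lieD ho hs (hS.berwald hf hg hh) w hw).1]
    change vder F (coord v w) (-_) = 0
    rw [map_neg, h2 w hw, neg_zero]
  | lie X Y hXg hYg hX hY =>
    obtain ⟨f, hf⟩ := hXg.exists_isRep hS
    obtain ⟨g, hg⟩ := hYg.exists_isRep hS
    have hev : ∀ {X : VF n M} {f : Model n → Model n}, IsRep v U X f →
        (∀ w ∈ U, lieD X E w = 0) → ∀ w ∈ U, ∀ᶠ u in 𝓝 (coord v w), fderiv ℝ F u (f u) = 0 := by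
      intro X f hf hX w hw
      refine eventually_coord (hs hw) ?_
      filter_upwards [ho.mem_nhds hw] with w' hw'
      exact (hE.lieD ho hs hf w' hw').1.symm.trans (hX w' hw')
    intro w hw
    rw [(hE.lieD ho hs (hf.bracket ho hs hg) w hw).1]
    exact fderiv_lieBracket_eq_zero (hE w hw).2 (hf w hw).2 (hg w hw).2 (hev hf hX w hw)
      (hev hg hY w hw)

end

/-! ### Necessity of the conditions -/

section

variable {v : TM n M} {U U' : Set (TM n M)} {S : VF n M}
  {σ : Model n → EuclideanSpace ℝ (Fin n)} {E : TM n M → ℝ} {F : Model n → ℝ}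

theorem IsSprayRep.mono (hS : IsSprayRep S v U σ) (hU' : IsOpen U') (h : U' ⊆ U) :
    IsSprayRep S v U' σ :=
  ⟨hU', h.trans hS.subset, hS.rep.mono h, fun w hw => hS.hom w (h hw)⟩

/-- Euler's relation for the energy of a Finsler metric. -/
theorem IsFinslerOn.vder_energy {F₀ : TM n M → ℝ} {U₀ : Set (TM n M)} (hF : IsFinslerOn F₀ U₀)
    (hU : IsOpen U) (hUs : U ⊆ coordSource v) (hU₀ : U ⊆ U₀) (hE : IsFunRep v U (energy F₀) F)
    {w : TM n M} (hw : w ∈ U) :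
    vder F (coord v w) (coord v w).2 = 2 * F (coord v w) := by
  set x := (coord v w).1
  set y := (coord v w).2
  have hwc := hUs hw
  have hcoord : ∀ c : ℝ, coord v ⟨w.1, c • w.2⟩ = (x, c • y) := fun c => by
    rw [coord_fibre hwc, map_smul, ← coord_snd hwc]
  have h1 : Tendsto (fun c : ℝ => (⟨w.1, c • w.2⟩ : TM n M)) (𝓝 1) (𝓝 w) := by
    have := tendsto_fibre (t := (1 : ℝ)) (c := fun c : ℝ => c • w.2) hwc (by
      simp only [map_smul]
      fun_prop)
    rwa [one_smul] at this
  have h2 : ∀ᶠ c : ℝ in 𝓝 1, F (x, c • y) = c ^ 2 * F (x, y) := by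
    filter_upwards [h1.eventually (hU.mem_nhds hw), lt_mem_nhds one_pos] with c hc hc0
    rw [← hcoord, ← (hE _ hc).1]
    change _ = _ * F (coord v w)
    rw [← (hE w hw).1]
    simp only [energy]
    rw [hF.homogeneous w (hU₀ hw) c hc0 (hU₀ hc)]
    ring
  have h3 : HasDerivAt (fun c : ℝ => ((x, c • y) : Model n)) (0, y) 1 := by
    simpa using (hasDerivAt_const (1 : ℝ) x).prodMk ((hasDerivAt_id (1 : ℝ)).smul_const y)
  have h4 : HasDerivAt (fun c : ℝ => F (x, c • y)) (fderiv ℝ F (x, y) (0, y)) 1 :=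
    (hasFDerivAt_of_contDiffAt (hE w hw).2).comp_hasDerivAt_of_eq (1 : ℝ) h3 (by
      rw [one_smul])
  have h5 : HasDerivAt (fun c : ℝ => c ^ 2 * F (x, y)) (2 * F (x, y)) 1 := by
    simpa using (hasDerivAt_pow 2 (1 : ℝ)).mul_const (F (x, y))
  exact h4.unique (h5.congr_of_eventuallyEq h2)

theorem sameJet_zero_of_forall_eq_zero (k : ℕ) {φ : TM n M → ℝ} (hU : IsOpen U) (hv : v ∈ U)
    (h : ∀ w ∈ U, φ w = 0) : SameJet k v φ 0 := by
  intro i _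
  refine Filter.EventuallyEq.eq_of_nhds (Filter.EventuallyEq.iteratedFDeriv ℝ ?_ i)
  have h1 := tendsto_coordSymm (mem_coordSource v)
  filter_upwards [h1.eventually (hU.mem_nhds hv)] with u hu
  exact h _ hu

/-- The energy of a metric of Landsberg type solves the reduced system, so that its own `2`-jet at
`v` is the required initial condition. -/
theorem LandsbergMetrizableNear.necessary (hS : IsAnalyticSpray S)
    (h : LandsbergMetrizableNear S v) :
    C v ∉ distL S v ∧ ∃ p ∈ prolongedKernel S v, PosDefJet v p := by
  obtain ⟨U₀, hU₀, hvU₀, hslit, F₀, hF, hgeo, hland⟩ := h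
  set U := U₀ ∩ coordSource v
  have hU : IsOpen U := hU₀.inter (isOpen_coordSource v)
  have hvU : v ∈ U := ⟨hvU₀, mem_coordSource v⟩
  have hUU₀ : U ⊆ U₀ := inter_subset_left
  have hUs : U ⊆ coordSource v := inter_subset_right
  obtain ⟨σ, hσ⟩ := hS.exists_isSprayRep hU hUs (hUU₀.trans hslit)
  set E := energy F₀
  obtain ⟨F, hE⟩ : ∃ F, IsFunRep v U E F := by
    have h1 := SmoothFunOn.isFunRep hU hUs (ContMDiffOn.mono hF.smooth hUU₀)
    exact ⟨fun u => 1 / 2 * (F₀ ∘ coordSymm v) u ^ 2, fun w hw =>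
      ⟨congrArg (fun t => 1 / 2 * t ^ 2) (h1 w hw).1, contDiffAt_const.mul ((h1 w hw).2.pow 2)⟩⟩
  have hEpos : 0 < E v := by
    have := hF.pos v hvU₀
    simp only [E, energy]
    positivity
  have hEuler : ∀ w ∈ U, vder F (coord v w) (coord v w).2 = 2 * F (coord v w) := fun w hw =>
    hF.vder_energy hU hUs hUU₀ hE hw
  have hconst : ∀ a : EuclideanSpace ℝ (Fin n),
      ∃ X, IsRep v U X fun _ => ((a, 0) : Model n) := fun a =>
    exists_isRep hUs fun _ _ => contDiffAt_const
  have hEL : ∀ w ∈ U, ∀ a, fderiv ℝ (vder F) (coord v w) (flatSpray σ (coord v w)) a =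
      fderiv ℝ F (coord v w) (a, 0) := by
    intro w hw a
    obtain ⟨X, hX⟩ := hconst a
    have h1 := hgeo U hUU₀ hU X (hX.regularOn hU hUs) w hw
    rw [Pe_eq hσ hE hX hw] at h1
    exact sub_eq_zero.1 h1
  have hhor : ∀ w ∈ U, HorConst σ F (coord v w) := by
    intro w hw
    refine horConst_of_eulerLagrange (hσ.hom w hw) (hE.eventually hU hUs hw)
      (eventually_coord (hUs hw) ?_) (eventually_coord (hUs hw) ?_)
    · filter_upwards [hU.mem_nhds hw] with w hw using hEuler w hw
    · filter_upwards [hU.mem_nhds hw] with w hw using hEL w hw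
  have hcurv : ∀ w ∈ U, ∀ a b c,
      vder F (coord v w) (vder (vder (conn σ)) (coord v w) a b c) = 0 := by
    intro w hw a b c
    obtain ⟨X, hX⟩ := hconst c
    obtain ⟨Y, hY⟩ := hconst a
    obtain ⟨Z, hZ⟩ := hconst b
    have h1 := hland U hUU₀ hU X Y Z (hX.regularOn hU hUs) (hY.regularOn hU hUs)
      (hZ.regularOn hU hUs) w hw
    rwa [Pg_eq hσ hE hX hY hZ hw (hhor w hw)] at h1
  have hgen : ∀ w ∈ U, ∀ ξ ∈ distL S w,
      (mfderiv (𝓡 n).tangent 𝓘(ℝ, ℝ) E w ξ : ℝ) = 0 := by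
    intro w hw ξ hξ
    induction hξ using Submodule.span_induction with
    | mem ξ hξ =>
      obtain ⟨U', X, hU', hw', -, hX, rfl⟩ := hξ
      have hsub : U' ∩ U ⊆ U := inter_subset_right
      exact Generated.lieD_eq_zero (hσ.mono (hU'.inter hU) hsub) (hE.mono hsub)
        (fun w hw => (hhor w (hsub hw)).self_of_nhds) (fun w hw => hcurv w (hsub hw))
        (hX.mono inter_subset_left) w ⟨hw', hw⟩
    | zero => exact map_zero _
    | add ξ η _ _ hξ hη => exact (map_add _ ξ η).trans (by rw [hξ, hη]; exact add_zero (0 : ℝ))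
    | smul c ξ _ hξ => exact (map_smul _ c ξ).trans (by rw [hξ]; exact mul_zero c)
  have hCE : ∀ w ∈ U, lieD C E w = 2 * E w := by
    intro w hw
    rw [(hE.lieD hU hUs (isRep_C hUs) w hw).1, (hE w hw).1]
    exact hEuler w hw
  refine ⟨fun hC => ?_, ?_⟩
  · have h1 : lieD C E v = 0 := hgen v hvU _ hC
    rw [hCE v hvU] at h1
    linarith
  · set φ : LocalFun v := ⟨E, U, hU, hvU, hE.smoothFunOn hU hUs⟩
    refine ⟨jet 2 v φ, ⟨φ, rfl, ?_, ?_⟩, φ, rfl, hF.convex v hvU₀⟩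
    · refine sameJet_zero_of_forall_eq_zero 1 hU hvU fun w hw => ?_
      simp only [Pc]
      rw [hCE w hw, sub_self]
    · intro U' X hU' hv' _ hX
      exact sameJet_zero_of_forall_eq_zero 1 (hU'.inter hU) ⟨hv', hvU⟩ fun w hw =>
        hgen w hw.2 _ (hX.2 w hw.1)

end

/-! ### Solving the reduced system in a local frame -/

section

open VectorField

/-- The reduced system in a frame `f` of the distribution: a `2`-jet annihilated by the first
prolongation extends to a solution. -/
theorem exists_solution_of_frame {V : Type} [NormedAddCommGroup V] [NormedSpace ℝ V]
    [FiniteDimensional ℝ V] {r : ℕ} (c₀ : V → V) (f : Fin r → V → V) (p : V)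
    (hc₀ : ∀ᶠ q in 𝓝 p, ContDiffAt ℝ ∞ c₀ q) (hf : ∀ᶠ q in 𝓝 p, ∀ i, ContDiffAt ℝ ∞ (f i) q)
    (hli : LinearIndependent ℝ fun i => f i p) (hC : c₀ p ∉ Submodule.span ℝ (range fun i => f i p))
    (hbC : ∀ᶠ q in 𝓝 p, ∀ i, lieBracket ℝ c₀ (f i) q ∈ Submodule.span ℝ (range fun i => f i q))
    (hb : ∀ᶠ q in 𝓝 p, ∀ i j,
      lieBracket ℝ (f i) (f j) q ∈ Submodule.span ℝ (range fun i => f i q))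
    (φ : V → ℝ) (hφ : ∀ᶠ q in 𝓝 p, ContDiffAt ℝ ∞ φ q)
    (h0C : fderiv ℝ φ p (c₀ p) = 2 * φ p) (h0 : ∀ i, fderiv ℝ φ p (f i p) = 0)
    (h1C : fderiv ℝ (fun q => fderiv ℝ φ q (c₀ q) - 2 * φ q) p = 0)
    (h1 : ∀ i, fderiv ℝ (fun q => fderiv ℝ φ q (f i q)) p = 0) :
    ∃ E : V → ℝ, (∀ᶠ q in 𝓝 p, ContDiffAt ℝ ∞ E q) ∧
      (∀ᶠ q in 𝓝 p, fderiv ℝ E q (c₀ q) = 2 * E q ∧ ∀ i, fderiv ℝ E q (f i q) = 0) ∧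
      fderiv ℝ (fderiv ℝ E) p = fderiv ℝ (fderiv ℝ φ) p := by
  set Z : V → (ℝ × (Fin r → ℝ)) →L[ℝ] V := fun q =>
    (ContinuousLinearMap.fst ℝ ℝ (Fin r → ℝ)).smulRight (c₀ q) +
      ∑ i, ((ContinuousLinearMap.proj i).comp
        (ContinuousLinearMap.snd ℝ ℝ (Fin r → ℝ))).smulRight (f i q) with hZdef
  have hZ : ∀ q e, Z q e = e.1 • c₀ q + ∑ i, e.2 i • f i q := by
    intro q e
    simp [hZdef]
  have hZ1 : ∀ q, Z q (1, 0) = c₀ q := fun q => by simp [hZ]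
  have hZ2 : ∀ q i, Z q (0, Pi.single i 1) = f i q := fun q i => by
    simp [hZ, Pi.single_apply]
  set ℓ : (ℝ × (Fin r → ℝ)) →L[ℝ] ℝ := (2 : ℝ) • ContinuousLinearMap.fst ℝ ℝ (Fin r → ℝ) with hℓ
  have hℓ1 : ∀ e, ℓ e = 2 * e.1 := fun e => rfl
  have hdecomp : ∀ e : ℝ × (Fin r → ℝ),
      e = e.1 • (1, 0) + ∑ i, e.2 i • ((0 : ℝ), (Pi.single i 1 : Fin r → ℝ)) := by
    intro e
    ext j
    · simp [Prod.fst_sum]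
    · simp [Prod.snd_sum, Finset.sum_apply, Pi.single_apply]
  have hZs : ∀ᶠ q in 𝓝 p, ContDiffAt ℝ ∞ Z q := by
    filter_upwards [hc₀, hf] with q h1 h2
    exact (contDiffAt_const.smulRight h1).add
      (ContDiffAt.sum fun i _ => contDiffAt_const.smulRight (h2 i))
  have hZp : Function.Injective (Z p) := by
    rw [injective_iff_map_eq_zero]
    intro e he
    rw [hZ] at he
    have hsum : ∑ i, e.2 i • f i p ∈ Submodule.span ℝ (range fun i => f i p) :=
      Submodule.sum_mem _ fun i _ => Submodule.smul_mem _ _ (Submodule.subset_span ⟨i, rfl⟩)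
    have he1 : e.1 = 0 := by
      by_contra hne
      refine hC ((Submodule.smul_mem_iff _ hne).1 ?_)
      rw [eq_neg_of_add_eq_zero_left he]
      exact Submodule.neg_mem _ hsum
    rw [he1, zero_smul, zero_add] at he
    ext i
    · exact he1
    · exact Fintype.linearIndependent_iff.1 hli e.2 he i
  have hspan : ∀ q, ∀ ξ ∈ Submodule.span ℝ (range fun i => f i q), ∃ c, ℓ c = 0 ∧ ξ = Z q c := by
    intro q ξ hξ
    obtain ⟨c, rfl⟩ := (Submodule.mem_span_range_iff_exists_fun ℝ).1 hξ
    exact ⟨(0, c), by simp [hℓ1], by simp [hZ]⟩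
  have hinv : ∀ᶠ q in 𝓝 p, ∀ e e', ∃ c, ℓ c = 0 ∧
      lieBracket ℝ (fun q => Z q e) (fun q => Z q e') q = Z q c := by
    filter_upwards [hZs, hbC, hb] with q hZq hbC hb
    have hbr : ∀ e e', lieBracket ℝ (fun q => Z q e) (fun q => Z q e') q =
        fderiv ℝ Z q (Z q e) e' - fderiv ℝ Z q (Z q e') e := by
      intro e e'
      have h : ∀ e η, fderiv ℝ (fun q => Z q e) q η = fderiv ℝ Z q η e := by
        intro e η
        rw [((hasFDerivAt_of_contDiffAt hZq).clm_apply (hasFDerivAt_const e q)).fderiv]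
        simp
      simp only [lieBracket, h]
    -- the bracket of the fields with constant coefficients is bilinear in the coefficients
    let β : (ℝ × (Fin r → ℝ)) →ₗ[ℝ] (ℝ × (Fin r → ℝ)) →ₗ[ℝ] V :=
      LinearMap.mk₂ ℝ (fun e e' => fderiv ℝ Z q (Z q e) e' - fderiv ℝ Z q (Z q e') e)
        (fun _ _ _ => by simp only [map_add, add_apply]; abel)
        (fun _ _ _ => by simp only [map_smul, smul_apply, smul_sub])
        (fun _ _ _ => by simp only [map_add, add_apply]; abel)
        (fun _ _ _ => by simp only [map_smul, smul_apply, smul_sub])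
    have hβ : ∀ e e', β e e' = lieBracket ℝ (fun q => Z q e) (fun q => Z q e') q :=
      fun e e' => (hbr e e').symm
    intro e e'
    rw [← hβ]
    refine hspan q _ ?_
    set P := Submodule.span ℝ (range fun i => f i q)
    have h11 : β (1, 0) (1, 0) ∈ P := by
      rw [hβ, lieBracket_self]
      exact Submodule.zero_mem _
    have h12 : ∀ i, β (1, 0) (0, Pi.single i 1) ∈ P := fun i => by
      rw [hβ]
      simp only [hZ1, hZ2]
      exact hbC i
    have h21 : ∀ i, β (0, Pi.single i 1) (1, 0) ∈ P := fun i => by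
      rw [hβ, lieBracket_swap, ← hβ]
      exact Submodule.neg_mem _ (h12 i)
    have h22 : ∀ i j, β (0, Pi.single i 1) (0, Pi.single j 1) ∈ P := fun i j => by
      rw [hβ]
      simp only [hZ2]
      exact hb i j
    rw [hdecomp e, hdecomp e']
    simp only [map_add, map_sum, map_smul, LinearMap.add_apply, LinearMap.sum_apply,
      LinearMap.smul_apply]
    refine Submodule.add_mem _ (Submodule.smul_mem _ _ (Submodule.add_mem _ ?_ ?_))
      (Submodule.sum_mem _ fun j _ => Submodule.smul_mem _ _ (Submodule.add_mem _ ?_ ?_))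
    · exact Submodule.smul_mem _ _ h11
    · exact Submodule.sum_mem _ fun i _ => Submodule.smul_mem _ _ (h21 i)
    · exact Submodule.smul_mem _ _ (h12 j)
    · exact Submodule.sum_mem _ fun i _ => Submodule.smul_mem _ _ (h22 i j)
  have hφp := hφ.self_of_nhds
  have hZp' := hZs.self_of_nhds
  set A : V → (ℝ × (Fin r → ℝ)) →L[ℝ] ℝ := fun q => fderiv ℝ φ q ∘L Z q - φ q • ℓ with hAdef
  have hA : ContDiffAt ℝ ∞ A p :=
    ((hφp.fderiv_right (m := ∞) (by simp)).clm_comp hZp').sub (hφp.smul contDiffAt_const)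
  have hAe : ∀ q e, A q e = fderiv ℝ φ q (Z q e) - ℓ e * φ q := fun q e => by
    simp [hAdef, mul_comm]
  have hAd : ∀ e η, fderiv ℝ (fun q => A q e) p η = fderiv ℝ A p η e := by
    intro e η
    rw [((hasFDerivAt_of_contDiffAt hA).clm_apply (hasFDerivAt_const e p)).fderiv]
    simp
  have hA1 : (fun q => A q (1, 0)) = fun q => fderiv ℝ φ q (c₀ q) - 2 * φ q := by
    funext q
    rw [hAe, hZ1, hℓ1, mul_one]
  have hA2 : ∀ i, (fun q => A q (0, Pi.single i 1)) = fun q => fderiv ℝ φ q (f i q) := by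
    intro i
    funext q
    rw [hAe, hZ2, hℓ1]
    simp
  have hext : ∀ L : (ℝ × (Fin r → ℝ)) →L[ℝ] ℝ, L (1, 0) = 0 →
      (∀ i, L (0, Pi.single i 1) = 0) → ∀ e, L e = 0 := by
    intro L hL1 hL2 e
    rw [hdecomp e, map_add, map_sum, map_smul, hL1]
    simp only [map_smul, hL2, smul_zero, Finset.sum_const_zero, add_zero]
  -- the first prolongation, for all coefficients at once
  have hA0 : ∀ e, A p e = 0 := hext _ ((congrFun hA1 p).trans (by rw [h0C, sub_self]))
    fun i => (congrFun (hA2 i) p).trans (h0 i)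
  have hA' : ∀ e, fderiv ℝ (fun q => A q e) p = 0 := by
    intro e
    ext η
    rw [hAd]
    refine hext _ ?_ ?_ e
    · rw [← hAd, hA1, h1C]; rfl
    · intro i
      rw [← hAd, hA2, h1]; rfl
  obtain ⟨E, hE, hEq, -, -, hE2⟩ := exists_solution_of_jet Z ℓ p hZs hZp hinv φ hφ
    (fun c => sub_eq_zero.1 ((hAe p c).symm.trans (hA0 c)))
    (fun c => by rw [← hA' c]; simp only [hAe])
  refine ⟨E, hE, ?_, hE2⟩
  filter_upwards [hEq] with q hq
  refine ⟨by rw [← hZ1, hq, hℓ1, mul_one], fun i => by rw [← hZ2, hq, hℓ1]; simp⟩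

end

section

variable {G : Type*} [NormedAddCommGroup G] [NormedSpace ℝ G]

/-- Euler's relation on a convex set integrates to homogeneity along the fibres. -/
theorem homogeneous_of_euler {E : G × G → ℝ} {B : Set (G × G)} (hB : Convex ℝ B) (hBo : IsOpen B)
    (hE : ∀ q ∈ B, ContDiffAt ℝ ∞ E q) (hEuler : ∀ q ∈ B, vder E q q.2 = 2 * E q) {x y : G}
    {c : ℝ} (hc : 0 < c) (h1 : (x, y) ∈ B) (h2 : (x, c • y) ∈ B) :
    E (x, c • y) = c ^ 2 * E (x, y) := by
  set s : Set ℝ := {t | 0 < t ∧ (x, t • y) ∈ B}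
  have hs : IsOpen s := isOpen_Ioi.inter
    (hBo.preimage (by fun_prop : Continuous fun t : ℝ => (x, t • y)))
  have hsc : Convex ℝ s := by
    intro a ha b hb α β hα hβ hαβ
    refine ⟨(convex_Ioi (0 : ℝ)) ha.1 hb.1 hα hβ hαβ, ?_⟩
    have h := hB ha.2 hb.2 hα hβ hαβ
    convert h using 1
    ext
    · simp [← add_smul, hαβ]
    · simp [add_smul, smul_smul]
  have hline : ∀ t : ℝ, HasDerivAt (fun t : ℝ => (x, t • y)) ((0 : G), y) t := fun t => by
    simpa using (hasDerivAt_const t x).prodMk ((hasDerivAt_id t).smul_const y)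
  have hd : ∀ t ∈ s, HasDerivAt (fun t : ℝ => E (x, t • y) / t ^ 2) 0 t := by
    intro t ht
    have h3 : HasDerivAt (fun t : ℝ => E (x, t • y)) (vder E (x, t • y) y) t :=
      (hasFDerivAt_of_contDiffAt (hE _ ht.2)).comp_hasDerivAt t (hline t)
    have h4 := hEuler _ ht.2
    simp only [map_smul, smul_eq_mul] at h4
    have ht0 : t ≠ 0 := ht.1.ne'
    have h5 := h3.div (hasDerivAt_pow 2 t) (pow_ne_zero 2 ht0)
    have h6 : (vder E (x, t • y) y * t ^ 2 - E (x, t • y) * (((2 : ℕ) : ℝ) * t ^ (2 - 1))) /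
        (t ^ 2) ^ 2 = 0 := by
      rw [div_eq_zero_iff]
      left
      push_cast
      linear_combination t * h4
    rw [h6] at h5
    exact h5
  have h3 := hs.is_const_of_deriv_eq_zero hsc.isPreconnected
    (fun t ht => (hd t ht).differentiableAt.differentiableWithinAt) (fun t ht => (hd t ht).deriv)
    (show c ∈ s from ⟨hc, h2⟩) (show (1 : ℝ) ∈ s from ⟨one_pos, by rwa [one_smul]⟩)
  simp only [one_smul, one_pow, div_one] at h3
  rw [div_eq_iff (by positivity)] at h3
  rw [h3, mul_comm]

/-- Positive definiteness of a continuous family of bilinear forms is an open condition. -/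
theorem eventually_posDef [FiniteDimensional ℝ G] {V : Type*} [TopologicalSpace V]
    {g : V → G →L[ℝ] G →L[ℝ] ℝ} {p : V} (hg : ContinuousAt g p) (h : ∀ a ≠ 0, 0 < g p a a) :
    ∀ᶠ q in 𝓝 p, ∀ a ≠ 0, 0 < g q a a := by
  have hcont : ∀ a : G, ContinuousAt (fun z : V × G => g z.1 z.2 z.2) (p, a) := fun a => by
    have h1 : ContinuousAt (fun z : V × G => g z.1) (p, a) :=
      ContinuousAt.comp (f := Prod.fst) (x := (p, a)) hg continuousAt_fst
    exact (h1.clm_apply continuousAt_snd).clm_apply continuousAt_snd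
  have h1 : ∀ᶠ q in 𝓝 p, ∀ a ∈ Metric.sphere (0 : G) 1, 0 < g q a a := by
    have := FiniteDimensional.proper_real G
    refine (isCompact_sphere (0 : G) 1).eventually_forall_of_forall_eventually fun a ha => ?_
    refine (hcont a).eventually (lt_mem_nhds (h a ?_))
    rintro rfl
    simp at ha
  filter_upwards [h1] with q hq a ha
  have hna : 0 < ‖a‖ := norm_pos_iff.2 ha
  have h2 := hq (‖a‖⁻¹ • a) (by simp [norm_smul, hna.ne'])
  simp only [map_smul, smul_apply, smul_eq_mul] at h2
  have h3 : 0 < ‖a‖⁻¹ := inv_pos.2 hna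
  exact (mul_pos_iff_of_pos_left h3).1 ((mul_pos_iff_of_pos_left h3).1 h2)

end

/-! ### A local frame of generated fields -/

section

variable {v w : TM n M} {U : Set (TM n M)} {S : VF n M} {σ : Model n → EuclideanSpace ℝ (Fin n)}

/-- The distribution `𝔏` in the coordinates of `v`. -/
def coordL (S : VF n M) (v w : TM n M) : Submodule ℝ (Model n) :=
  (distL S w).map (dcoord v w : TangentSpace (𝓡 n).tangent w →ₗ[ℝ] Model n)

theorem finrank_coordL (hw : w ∈ coordSource v) :
    Module.finrank ℝ (coordL S v w) = Module.finrank ℝ (distL S w) := by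
  obtain ⟨e, he⟩ := isInvertible_dcoord hw
  rw [coordL, ← he]
  exact LinearEquiv.finrank_map_eq e.toLinearEquiv (distL S w)

theorem dcoord_mem_coordL {ξ : TangentSpace (𝓡 n).tangent w} (hξ : ξ ∈ distL S w) :
    dcoord v w ξ ∈ coordL S v w := Submodule.mem_map_of_mem hξ

theorem mem_distL_of_dcoord_mem (hw : w ∈ coordSource v) {ξ : TangentSpace (𝓡 n).tangent w}
    (hξ : dcoord v w ξ ∈ coordL S v w) : ξ ∈ distL S w := by
  obtain ⟨η, hη, h⟩ := hξ
  rwa [← dcoord_injective hw h]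

theorem coord_snd_ne_zero_iff (hw : w ∈ coordSource v) :
    (coord v w).2 ≠ 0 ↔ w ∈ slit n M := by
  obtain ⟨e, he⟩ := isInvertible_dbase (mem_coordSource_iff.1 hw)
  rw [coord_snd hw, ← he]
  exact e.map_eq_zero_iff.not

/-- Where `𝔏` has constant rank it has a local frame of generated fields. -/
theorem exists_frame (hS : IsAnalyticSpray S) (hv : v ∈ slit n M) {r : ℕ}
    (hrank : ∀ᶠ w in 𝓝 v, Module.finrank ℝ (distL S w) = r) :
    ∃ (U : Set (TM n M)) (σ : Model n → EuclideanSpace ℝ (Fin n)) (X : Fin r → VF n M)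
      (f : Fin r → Model n → Model n), v ∈ U ∧ U ⊆ slit n M ∧ IsSprayRep S v U σ ∧
      (∀ i, Generated S U (X i)) ∧ (∀ i, IsRep v U (X i) (f i)) ∧
      LinearIndependent ℝ (fun i => f i (coord v v)) ∧
      ∀ w ∈ U, coordL S v w = Submodule.span ℝ (range fun i => f i (coord v w)) := by
  have hvs := mem_coordSource v
  set s : Set (Model n) := dcoord v v '' {ξ | ∃ (U : Set (TM n M)) (X : VF n M),
    IsOpen U ∧ v ∈ U ∧ U ⊆ slit n M ∧ Generated S U X ∧ X v = ξ}
  have hs : coordL S v v = Submodule.span ℝ s := Submodule.map_span _ _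
  obtain ⟨f₀, hf₀, -, hli⟩ := Submodule.exists_fun_fin_finrank_span_eq ℝ s
  have hr : Module.finrank ℝ (Submodule.span ℝ s) = r := by
    rw [← hs, finrank_coordL hvs, hrank.self_of_nhds]
  have hbasis := Submodule.exists_fun_fin_finrank_span_eq ℝ s
  rw [hr] at hbasis
  obtain ⟨f₀, hf₀, -, hli⟩ := hbasis
  choose ξ hξ hξf using hf₀
  choose U₀ X hU₀ hvU₀ hU₀s hX hXξ using hξ
  have hslit : ∀ᶠ w in 𝓝 v, w ∈ slit n M := by
    have h1 : ∀ᶠ w in 𝓝 v, (coord v w).2 ≠ 0 :=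
      ((tendsto_coord hvs).snd_nhds).eventually_ne ((coord_snd_ne_zero_iff hvs).2 hv)
    filter_upwards [h1, (isOpen_coordSource v).mem_nhds hvs] with w h1 h2
    exact (coord_snd_ne_zero_iff h2).1 h1
  obtain ⟨U₁, hU₁, hU₁o, hvU₁⟩ := mem_nhds_iff.1 hslit
  set U₂ := (U₁ ∩ coordSource v) ∩ ⋂ i, U₀ i
  have hU₂ : IsOpen U₂ :=
    (hU₁o.inter (isOpen_coordSource v)).inter (isOpen_iInter_of_finite hU₀)
  have hvU₂ : v ∈ U₂ := ⟨⟨hvU₁, hvs⟩, mem_iInter.2 hvU₀⟩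
  have hU₂s : U₂ ⊆ coordSource v := fun w hw => hw.1.2
  have hU₂slit : U₂ ⊆ slit n M := fun w hw => hU₁ hw.1.1
  obtain ⟨σ, hσ⟩ := hS.exists_isSprayRep hU₂ hU₂s hU₂slit
  have hX₂ : ∀ i, Generated S U₂ (X i) := fun i =>
    (hX i).mono (inter_subset_right.trans (iInter_subset _ i))
  choose f hf using fun i => (hX₂ i).exists_isRep hσ
  have hfv : (fun i => f i (coord v v)) = f₀ := by
    funext i
    rw [← (hf i v hvU₂).1, hXξ, hξf]
  have hcont : ContinuousAt (fun w i => f i (coord v w)) v :=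
    continuousAt_pi.2 fun i => ContinuousAt.comp (g := f i) (f := coord v)
      (hf i v hvU₂).2.continuousAt (tendsto_coord hvs)
  have hliev : ∀ᶠ w in 𝓝 v, LinearIndependent ℝ fun i => f i (coord v w) :=
    hcont.eventually (isOpen_setOfPred_linearIndependent.mem_nhds (by
      change LinearIndependent ℝ fun i => f i (coord v v)
      rwa [hfv]))
  obtain ⟨U, hU, hUo, hvU⟩ := mem_nhds_iff.1
    ((hliev.and hrank).and (hU₂.mem_nhds hvU₂))
  have hUU₂ : U ⊆ U₂ := fun w hw => (hU hw).2
  refine ⟨U, σ, X, f, hvU, hUU₂.trans hU₂slit, hσ.mono hUo hUU₂, fun i => (hX₂ i).mono hUU₂,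
    fun i => (hf i).mono hUU₂, by rwa [hfv], fun w hw => ?_⟩
  obtain ⟨⟨h1, h2⟩, h3⟩ := hU hw
  refine (Submodule.eq_of_le_of_finrank_eq ?_ ?_).symm
  · refine Submodule.span_le.2 ?_
    rintro _ ⟨i, rfl⟩
    change f i (coord v w) ∈ coordL S v w
    rw [← (hf i w h3).1]
    exact dcoord_mem_coordL ((hX₂ i).mem_distL hU₂ hU₂slit h3)
  · rw [finrank_span_eq_card h1, Fintype.card_fin, finrank_coordL (hU₂s h3), h2]

end

/-! ### Jets in coordinates -/

section

variable {v : TM n M} {U : Set (TM n M)} {φ ψ : TM n M → ℝ} {F G : Model n → ℝ}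

theorem IsFunRep.eventuallyEq (hU : IsOpen U) (hφ : IsFunRep v U φ F) (hv : v ∈ U) :
    φ ∘ coordSymm v =ᶠ[𝓝 (coord v v)] F := by
  have hvs := mem_coordSource v
  filter_upwards [(tendsto_coordSymm hvs).eventually (hU.mem_nhds hv), coord_coordSymm hvs]
    with u h1 h2
  rw [Function.comp_apply, (hφ _ h1).1, h2]

theorem SameJet.iteratedFDeriv_eq {k : ℕ} (h : SameJet k v φ ψ) (hU : IsOpen U) (hv : v ∈ U)
    (hφ : IsFunRep v U φ F) (hψ : IsFunRep v U ψ G) {i : ℕ} (hi : i ≤ k) :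
    iteratedFDeriv ℝ i F (coord v v) = iteratedFDeriv ℝ i G (coord v v) := by
  have h1 := ((hφ.eventuallyEq hU hv).iteratedFDeriv ℝ i).eq_of_nhds
  have h2 := ((hψ.eventuallyEq hU hv).iteratedFDeriv ℝ i).eq_of_nhds
  rw [← h1, ← h2]
  exact h i hi

theorem isFunRep_zero : IsFunRep v U (0 : TM n M → ℝ) 0 := fun _ _ => ⟨rfl, contDiffAt_const⟩

theorem SameJet.fderiv_eq_zero (h : SameJet 1 v φ 0) (hU : IsOpen U) (hv : v ∈ U)
    (hφ : IsFunRep v U φ F) : F (coord v v) = 0 ∧ fderiv ℝ F (coord v v) = 0 := by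
  constructor
  · have := congrArg (fun L => L 0)
      (h.iteratedFDeriv_eq hU hv hφ isFunRep_zero (i := 0) (by simp))
    simpa using this
  · refine ContinuousLinearMap.ext fun a => ?_
    have := congrArg (fun L => L fun _ => a)
      (h.iteratedFDeriv_eq hU hv hφ isFunRep_zero (i := 1) le_rfl)
    simpa using this

theorem SameJet.fderiv_fderiv_eq (h : SameJet 2 v φ ψ) (hU : IsOpen U) (hv : v ∈ U)
    (hφ : IsFunRep v U φ F) (hψ : IsFunRep v U ψ G) :
    fderiv ℝ (fderiv ℝ F) (coord v v) = fderiv ℝ (fderiv ℝ G) (coord v v) := by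
  refine ContinuousLinearMap.ext fun a => ContinuousLinearMap.ext fun b => ?_
  have := congrArg (fun L => L ![a, b]) (h.iteratedFDeriv_eq hU hv hφ hψ (i := 2) le_rfl)
  simpa [iteratedFDeriv_two_apply] using this

end

/-! ### Sufficiency of the conditions -/

section

variable {v : TM n M} {S : VF n M}

/-- The energy: a solution of the reduced system near `v`, in coordinates, whose fundamental tensor
at `v` is the one of the given positive definite initial condition. -/
theorem exists_energy (hS : IsAnalyticSpray S) (hv : v ∈ slit n M) {r : ℕ}
    (hrank : ∀ᶠ w in 𝓝 v, Module.finrank ℝ (distL S w) = r) (hC : C v ∉ distL S v)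
    {p : JetSpace 2 v} (hp : p ∈ prolongedKernel S v) (hpos : PosDefJet v p) :
    ∃ (U : Set (TM n M)) (σ : Model n → EuclideanSpace ℝ (Fin n)) (E : Model n → ℝ),
      v ∈ U ∧ U ⊆ slit n M ∧ IsSprayRep S v U σ ∧ (∀ w ∈ U, ContDiffAt ℝ ∞ E (coord v w)) ∧
      (∀ w ∈ U, vder E (coord v w) (coord v w).2 = 2 * E (coord v w)) ∧
      (∀ w ∈ U, ∀ ξ ∈ coordL S v w, fderiv ℝ E (coord v w) ξ = 0) ∧
      ∀ a ≠ 0, 0 < vder (vder E) (coord v v) a a := by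
  obtain ⟨U, σ, X, f, hvU, hUslit, hσ, hX, hf, hli, hspan⟩ := exists_frame hS hv hrank
  have hU := hσ.isOpen
  have hUs := hσ.subset
  have hvs := mem_coordSource v
  have hev : ∀ {P : Model n → Prop}, (∀ w ∈ U, P (coord v w)) → ∀ᶠ q in 𝓝 (coord v v), P q :=
    fun h => eventually_coord hvs (by filter_upwards [hU.mem_nhds hvU] with w hw using h w hw)
  obtain ⟨φ, rfl, hφC, hφL⟩ := hp
  obtain ⟨ψ, hψ, hψpos⟩ := hpos
  have hjet : SameJet 2 v ψ.1 φ.1 := Quotient.exact hψ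
  obtain ⟨U₁, hU₁, hvU₁, hφs⟩ := φ.2
  obtain ⟨U₂, hU₂, hvU₂, hψs⟩ := ψ.2
  set U' := (U ∩ U₁) ∩ U₂
  have hU' : IsOpen U' := (hU.inter hU₁).inter hU₂
  have hvU' : v ∈ U' := ⟨⟨hvU, hvU₁⟩, hvU₂⟩
  have hsub : U' ⊆ U := fun w hw => hw.1.1
  have hU's : U' ⊆ coordSource v := hsub.trans hUs
  have hφr := SmoothFunOn.isFunRep hU' hU's (ContMDiffOn.mono hφs fun w hw => hw.1.2)
  have hψr := SmoothFunOn.isFunRep hU' hU's (ContMDiffOn.mono hψs fun w hw => hw.2)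
  set F := φ.1 ∘ coordSymm v
  have hPc : IsFunRep v U' (Pc φ.1) fun q => fderiv ℝ F q (flatC q) - 2 * F q := fun w hw => by
    obtain ⟨h1, h2⟩ := hφr.lieD hU' hU's (isRep_C hU's) w hw
    refine ⟨?_, h2.sub (contDiffAt_const.mul (hφr w hw).2)⟩
    rw [Pc, h1, (hφr w hw).1]
  obtain ⟨h0C, h1C⟩ := hφC.fderiv_eq_zero hU' hvU' hPc
  have hsec : ∀ i, SameJet 1 v (lieD (X i) φ.1) 0 := fun i => hφL U (X i) hU hvU hUslit
    ⟨(hf i).regularOn hU hUs, fun w hw => (hX i).mem_distL hU hUslit hw⟩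
  have h01 := fun i => (hsec i).fderiv_eq_zero hU' hvU'
    (hφr.lieD hU' hU's ((hf i).mono hsub))
  have hCspan : flatC (coord v v) ∉ Submodule.span ℝ (range fun i => f i (coord v v)) := by
    intro h
    rw [← hspan v hvU, ← (isRep_C hUs v hvU).1] at h
    exact hC (mem_distL_of_dcoord_mem hvs h)
  have hbC : ∀ᶠ q in 𝓝 (coord v v), ∀ i, VectorField.lieBracket ℝ flatC (f i) q ∈
      Submodule.span ℝ (range fun i => f i q) := by
    refine hev fun w hw i => ?_
    obtain ⟨B, hB, hB'⟩ := (hX i).exists_bracket_C hσ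
    rw [← ((isRep_C hUs).bracket hU hUs (hf i) w hw).1, ← hspan w hw, hB' hw]
    exact dcoord_mem_coordL (mem_distL_of_mem_genSpan hU hUslit hB hw)
  have hb : ∀ᶠ q in 𝓝 (coord v v), ∀ i j, VectorField.lieBracket ℝ (f i) (f j) q ∈
      Submodule.span ℝ (range fun i => f i q) := by
    refine hev fun w hw i j => ?_
    rw [← ((hf i).bracket hU hUs (hf j) w hw).1, ← hspan w hw]
    exact dcoord_mem_coordL ((Generated.lie _ _ (hX i) (hX j)).mem_distL hU hUslit hw)
  obtain ⟨E, hEs, hEeq, hE2⟩ := exists_solution_of_frame flatC f (coord v v)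
    (.of_forall fun _ => contDiffAt_flatC) (hev fun w hw i => (hf i w hw).2) hli hCspan hbC hb F
    (hφr.eventually hU' hU's hvU') (sub_eq_zero.1 h0C) (fun i => (h01 i).1) h1C
    (fun i => (h01 i).2)
  obtain ⟨U₃, hU₃, hU₃o, hvU₃⟩ := mem_nhds_iff.1
    (((tendsto_coord hvs).eventually (hEs.and hEeq)).and (hU.mem_nhds hvU))
  refine ⟨U₃, σ, E, hvU₃, fun w hw => hUslit (hU₃ hw).2, hσ.mono hU₃o fun w hw => (hU₃ hw).2,
    fun w hw => (hU₃ hw).1.1, fun w hw => (hU₃ hw).1.2.1, fun w hw ξ hξ => ?_, fun a ha => ?_⟩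
  · obtain ⟨⟨-, -, h1⟩, h2⟩ := hU₃ hw
    rw [hspan w h2] at hξ
    have hle : Submodule.span ℝ (range fun i => f i (coord v w)) ≤
        LinearMap.ker (fderiv ℝ E (coord v w) : Model n →ₗ[ℝ] ℝ) := by
      refine Submodule.span_le.2 ?_
      rintro _ ⟨i, rfl⟩
      exact h1 i
    exact hle hξ
  · -- `E` and the initial condition have the same second derivatives at `v`
    obtain ⟨e, he⟩ := isInvertible_dbase (mem_coordSource_iff.1 hvs)
    have h1 := hψpos (e.symm a) (by simpa using ha)
    rw [hψr.fund_eq hU' hU's hvU', ← he] at h1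
    change 0 < vder (vder (ψ.1 ∘ coordSymm v)) (coord v v) (e (e.symm a)) (e (e.symm a)) at h1
    rw [e.apply_symm_apply] at h1
    rw [vder_apply, fderiv_vder_apply (hψr v hvU').2, hjet.fderiv_fderiv_eq hU' hvU' hψr hφr,
      ← hE2] at h1
    rwa [vder_apply, fderiv_vder_apply hEs.self_of_nhds]

/-- The square root of twice the energy is a Finsler metric on a small convex coordinate domain; it
solves the Euler–Lagrange equation because the energy is constant along the horizontal
distribution, and it is of Landsberg type because the energy is annihilated by the curvature. -/
theorem landsbergMetrizableNear_of_jet (hS : IsAnalyticSpray S) (hv : v ∈ slit n M) {r : ℕ}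
    (hrank : ∀ᶠ w in 𝓝 v, Module.finrank ℝ (distL S w) = r) (hC : C v ∉ distL S v)
    {p : JetSpace 2 v} (hp : p ∈ prolongedKernel S v) (hpos : PosDefJet v p) :
    LandsbergMetrizableNear S v := by
  obtain ⟨U, σ, E, hvU, hUslit, hσ, hEs, hEuler, hEL, hg⟩ := exists_energy hS hv hrank hC hp hpos
  have hU := hσ.isOpen
  have hUs := hσ.subset
  have hvs := mem_coordSource v
  have hev : ∀ {P : Model n → Prop}, (∀ w ∈ U, P (coord v w)) → ∀ w ∈ U,
      ∀ᶠ q in 𝓝 (coord v w), P q := fun h w hw =>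
    eventually_coord (hUs hw) (by filter_upwards [hU.mem_nhds hw] with w hw using h w hw)
  have hconst : ∀ a : EuclideanSpace ℝ (Fin n),
      ∃ X, IsRep v U X fun _ => ((a, 0) : Model n) := fun a =>
    exists_isRep hUs fun _ _ => contDiffAt_const
  have hhor : ∀ w ∈ U, HorConst σ E (coord v w) := by
    refine fun w hw => hev (fun w hw a => ?_) w hw
    obtain ⟨X, hX⟩ := hconst a
    have h1 := hEL w hw _ (dcoord_mem_coordL
      ((Generated.horizontal X (hX.regularOn hU hUs)).mem_distL hU hUslit hw))
    rwa [(hσ.hor hX w hw).1] at h1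
  have hcurv : ∀ w ∈ U, ∀ a b c,
      vder E (coord v w) (vder (vder (conn σ)) (coord v w) a b c) = 0 := by
    intro w hw a b c
    obtain ⟨X, hX⟩ := hconst c
    obtain ⟨Y, hY⟩ := hconst a
    obtain ⟨Z, hZ⟩ := hconst b
    have h1 := hEL w hw _ (dcoord_mem_coordL ((Generated.curvature X Y Z (hX.regularOn hU hUs)
      (hY.regularOn hU hUs) (hZ.regularOn hU hUs)).mem_distL hU hUslit hw))
    rw [(hσ.berwald hX hY hZ w hw).1] at h1
    change vder E (coord v w) (-_) = 0 at h1
    rwa [map_neg, neg_eq_zero] at h1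
  -- Euler's relation gives `2 E = g(y, y)` at `v`
  have hEpos : 0 < E (coord v v) := by
    have h1 := vder_vder_self (κ := 2) (hEs v hvU) (hev hEuler v hvU)
    have h2 := hg _ ((coord_snd_ne_zero_iff hvs).2 hv)
    rw [h1, smul_apply, hEuler v hvU, smul_eq_mul] at h2
    linarith
  have hposdef : ∀ᶠ q in 𝓝 (coord v v), ∀ a ≠ 0, 0 < vder (vder E) q a a :=
    eventually_posDef (contDiffAt_vder (contDiffAt_vder (hEs v hvU))).continuousAt hg
  have hsym : ∀ᶠ q in 𝓝 (coord v v), coordSymm v q ∈ U ∧ coord v (coordSymm v q) = q :=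
    ((tendsto_coordSymm hvs).eventually (hU.mem_nhds hvU)).and (coord_coordSymm hvs)
  obtain ⟨ε, hε, hball⟩ := Metric.eventually_nhds_iff_ball.1
    ((hposdef.and ((hEs v hvU).continuousAt.eventually (lt_mem_nhds hEpos))).and hsym)
  -- the domain of the metric corresponds to a convex set, so that the fibre segments in it are
  -- connected
  set B := Metric.ball (coord v v) ε
  set U' := {w | w ∈ coordSource v ∧ coord v w ∈ B}
  have hU' : IsOpen U' := by
    refine isOpen_iff_mem_nhds.2 fun w hw => ?_
    filter_upwards [(isOpen_coordSource v).mem_nhds hw.1,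
      (tendsto_coord hw.1).eventually (Metric.isOpen_ball.mem_nhds hw.2)] with w h1 h2
    exact ⟨h1, h2⟩
  have hsub : U' ⊆ U := fun w hw => by
    have := (hball _ hw.2).2.1
    rwa [coordSymm_coord hw.1] at this
  have hvU' : v ∈ U' := ⟨hvs, Metric.mem_ball_self hε⟩
  have hU's : U' ⊆ coordSource v := hsub.trans hUs
  have hpos' : ∀ w ∈ U', 0 < E (coord v w) := fun w hw => (hball _ hw.2).1.2
  set F : TM n M → ℝ := fun w => √(2 * E (coord v w)) with hF
  have hFr : IsFunRep v U' F fun q => √(2 * E q) := fun w hw =>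
    ⟨rfl, (contDiffAt_const.mul (hEs w (hsub hw))).sqrt (by have := hpos' w hw; positivity)⟩
  have henergy : IsFunRep v U' (energy F) E := fun w hw => by
    refine ⟨?_, hEs w (hsub hw)⟩
    have := hpos' w hw
    rw [energy, hF, Real.sq_sqrt (by positivity)]
    ring
  have hBE : ∀ q ∈ B, ContDiffAt ℝ ∞ E q ∧ vder E q q.2 = 2 * E q := fun q hq => by
    obtain ⟨h1, h2⟩ := (hball q hq).2
    have h3 := hEs _ h1
    have h4 := hEuler _ h1
    rw [h2] at h3 h4
    exact ⟨h3, h4⟩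
  refine ⟨U', hU', hvU', hsub.trans hUslit, F, ⟨hFr.smoothFunOn hU' hU's, ?_, ?_, ?_⟩, ?_, ?_⟩
  · intro w hw
    have := hpos' w hw
    exact Real.sqrt_pos.2 (by positivity)
  · intro w hw c hc hcw
    have h1 := hcw.2
    have h2 := hw.2
    have hcoord : coord v ⟨w.1, c • w.2⟩ = ((coord v w).1, c • (coord v w).2) := by
      rw [coord_fibre hw.1, map_smul, ← coord_snd hw.1]
    rw [hcoord] at h1
    have h3 : E ((coord v w).1, c • (coord v w).2) = c ^ 2 * E (coord v w) :=
      homogeneous_of_euler (convex_ball _ _) Metric.isOpen_ball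
        (fun q hq => (hBE q hq).1) (fun q hq => (hBE q hq).2) hc h2 h1
    simp only [hF]
    rw [hcoord, h3, mul_left_comm, Real.sqrt_mul (sq_nonneg c), Real.sqrt_sq hc.le]
  · intro w hw a ha
    rw [henergy.fund_eq hU' hU's hw]
    refine (hball _ hw.2).1.1 _ ?_
    obtain ⟨e, he⟩ := isInvertible_dbase (mem_coordSource_iff.1 hw.1)
    rw [← he]
    exact e.map_eq_zero_iff.not.2 ha
  · intro V hVU' hV X hX w hw
    have hσV := hσ.mono hV (hVU'.trans hsub)
    obtain ⟨f, hf⟩ := hX.exists_isRep hV hσV.subset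
    rw [Pe_eq hσV (henergy.mono hVU') hf hw, eulerLagrange_of_horConst (hσV.hom w hw)
      (hEs w (hsub (hVU' hw))) (hhor w (hsub (hVU' hw))), sub_self]
  · intro V hVU' hV X Y Z hX hY hZ w hw
    have hσV := hσ.mono hV (hVU'.trans hsub)
    obtain ⟨f, hf⟩ := hX.exists_isRep hV hσV.subset
    obtain ⟨g, hg⟩ := hY.exists_isRep hV hσV.subset
    obtain ⟨h, hh⟩ := hZ.exists_isRep hV hσV.subset
    rw [Pg_eq hσV (henergy.mono hVU') hf hg hh hw (hhor w (hsub (hVU' hw))),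
      hcurv w (hsub (hVU' hw))]

end

end SprayGeometry

end

theorem mainTheorem4 (n : ℕ) (M : Type*) [TopologicalSpace M]
    [ChartedSpace (EuclideanSpace ℝ (Fin n)) M] [IsManifold (𝓡 n) ω M]
    (S : SprayGeometry.VF n M) (hS : SprayGeometry.IsAnalyticSpray S)
    (v : SprayGeometry.TM n M) (hv : v ∈ SprayGeometry.slit n M)
    (r : ℕ) (hrank : ∀ᶠ w in 𝓝 v, Module.finrank ℝ (SprayGeometry.distL S w) = r) :
    SprayGeometry.LandsbergMetrizableNear S v ↔
      SprayGeometry.C v ∉ SprayGeometry.distL S v ∧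
        ∃ p ∈ SprayGeometry.prolongedKernel S v, SprayGeometry.PosDefJet v p :=
  ⟨fun h => h.necessary hS, fun ⟨hC, _, hp, hpos⟩ =>
    SprayGeometry.landsbergMetrizableNear_of_jet hS hv hrank hC hp hpos⟩
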